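/- **Setting.** Let $H_0$ be a self-adjoint operator on a complex Hilbert space $\mathcal H$ with a complete orthonormal sequence of eigenvectors $\psi_j$, $H_0\psi_j=\lambda_j\psi_j$ ($j\in\mathbb N=\{0,1,2,\dots\}$), let $\beta$ be a bounded self-adjoint operator with $\|\beta\|=1$, and let $g_0\in L^2(\mathbb R)$ be real valued, supported in $[0,T]$, with $\|g_0\|_{L^1}=1$. Let $d_0,d_1,\dots$ be i.i.d. nonnegative random variables with $\mathbb E\,e^{i(\lambda_j-\lambda_k)d_l}=0$ for all $l$ and all $j\ne k$. Put $t_n=\sum_{i<n}(d_i+T)+d_n$ and $g(t)=\sum_{n\ge0}g_0(t-t_n)$. Let $\phi_0$ be an initial state, deterministic or, more generally, random, independent of the sequence $(d_l)$ and with $\mathbb E\|\phi_0\|^2<\infty$. For $\varepsilon\in\mathbb R$ let $\phi$ be the (weak) solution on $[0,\infty)$ of $$i\partial_t\phi=H_0\phi+\varepsilon g(t)\beta\phi,\qquad \phi(0)=\phi_0 .$$ Write $P_k(0)=\mathbb E|\langle\psi_k,\phi_0\rangle|^2$ and let $P_k^{(n)}=\mathbb E|\langle\psi_k,\phi(t)\rangle|^2$,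 where $t$ is any (possibly random) time after the first $n$ defects and before the next one, $\sum_{i<n}(d_i+T)\le t\le t_n$ (the value does not depend on the choice of $t$). With $\alpha_{kj}=\langle\psi_k,\beta\psi_j\rangle$ and $\hat g_0(\xi)=\int e^{-i\xi t}g_0(t)\,dt$ let $$b_{kj}=-|\alpha_{kj}|^2|\hat g_0(-(\lambda_k-\lambda_j))|^2\ (j\neq k),\qquad b_{kk}=\sum_{l\ne k}|\alpha_{kl}|^2|\hat g_0(-(\lambda_k-\lambda_l))|^2 .$$ Let $I\subset\mathbb N$ be the set of modes of an irreducible subsystem with infinitely many bound states: $I$ is infinite, $b_{kj}=0$ for $k\in I$, $j\notin I$, and no nonempty proper subset $J\subset I$ has $b_{kj}=0$ for all $k\in J$, $j\in I\setminus J$. Call the subsystem *isolated* if moreover $\alpha_{kj}=0$ for all $k\in I$, $j\notin I$ (for instance, $I=\mathbb N$). From now on $P(0)$, $P^{(n)}$ and $B=(b_{kj})$ are restricted to the indices in $I$, and $E=\sum_{k\in I}P_k(0)$. **Statement.** $B$ is a bounded operator on $\ell^1(I)$, the vectors $P(0)$ and $P^{(n)}=P^{(n)}(\varepsilon)$ belong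 to $\ell^1(I)$, and the following hold for all sequences of pairs $(\varepsilon,n)$, $n\in\mathbb N$, with $\varepsilon\to0$. 1. If $n\varepsilon^2\to0$ (that is, $n\ll\varepsilon^{-2}$), then $P^{(n)}\to P(0)$ in $\ell^1(I)$, hence also in $\ell^2(I)$. 2. If $n\varepsilon^2\to\tau$ (that is, $n=\tau\varepsilon^{-2}$ up to lower order), then $P^{(n)}\to e^{-B\tau}P(0)$ in $\ell^1(I)$, hence also in $\ell^2(I)$. 3. If the subsystem is isolated, its total power is conserved: $\sum_{k\in I}P^{(n)}_k=E$ for all $n\ge0$ and all $\varepsilon\in\mathbb R$. 4. If $n\varepsilon^2\to\infty$ (that is, $n\gg\varepsilon^{-2}$) and, unless the subsystem is isolated, also $n|\varepsilon|^3\to0$, then $P^{(n)}\to0$ in $\ell^2(I)$ and $\sum_{k\in I}P_k^{(n)}\to E$; if $P(0)\ne0$, then $P^{(n)}$ does not converge in $\ell^1(I)$. The power flows to the high modes: for every fixed $N$, $$\sum_{k\in I,\,k\ge N}P_k^{(n)}\to E,\qquad \sum_{k\in I,\,k\le N}P_k^{(n)}\to0 .$$ -/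

import Mathlib

open MeasureTheory ProbabilityTheory Filter Topology
open scoped ENNReal

namespace PowerDiffusion

variable {H : Type*} [NormedAddCommGroup H] [InnerProductSpace ℂ H] [CompleteSpace H]
variable {Ω : Type*} [MeasurableSpace Ω]

/-- Hypothesis on the unperturbed Hamiltonian: `H₀` is a (possibly unbounded) self-adjoint operator
with a complete orthonormal system `ψ` of eigenvectors and real eigenvalues `lam`. -/
structure PurePoint (H₀ : H →ₗ.[ℂ] H) (lam : ℕ → ℝ) (ψ : HilbertBasis ℕ ℂ H) : Prop where
  selfAdjoint : IsSelfAdjoint H₀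
  eigen : ∀ j, ∃ h : ψ j ∈ H₀.domain, H₀ ⟨ψ j, h⟩ = (lam j : ℂ) • ψ j

/-- Hypothesis on the space part of the perturbation. -/
structure NormalizedCoupling (β : H →L[ℂ] H) : Prop where
  selfAdjoint : IsSelfAdjoint β
  norm_eq : ‖β‖ = 1

/-- Hypothesis on the profile of a single defect: real, square integrable, supported in `[0, T]`,
of `L¹` norm one. -/
structure DefectProfile (g₀ : ℝ → ℝ) (T : ℝ) : Prop where
  memLp : MemLp g₀ 2 volume
  support : ∀ t, t ∉ Set.Icc 0 T → g₀ t = 0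
  norm_eq : ∫ t, |g₀ t| = 1

/-- Hypothesis on the random gaps between the defects: i.i.d., nonnegative, and mixing the phases
of any two distinct modes. -/
structure PhaseMixing (μ : Measure Ω) (d : ℕ → Ω → ℝ) (lam : ℕ → ℝ) : Prop where
  measurable : ∀ l, Measurable (d l)
  indep : iIndepFun d μ
  ident : ∀ l, IdentDistrib (d l) (d 0) μ μ
  nonneg : ∀ l ω, 0 ≤ d l ω
  mixing : ∀ l j k, j ≠ k →
    ∫ ω, Complex.exp (Complex.I * ((lam j - lam k : ℝ) : ℂ) * (d l ω : ℂ)) ∂μ = 0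

/-- The end of the `n`-th defect (time `0` for `n = 0`): `∑_{i < n} (d_i + T)`. -/
noncomputable def gapStart (d : ℕ → Ω → ℝ) (T : ℝ) (n : ℕ) (ω : Ω) : ℝ :=
  ∑ i ∈ Finset.range n, (d i ω + T)

/-- The onset time `t_n = (d_0 + T) + ⋯ + (d_{n-1} + T) + d_n`. -/
noncomputable def onset (d : ℕ → Ω → ℝ) (T : ℝ) (n : ℕ) (ω : Ω) : ℝ :=
  gapStart d T n ω + d n ω

/-- The train of defects `g(t) = ∑_n g₀(t - t_n)`. For `T > 0` the sum is finite at every `t`. -/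
noncomputable def defectTrain (g₀ : ℝ → ℝ) (d : ℕ → Ω → ℝ) (T : ℝ) (ω : Ω) (t : ℝ) : ℝ :=
  ∑' n, g₀ (t - onset d T n ω)

/-- `φ` is the (weak, equivalently mild) solution on `[0, ∞)` of
`i ∂ₜ φ = H₀ φ + ε g(t) β φ`, `φ(0) = φ₀`: it is continuous in `H`, and the equation holds,
integrated in time, against every vector of the domain of the self-adjoint operator `H₀`.
(No pointwise derivative is asked for, since `g` is only locally square integrable and `φ₀` need
not lie in the domain of `H₀`.) -/
structure IsSolution (H₀ : H →ₗ.[ℂ] H) (β : H →L[ℂ] H) (ε : ℝ) (g : ℝ → ℝ) (φ₀ : H)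
    (φ : ℝ → H) : Prop where
  continuousOn : ContinuousOn φ (Set.Ici 0)
  initial : φ 0 = φ₀
  equation : ∀ (v : H₀.domain) (t : ℝ), 0 ≤ t →
    inner ℂ (v : H) (φ t) = inner ℂ (v : H) φ₀ - Complex.I *
      ∫ s in (0 : ℝ)..t,
        (inner ℂ (H₀ v) (φ s) + (ε : ℂ) * (g s : ℂ) * inner ℂ (v : H) (β (φ s)))

/-- Fourier transform `ĝ(ξ) = ∫ e^{-iξt} g(t) dt`. -/
noncomputable def fourierHat (g : ℝ → ℝ) (ξ : ℝ) : ℂ :=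
  ∫ t : ℝ, Complex.exp (-(Complex.I * (ξ : ℂ) * (t : ℂ))) * (g t : ℂ)

/-- `α_{kj} = ⟨ψ_k, β ψ_j⟩`. -/
noncomputable def coupling (ψ : HilbertBasis ℕ ℂ H) (β : H →L[ℂ] H) (k j : ℕ) : ℂ :=
  inner ℂ (ψ k) (β (ψ j))

/-- `|α_{kj}|² |ĝ₀(-(λ_k - λ_j))|²`. -/
noncomputable def rate (lam : ℕ → ℝ) (ψ : HilbertBasis ℕ ℂ H) (β : H →L[ℂ] H) (g₀ : ℝ → ℝ)
    (k j : ℕ) : ℝ :=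
  ‖coupling ψ β k j‖ ^ 2 * ‖fourierHat g₀ (-(lam k - lam j))‖ ^ 2

/-- The entries `b_{kj}` of the power transmission matrix `B`. -/
noncomputable def bEntry (lam : ℕ → ℝ) (ψ : HilbertBasis ℕ ℂ H) (β : H →L[ℂ] H) (g₀ : ℝ → ℝ)
    (k j : ℕ) : ℝ :=
  if j = k then ∑' l, (if l = k then 0 else rate lam ψ β g₀ k l) else -rate lam ψ β g₀ k j

/-- The set of modes `I` carries a diagonal block of the (symmetric) matrix `b`, and this block
cannot be decomposed further. -/
structure IsIrreducibleBlock (b : ℕ → ℕ → ℝ) (I : Set ℕ) : Prop where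
  block : ∀ k ∈ I, ∀ j ∉ I, b k j = 0
  irreducible : ∀ J ⊆ I, J.Nonempty → (∀ k ∈ J, ∀ j ∈ I \ J, b k j = 0) → J = I

/-- The modes in `I` span a subspace that reduces `β` (and `H₀`): no mode in `I` is coupled by `β`
to a mode outside `I`. -/
def IsIsolated (ψ : HilbertBasis ℕ ℂ H) (β : H →L[ℂ] H) (I : Set ℕ) : Prop :=
  ∀ k ∈ I, ∀ j ∉ I, coupling ψ β k j = 0

/-- `ℓ¹` over the modes of the subsystem `I`. -/
abbrev EllOne (I : Set ℕ) : Type := lp (fun _ : I => ℝ) 1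

/-- `ℓ²` over the modes of the subsystem `I`. -/
abbrev EllTwo (I : Set ℕ) : Type := lp (fun _ : I => ℝ) 2

/-- The inclusion of `ℓ¹` in `ℓ²`. -/
def toEllTwo {I : Set ℕ} (v : EllOne I) : EllTwo I :=
  ⟨fun k => v k, (lp.memℓp v).of_exponent_ge one_le_two⟩

/-- `n` defects with `n ≫ ε⁻²`, along a sequence of pairs `(ε, n)` with `ε → 0`. Unless the
subsystem is isolated, `n ≪ |ε|⁻³` is required as well. -/
structure LongRegime (isolated : Prop) (ε : ℕ → ℝ) (n : ℕ → ℕ) : Prop where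
  eps : Tendsto ε atTop (𝓝 0)
  long : Tendsto (fun m => (n m : ℝ) * ε m ^ 2) atTop atTop
  cutoff : isolated ∨ Tendsto (fun m => (n m : ℝ) * |ε m| ^ 3) atTop (𝓝 0)

end PowerDiffusion

/-! The random gaps turn the Schrödinger evolution into an exact Markov chain for the mean mode
powers. During a gap each mode only acquires a phase. The gap `d n` is independent of the state at
its beginning, and the mixing hypothesis makes the mean of every interference term between distinct
modes vanish. Hence the power vector is multiplied by the matrix `M ε` with entries `|⟨ψ_k, W
ψ_j⟩|²`, where `W` is the interaction-picture propagator of a single defect (`hasSum_power_succ`,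
`pow_stepMatrix_apply`). Since `W` is an isometry, the columns of `M ε` sum to one and its rows to
at most one, so `M ε` is a contraction of both `ℓ¹` and `ℓ²`.

The Born approximation of `W` gives `M ε = 1 - ε² B + O(|ε|³)` in the operator norm of `ℓ¹`, where
`K = 1 - B` is symmetric and stochastic (`stepMatrix_approx`). Telescoping then yields `‖(M ε)ⁿ -
e^{-nε²B}‖ ≤ C n |ε|³` (`exists_norm_pow_sub_exp_le`). This error vanishes whenever `nε²` converges,
which settles the regimes `nε² → 0` and `nε² → τ`. The block `I` is closed under `K`, so the limit
semigroup restricts to it.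

For long times one works in `ℓ²(I)`, where `K` is a self-adjoint contraction. By the maximum
principle, an irreducible stochastic matrix on infinitely many indices has no nonzero square
summable fixed vector (`IsSubstochastic.eq_zero_of_toEllTwo_eq`), so `e^{-sB} → 0` strongly
(`tendsto_exp_neg_smul_one_sub_apply`). If `n|ε|³ → 0`, the chain inherits this decay directly. If
the subsystem is isolated, `M ε` is block diagonal (`stepMatrix_eq_zero`): the total power is
conserved and the `ℓ²` norm decreases with `n`, so it is enough to make it small at an earlier step
number of order `ε⁻²`. Decay of every single mode together with persistence of the total power
forces the power to high modes and excludes an `ℓ¹` limit (`spreading`). -/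

namespace PowerDiffusion

/-! ### Operator exponentials: contraction bounds, telescoping, strong decay. -/

section Exponential

/-- The relation passes to powers and then to the exponential series. It serves to move the
semigroup from `ℕ` to the block and from `ℓ¹` to `ℓ²`, and, with `Y = 0`, to show that a functional
annihilating the generator is conserved. -/
theorem comp_exp_of_comp {E F : Type*} [NormedAddCommGroup E] [NormedSpace ℝ E] [CompleteSpace E]
    [NormedAddCommGroup F] [NormedSpace ℝ F] [CompleteSpace F]
    (L : E →L[ℝ] F) (X : E →L[ℝ] E) (Y : F →L[ℝ] F) (h : ∀ v, L (X v) = Y (L v)) (v : E) :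
    L (NormedSpace.exp X v) = NormedSpace.exp Y (L v) := by
  have hpow : ∀ (n : ℕ) (w : E), L ((X ^ n) w) = (Y ^ n) (L w) := by
    intro n
    induction n with
    | zero => intro w; simp
    | succ n ih =>
      intro w
      rw [pow_succ, pow_succ]
      change L ((X ^ n) (X w)) = (Y ^ n) (Y (L w))
      rw [ih, h]
  have hX := (NormedSpace.exp_series_hasSum_exp' (𝕂 := ℝ) X)
  have hY := (NormedSpace.exp_series_hasSum_exp' (𝕂 := ℝ) Y)
  have hX' := hX.mapL (ContinuousLinearMap.apply ℝ E v)
  have hX'' := hX'.mapL L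
  have hY' := hY.mapL (ContinuousLinearMap.apply ℝ F (L v))
  refine hX''.unique ?_
  convert! hY' using 2 with n
  change L ((n.factorial : ℝ)⁻¹ • (X ^ n) v) = (n.factorial : ℝ)⁻¹ • (Y ^ n) (L v)
  rw [map_smul, hpow]

theorem norm_exp_le_exp_norm {A : Type*} [NormedRing A] [NormOneClass A] [NormedAlgebra ℝ A]
    [CompleteSpace A] (x : A) : ‖NormedSpace.exp x‖ ≤ Real.exp ‖x‖ := by
  have h1 := NormedSpace.exp_series_hasSum_exp' (𝕂 := ℝ) x
  have h2 := NormedSpace.exp_series_hasSum_exp' (𝕂 := ℝ) ‖x‖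
  rw [← Real.exp_eq_exp_ℝ] at h2
  rw [← h1.tsum_eq]
  refine tsum_of_norm_bounded h2 fun n => ?_
  rw [norm_smul, smul_eq_mul]
  gcongr
  · simp
  · exact norm_pow_le x n

/-- The scalar part splits off: `e^{-s(1-K)} = e^{-s} e^{sK}`, and `‖e^{sK}‖ ≤ e^{s}`. -/
theorem norm_exp_neg_smul_one_sub_le {A : Type*} [NormedRing A] [NormOneClass A]
    [NormedAlgebra ℝ A] [CompleteSpace A] {K : A} (hK : ‖K‖ ≤ 1) {s : ℝ} (hs : 0 ≤ s) :
    ‖NormedSpace.exp (-(s • (1 - K)))‖ ≤ 1 := by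
  have h : -(s • (1 - K)) = algebraMap ℝ A (-s) + s • K := by
    rw [Algebra.algebraMap_eq_smul_one, smul_sub, neg_smul]; abel
  let : NormedAlgebra ℚ A := NormedAlgebra.restrictScalars ℚ ℝ A
  rw [h, NormedSpace.exp_add_of_commute (Algebra.commute_algebraMap_left _ _),
    ← NormedSpace.algebraMap_exp_comm (𝕂 := ℝ), ← Real.exp_eq_exp_ℝ]
  calc _ ≤ ‖algebraMap ℝ A (Real.exp (-s))‖ * ‖NormedSpace.exp (s • K)‖ := norm_mul_le _ _
    _ ≤ Real.exp (-s) * Real.exp s := by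
        gcongr
        · simp
        · refine (norm_exp_le_exp_norm _).trans (Real.exp_le_exp.2 ?_)
          rw [norm_smul, Real.norm_of_nonneg hs]
          nlinarith
    _ = 1 := by rw [← Real.exp_add]; simp

theorem exists_norm_exp_sub_one_sub_le (A : Type*) [NormedRing A]
    [NormedAlgebra ℝ A] [CompleteSpace A] :
    ∃ C δ : ℝ, 0 < δ ∧ ∀ x : A, ‖x‖ < δ → ‖NormedSpace.exp x - (1 + x)‖ ≤ C * ‖x‖ ^ 2 := by
  have h := (NormedSpace.exp_hasFPowerSeriesAt_zero (𝕂 := ℝ) (𝔸 := A)).isBigO_sub_partialSum_pow 2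
  obtain ⟨C, hC⟩ := h.bound
  obtain ⟨δ, hδ, hb⟩ := Metric.eventually_nhds_iff.1 hC
  refine ⟨C, δ, hδ, fun x hx => ?_⟩
  have := hb (y := x) (by simpa using hx)
  simpa [FormalMultilinearSeries.partialSum, Finset.sum_range_succ, NormedSpace.expSeries_apply_eq]
    using this

/-- Telescoping: replacing one factor at a time costs `‖a - b‖`, because the remaining factors are
contractions. -/
theorem norm_pow_sub_pow_le {A : Type*} [NormedRing A] [NormOneClass A] {a b : A} (ha : ‖a‖ ≤ 1)
    (hb : ‖b‖ ≤ 1) (n : ℕ) : ‖a ^ n - b ^ n‖ ≤ n * ‖a - b‖ := by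
  induction n with
  | zero => simp
  | succ n ih =>
    have h : a ^ (n + 1) - b ^ (n + 1) = a ^ n * (a - b) + (a ^ n - b ^ n) * b := by
      rw [pow_succ, pow_succ]; noncomm_ring
    have h1 : ‖a ^ n‖ ≤ 1 := (norm_pow_le a n).trans (pow_le_one₀ (norm_nonneg _) ha)
    rw [h]
    refine (norm_add_le _ _).trans ?_
    have h2 := norm_mul_le (a ^ n) (a - b)
    have h3 := norm_mul_le (a ^ n - b ^ n) b
    push_cast
    nlinarith [norm_nonneg (a - b), norm_nonneg (a ^ n - b ^ n), norm_nonneg b]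

/-- No spectral theorem is needed. With `B = 1 - K ≥ 0`, a Lyapunov function gives `‖e^{-sB} B w‖² =
O(1/s)`. The range of `B` is dense because `B` is self-adjoint and injective, and the uniform bound
`‖e^{-sB}‖ ≤ 1` extends the decay to all vectors. -/
theorem tendsto_exp_neg_smul_one_sub_apply {E : Type*} [NormedAddCommGroup E]
    [InnerProductSpace ℝ E] [CompleteSpace E] [Nontrivial E] {K : E →L[ℝ] E}
    (hsa : IsSelfAdjoint K) (hK : ‖K‖ ≤ 1) (hker : ∀ v, K v = v → v = 0) (x : E) :
    Tendsto (fun s : ℝ => NormedSpace.exp (-(s • (1 - K))) x) atTop (𝓝 0) := by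
  set B : E →L[ℝ] E := 1 - K with hB
  have hBsa : IsSelfAdjoint B := (IsSelfAdjoint.one _).sub hsa
  have hsym : ∀ v w, inner ℝ (B v) w = inner ℝ v (B w) := fun v w => by
    simpa using (ContinuousLinearMap.isSelfAdjoint_iff_isSymmetric.1 hBsa) v w
  have hpos : ∀ v, 0 ≤ inner ℝ v (B v) := fun v => by
    have h1 : inner ℝ v (K v) ≤ ‖v‖ * ‖K v‖ := real_inner_le_norm _ _
    have h2 : ‖K v‖ ≤ 1 * ‖v‖ := K.le_of_opNorm_le hK v
    have h3 : inner ℝ v (B v) = ‖v‖ ^ 2 - inner ℝ v (K v) := by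
      simp [hB, inner_sub_right]
    rw [h3]; nlinarith [norm_nonneg v]
  have hcontr : ∀ s : ℝ, 0 ≤ s → ∀ v, ‖NormedSpace.exp (-(s • B)) v‖ ≤ ‖v‖ := fun s hs v => by
    simpa using (NormedSpace.exp (-(s • B))).le_of_opNorm_le
      (norm_exp_neg_smul_one_sub_le hK hs) v
  have hcomm : ∀ (s : ℝ) v, B (NormedSpace.exp (-(s • B)) v) = NormedSpace.exp (-(s • B)) (B v) :=
    fun s v => comp_exp_of_comp B _ _ (fun w => by simp) v
  have hrange : ∀ w, Tendsto (fun s : ℝ => NormedSpace.exp (-(s • B)) (B w)) atTop (𝓝 0) := by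
    intro w
    set u : ℝ → E := fun s => NormedSpace.exp (-(s • B)) w with hu
    have hder : ∀ s, HasDerivAt u (-(B (u s))) s := by
      intro s
      have h := hasDerivAt_exp_smul_const' (𝕂 := ℝ) (-B) s
      have h2 := ((ContinuousLinearMap.apply ℝ E w).hasFDerivAt).comp_hasDerivAt s h
      simpa [hu, Function.comp_def] using h2
    have hderB : ∀ s, HasDerivAt (fun s => B (u s)) (-(B (B (u s)))) s := by
      intro s
      simpa [Function.comp_def] using (B.hasFDerivAt).comp_hasDerivAt s (hder s)
    -- The weight `2s` is chosen so that its derivative `2‖Bu‖²` cancels the derivative `-2‖Bu‖²` of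
    -- `⟨u, Bu⟩`. What remains is `-4s⟨Bu, B(Bu)⟩ ≤ 0`, so `2s‖Bu‖² ≤ G s ≤ G 0`.
    set G : ℝ → ℝ := fun s => inner ℝ (u s) (B (u s)) + 2 * s * inner ℝ (B (u s)) (B (u s)) with hG
    have hderG : ∀ s, HasDerivAt G (-(4 * s * inner ℝ (B (u s)) (B (B (u s))))) s := by
      intro s
      have h1 := (hder s).inner ℝ (hderB s)
      have h2 := (hderB s).inner ℝ (hderB s)
      have h3 := ((hasDerivAt_id s).const_mul 2).mul h2
      refine (h1.add h3).congr_deriv ?_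
      simp only [inner_neg_left, inner_neg_right, hsym, id, map_neg]
      ring
    have hanti : AntitoneOn G (Set.Ici 0) := by
      refine antitoneOn_of_deriv_nonpos (convex_Ici 0)
        (fun s _ => (hderG s).continuousAt.continuousWithinAt)
        (fun s _ => (hderG s).differentiableAt.differentiableWithinAt) fun s hs => ?_
      rw [(hderG s).deriv]
      have h1 : 0 ≤ s := by rw [interior_Ici] at hs; exact hs.le
      have := mul_nonneg h1 (hpos (B (u s)))
      linarith
    have hbound : ∀ s : ℝ, 0 < s → ‖NormedSpace.exp (-(s • B)) (B w)‖ ^ 2 ≤ G 0 / 2 * s⁻¹ := by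
      intro s hs
      have h1 := hanti (Set.mem_Ici.2 le_rfl) (Set.mem_Ici.2 hs.le) hs.le
      have h2 : G s = inner ℝ (u s) (B (u s)) + 2 * s * ‖B (u s)‖ ^ 2 := by
        simp only [hG, real_inner_self_eq_norm_sq]
      rw [← hcomm, ← div_eq_mul_inv, le_div_iff₀ hs]
      have := hpos (u s)
      change ‖B (u s)‖ ^ 2 * s ≤ _
      linarith
    have hsq : Tendsto (fun s : ℝ => ‖NormedSpace.exp (-(s • B)) (B w)‖ ^ 2) atTop (𝓝 0) := by
      refine squeeze_zero' (Eventually.of_forall fun s => sq_nonneg _)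
        ((eventually_gt_atTop 0).mono hbound) ?_
      simpa using tendsto_inv_atTop_zero.const_mul (G 0 / 2)
    rw [tendsto_zero_iff_norm_tendsto_zero]
    have := hsq.sqrt
    simpa [Real.sqrt_sq] using this
  have hdense : x ∈ closure (B.range : Set E) := by
    have h1 : B.rangeᗮ = ⊥ := by
      rw [ContinuousLinearMap.orthogonal_range, hBsa.adjoint_eq, eq_bot_iff]
      intro v hv
      refine (Submodule.mem_bot ℝ).2 (hker v ?_)
      exact (sub_eq_zero.1 (show v - K v = 0 from hv)).symm
    have h2 := (Submodule.topologicalClosure_eq_top_iff (K := B.range)).2 h1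
    rw [← Submodule.topologicalClosure_coe, h2]
    trivial
  rw [Metric.tendsto_atTop]
  intro ε hε
  obtain ⟨y, ⟨w, rfl⟩, hy⟩ := Metric.mem_closure_iff.1 hdense (ε / 2) (half_pos hε)
  obtain ⟨N, hN⟩ := Metric.tendsto_atTop.1 (hrange w) (ε / 2) (half_pos hε)
  refine ⟨max N 0, fun s hs => ?_⟩
  have h1 := hN s ((le_max_left _ _).trans hs)
  have h2 := hcontr s ((le_max_right _ _).trans hs) (x - B w)
  rw [dist_zero_right] at h1 ⊢
  rw [dist_eq_norm] at hy
  rw [map_sub] at h2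
  have h3 := norm_sub_norm_le (NormedSpace.exp (-(s • B)) x) (NormedSpace.exp (-(s • B)) (B w))
  have hy' : ‖x - B w‖ < ε / 2 := hy
  linarith

end Exponential

end PowerDiffusion
namespace PowerDiffusion

/-! ### The sequence spaces `ℓ¹` and `ℓ²`, and operators on `ℓ¹` given by columns. -/

section EllOne

variable {ι : Type*}

theorem ellOne_summable_norm (v : lp (fun _ : ι => ℝ) 1) : Summable fun i => ‖v i‖ := by
  simpa using (lp.memℓp v).summable (by simp)

theorem ellOne_summable (v : lp (fun _ : ι => ℝ) 1) : Summable fun i => v i :=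
  (ellOne_summable_norm v).of_norm

theorem ellOne_norm_eq (v : lp (fun _ : ι => ℝ) 1) : ‖v‖ = ∑' i, ‖v i‖ := by
  rw [lp.norm_eq_tsum_rpow (by simp)]
  simp

/-- A summable family as an element of `ℓ¹`. -/
def ellOneMk (f : ι → ℝ) (hf : Summable f) : lp (fun _ : ι => ℝ) 1 :=
  ⟨f, memℓp_gen (by simpa using hf.norm)⟩

@[simp]
theorem ellOneMk_apply (f : ι → ℝ) (hf : Summable f) (i : ι) : ellOneMk f hf i = f i := rfl

theorem ellTwo_summable_sq (v : lp (fun _ : ι => ℝ) 2) : Summable fun i => v i ^ 2 := by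
  simpa using (lp.memℓp v).summable (by simp)

theorem ellTwo_norm_sq (v : lp (fun _ : ι => ℝ) 2) : ‖v‖ ^ 2 = ∑' i, v i ^ 2 := by
  have := lp.norm_rpow_eq_tsum (p := 2) (by simp) v
  simpa using this

/-- The inclusion of `ℓ¹` in `ℓ²` as a continuous linear map. -/
noncomputable def ellOneToTwo (ι : Type*) :
    lp (fun _ : ι => ℝ) 1 →L[ℝ] lp (fun _ : ι => ℝ) 2 :=
  (lp.linearMapOfLE ℝ (fun _ : ι => ℝ) one_le_two).mkContinuous 1 fun v => by
    rw [one_mul]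
    refine abs_le_of_sq_le_sq' ?_ (norm_nonneg _) |>.2
    rw [ellTwo_norm_sq]
    have h : ∀ i, v i ^ 2 ≤ ‖v‖ * ‖v i‖ := fun i => by
      rw [← sq_abs, ← Real.norm_eq_abs, sq]
      exact mul_le_mul_of_nonneg_right (lp.norm_apply_le_norm one_ne_zero v i) (norm_nonneg _)
    calc ∑' i, v i ^ 2 ≤ ∑' i, ‖v‖ * ‖v i‖ :=
          Summable.tsum_le_tsum h
            (Summable.of_nonneg_of_le (fun _ => sq_nonneg _) h
              ((ellOne_summable_norm v).mul_left _)) ((ellOne_summable_norm v).mul_left _)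
      _ = ‖v‖ ^ 2 := by rw [tsum_mul_left, ← ellOne_norm_eq, sq]

/-- The operator on `ℓ¹` with the given columns. -/
noncomputable def ellOneOfColumns (col : ι → lp (fun _ : ι => ℝ) 1) (C : ℝ)
    (hC : ∀ j, ‖col j‖ ≤ C) : lp (fun _ : ι => ℝ) 1 →L[ℝ] lp (fun _ : ι => ℝ) 1 :=
  have hs : ∀ v : lp (fun _ : ι => ℝ) 1, Summable fun j => ‖v j • col j‖ := fun v =>
    Summable.of_nonneg_of_le (fun _ => norm_nonneg _)
      (fun j => by
        rw [norm_smul]; exact mul_le_mul_of_nonneg_left (hC j) (norm_nonneg _))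
      ((ellOne_summable_norm v).mul_right C)
  LinearMap.mkContinuous
    { toFun v := ∑' j, v j • col j
      map_add' v w := by
        rw [← Summable.tsum_add (hs v).of_norm (hs w).of_norm]
        simp [add_smul]
      map_smul' c v := by
        rw [RingHom.id_apply, ← Summable.tsum_const_smul _ (hs v).of_norm]
        simp [mul_smul] }
    C fun v => by
      refine (norm_tsum_le_tsum_norm (hs v)).trans ?_
      rw [ellOne_norm_eq, mul_comm, ← tsum_mul_right]
      refine (hs v).tsum_le_tsum (fun j => ?_) ((ellOne_summable_norm v).mul_right C)
      rw [norm_smul]; exact mul_le_mul_of_nonneg_left (hC j) (norm_nonneg _)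

theorem ellOneOfColumns_hasSum (col : ι → lp (fun _ : ι => ℝ) 1) (C : ℝ)
    (hC : ∀ j, ‖col j‖ ≤ C) (v : lp (fun _ : ι => ℝ) 1) :
    HasSum (fun j => v j • col j) (ellOneOfColumns col C hC v) := by
  refine Summable.hasSum (Summable.of_norm ?_)
  refine Summable.of_nonneg_of_le (fun _ => norm_nonneg _)
      (fun j => ?_) ((ellOne_summable_norm v).mul_right C)
  rw [norm_smul]; exact mul_le_mul_of_nonneg_left (hC j) (norm_nonneg _)

theorem ellOneOfColumns_norm_le (col : ι → lp (fun _ : ι => ℝ) 1) (C : ℝ) (hC0 : 0 ≤ C)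
    (hC : ∀ j, ‖col j‖ ≤ C) : ‖ellOneOfColumns col C hC‖ ≤ C := by
  unfold ellOneOfColumns
  exact LinearMap.mkContinuous_norm_le _ hC0 _

/-- An operator on `ℓ¹` is bounded by the norms of its columns. -/
theorem ellOne_opNorm_le [DecidableEq ι] (A : lp (fun _ : ι => ℝ) 1 →L[ℝ] lp (fun _ : ι => ℝ) 1)
    {C : ℝ} (hC0 : 0 ≤ C) (hC : ∀ j, ‖A (lp.single 1 j 1)‖ ≤ C) : ‖A‖ ≤ C := by
  refine A.opNorm_le_bound hC0 fun v => ?_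
  have h := (lp.hasSum_single (by simp) v).mapL A
  have hb : ∀ j, ‖A (lp.single 1 j (v j))‖ ≤ ‖v j‖ * C := fun j => by
    have : lp.single (E := fun _ : ι => ℝ) 1 j (v j) = v j • lp.single 1 j (1 : ℝ) := by
      rw [← lp.single_smul]; simp
    rw [this, map_smul, norm_smul]
    exact mul_le_mul_of_nonneg_left (hC j) (norm_nonneg _)
  rw [← h.tsum_eq]
  refine tsum_of_norm_bounded ?_ hb
  rw [mul_comm C, ellOne_norm_eq]
  exact (ellOne_summable_norm v).hasSum.mul_right C

/-- Restriction of a summable sequence to a subset of the indices. -/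
noncomputable def ellOneRestrict (s : Set ι) :
    lp (fun _ : ι => ℝ) 1 →L[ℝ] lp (fun _ : s => ℝ) 1 :=
  LinearMap.mkContinuous
    { toFun v := ellOneMk (fun i : s => v i) ((ellOne_summable v).subtype s)
      map_add' v w := rfl
      map_smul' c v := rfl }
    1 fun v => by
      rw [one_mul, ellOne_norm_eq, ellOne_norm_eq]
      exact (ellOne_summable_norm v).tsum_subtype_le (fun i => ‖v i‖) s (fun _ => norm_nonneg _)

@[simp]
theorem ellOneRestrict_apply (s : Set ι) (v : lp (fun _ : ι => ℝ) 1) (i : s) :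
    ellOneRestrict s v i = v i := rfl

end EllOne

/-! ### Substochastic matrices as contractions of `ℓ¹` and `ℓ²`. -/

section Substochastic

variable {ι : Type*}

/-- Matrices with nonnegative entries all of whose rows and columns have sum at most one. -/
structure IsSubstochastic (K : ι → ι → ℝ) : Prop where
  nonneg : ∀ k j, 0 ≤ K k j
  row_summable : ∀ k, Summable fun j => K k j
  row_le : ∀ k, ∑' j, K k j ≤ 1
  col_summable : ∀ j, Summable fun k => K k j
  col_le : ∀ j, ∑' k, K k j ≤ 1

namespace IsSubstochastic

variable {K : ι → ι → ℝ} (hK : IsSubstochastic K)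
include hK

theorem restrict (s : Set ι) : IsSubstochastic fun k j : s => K k j where
  nonneg k j := hK.nonneg k j
  row_summable k := (hK.row_summable k).subtype s
  row_le k := ((hK.row_summable k).tsum_subtype_le _ s (hK.nonneg k)).trans (hK.row_le k)
  col_summable j := (hK.col_summable j).subtype s
  col_le j := ((hK.col_summable j).tsum_subtype_le (fun k => K k j) s
    (fun k => hK.nonneg k j)).trans (hK.col_le j)

theorem norm_column_le (j : ι) : ‖ellOneMk (fun k => K k j) (hK.col_summable j)‖ ≤ 1 := by
  rw [ellOne_norm_eq]
  simpa [abs_of_nonneg (hK.nonneg _ j)] using hK.col_le j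

/-- The operator on `ℓ¹` with matrix `K`. -/
noncomputable def toEllOne : lp (fun _ : ι => ℝ) 1 →L[ℝ] lp (fun _ : ι => ℝ) 1 :=
  ellOneOfColumns (fun j => ellOneMk (fun k => K k j) (hK.col_summable j)) 1 hK.norm_column_le

theorem norm_toEllOne_le : ‖hK.toEllOne‖ ≤ 1 :=
  ellOneOfColumns_norm_le _ 1 zero_le_one _

theorem toEllOne_hasSum (v : lp (fun _ : ι => ℝ) 1) (k : ι) :
    HasSum (fun j => K k j * v j) (hK.toEllOne v k) := by
  have h := (ellOneOfColumns_hasSum _ 1 hK.norm_column_le v).mapL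
    (lp.evalCLM ℝ (fun _ : ι => ℝ) 1 k)
  convert! h using 2 with j
  change K k j * v j = v j * K k j
  ring

theorem toEllOne_single [DecidableEq ι] (j k : ι) :
    hK.toEllOne (lp.single 1 j (1 : ℝ)) k = K k j := by
  refine (hK.toEllOne_hasSum _ k).unique ?_
  convert hasSum_ite_eq j (K k j) using 2 with i
  by_cases h : i = j
  · subst h; simp
  · simp [lp.single_apply, h]

/-- Jensen's inequality for weights of mass at most one: expand `∑ K (f - a)² ≥ 0` around the
weighted sum `a` and use that the row sum is at most one. Summability of `K f` comes from `|f| ≤ 1 +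
f²`. -/
theorem sq_le {f : ι → ℝ} (hf : Summable fun j => f j ^ 2) (k : ι) :
    Summable (fun j => K k j * f j) ∧ Summable (fun j => K k j * f j ^ 2) ∧
      (∑' j, K k j * f j) ^ 2 ≤ ∑' j, K k j * f j ^ 2 := by
  have hle : ∀ j, K k j ≤ 1 := fun j =>
    ((hK.row_summable k).le_tsum j fun i _ => hK.nonneg k i).trans (hK.row_le k)
  have h2 : Summable fun j => K k j * f j ^ 2 := by
    refine Summable.of_nonneg_of_le (fun j => mul_nonneg (hK.nonneg k j) (sq_nonneg _))
      (fun j => ?_) hf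
    exact mul_le_of_le_one_left (sq_nonneg _) (hle j)
  have h1 : Summable fun j => K k j * f j := by
    refine Summable.of_norm_bounded ((hK.row_summable k).add h2) fun j => ?_
    rw [norm_mul, Real.norm_of_nonneg (hK.nonneg k j), Real.norm_eq_abs]
    have : |f j| ≤ 1 + f j ^ 2 := by
      rw [← sq_abs]; nlinarith [sq_nonneg (|f j| - 1), abs_nonneg (f j)]
    nlinarith [hK.nonneg k j]
  refine ⟨h1, h2, ?_⟩
  set a := ∑' j, K k j * f j with ha
  have h3 : HasSum (fun j => K k j * f j ^ 2 - 2 * a * (K k j * f j) + a ^ 2 * K k j)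
      (∑' j, K k j * f j ^ 2 - 2 * a * a + a ^ 2 * ∑' j, K k j) :=
    (h2.hasSum.sub (h1.hasSum.mul_left _)).add ((hK.row_summable k).hasSum.mul_left _)
  have h4 : 0 ≤ ∑' j, K k j * f j ^ 2 - 2 * a * a + a ^ 2 * ∑' j, K k j :=
    h3.nonneg fun j => by
      have := mul_nonneg (hK.nonneg k j) (sq_nonneg (f j - a))
      nlinarith
  nlinarith [hK.row_le k, sq_nonneg a]

/-- A Schur test. Jensen along the rows bounds the squared entries of the image of `v` by those of
the image of `v²`, and the column sums make the latter map an `ℓ¹` contraction. -/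
theorem ellTwo_aux (v : lp (fun _ : ι => ℝ) 2) :
    Summable (fun k => (∑' j, K k j * v j) ^ 2) ∧ ∑' k, (∑' j, K k j * v j) ^ 2 ≤ ‖v‖ ^ 2 := by
  set w : lp (fun _ : ι => ℝ) 1 := ellOneMk (fun j => v j ^ 2) (ellTwo_summable_sq v) with hw
  have hle : ∀ k, (∑' j, K k j * v j) ^ 2 ≤ ‖hK.toEllOne w k‖ := fun k => by
    refine (hK.sq_le (ellTwo_summable_sq v) k).2.2.trans ?_
    rw [← (hK.toEllOne_hasSum w k).tsum_eq]
    exact le_abs_self _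
  have hs := Summable.of_nonneg_of_le (fun k => sq_nonneg _) hle (ellOne_summable_norm _)
  refine ⟨hs, (hs.tsum_le_tsum hle (ellOne_summable_norm _)).trans ?_⟩
  rw [← ellOne_norm_eq]
  refine (hK.toEllOne.le_of_opNorm_le hK.norm_toEllOne_le w).trans ?_
  rw [one_mul, ellOne_norm_eq, ellTwo_norm_sq]
  simp [hw]

/-- The operator on `ℓ²` with matrix `K`. -/
noncomputable def toEllTwo : lp (fun _ : ι => ℝ) 2 →L[ℝ] lp (fun _ : ι => ℝ) 2 :=
  LinearMap.mkContinuous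
    { toFun v := ⟨fun k => ∑' j, K k j * v j, memℓp_gen (by simpa using (hK.ellTwo_aux v).1)⟩
      map_add' v w := by
        ext k
        change ∑' j, K k j * (v j + w j) = ∑' j, K k j * v j + ∑' j, K k j * w j
        rw [← Summable.tsum_add (hK.sq_le (ellTwo_summable_sq v) k).1
          (hK.sq_le (ellTwo_summable_sq w) k).1]
        simp [mul_add]
      map_smul' c v := by
        ext k
        change ∑' j, K k j * (c * v j) = c * ∑' j, K k j * v j
        rw [← tsum_mul_left]
        exact tsum_congr fun j => by ring }
    1 fun v => by
      rw [one_mul]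
      refine abs_le_of_sq_le_sq' ?_ (norm_nonneg _) |>.2
      rw [ellTwo_norm_sq]
      exact (hK.ellTwo_aux v).2

theorem norm_toEllTwo_le : ‖hK.toEllTwo‖ ≤ 1 :=
  LinearMap.mkContinuous_norm_le _ zero_le_one _

theorem toEllTwo_hasSum (v : lp (fun _ : ι => ℝ) 2) (k : ι) :
    HasSum (fun j => K k j * v j) (hK.toEllTwo v k) :=
  (hK.sq_le (ellTwo_summable_sq v) k).1.hasSum

theorem ellOneToTwo_toEllOne (v : lp (fun _ : ι => ℝ) 1) :
    ellOneToTwo ι (hK.toEllOne v) = hK.toEllTwo (ellOneToTwo ι v) := by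
  ext k
  exact (hK.toEllOne_hasSum v k).unique (hK.toEllTwo_hasSum (ellOneToTwo ι v) k)

theorem isSelfAdjoint_toEllTwo (hsymm : ∀ k j, K k j = K j k) : IsSelfAdjoint hK.toEllTwo := by
  classical
  rw [ContinuousLinearMap.isSelfAdjoint_iff']
  ext v k
  have h1 : (ContinuousLinearMap.adjoint hK.toEllTwo v) k =
      inner ℝ (hK.toEllTwo (lp.single 2 k 1)) v := by
    rw [← ContinuousLinearMap.adjoint_inner_right, lp.inner_single_left]; simp
  have h2 : ∀ j, hK.toEllTwo (lp.single 2 k (1 : ℝ)) j = K j k := fun j => by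
    refine (hK.toEllTwo_hasSum _ j).unique ?_
    convert hasSum_ite_eq k (K j k) using 2 with i
    by_cases h : i = k
    · subst h; simp
    · simp [lp.single_apply, h]
  rw [h1]
  refine (lp.hasSum_inner _ v).unique ?_
  refine (hK.toEllTwo_hasSum v k).congr_fun fun j => ?_
  rw [h2, hsymm k j]
  simp [mul_comm]

/-- Only the rows in `s` matter: those modes receive nothing from outside, so the restricted vector
evolves on its own. -/
theorem restrict_toEllOne {s : Set ι} (hs : ∀ k ∈ s, ∀ j ∉ s, K k j = 0)
    (v : lp (fun _ : ι => ℝ) 1) :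
    ellOneRestrict s (hK.toEllOne v) = (hK.restrict s).toEllOne (ellOneRestrict s v) := by
  ext k
  refine HasSum.unique ?_ ((hK.restrict s).toEllOne_hasSum (ellOneRestrict s v) k)
  have h := hK.toEllOne_hasSum v k
  rw [← hasSum_subtype_iff_of_support_subset (s := s)] at h
  · exact h
  · intro j hj
    by_contra hjs
    exact hj (by simp [hs k k.2 j hjs])

theorem tsum_toEllOne (hcol : ∀ j, ∑' k, K k j = 1) (v : lp (fun _ : ι => ℝ) 1) :
    ∑' k, hK.toEllOne v k = ∑' k, v k := by
  have h := (ellOneOfColumns_hasSum _ 1 hK.norm_column_le v).mapL (lp.tsumCLM ℝ ι ℝ)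
  have h2 := h.tsum_eq
  rw [lp.tsumCLM_apply] at h2
  refine h2.symm.trans (tsum_congr fun j => ?_)
  rw [map_smul, lp.tsumCLM_apply]
  simp [hcol]

end IsSubstochastic

end Substochastic

end PowerDiffusion
namespace PowerDiffusion

/-! ### Maximum principle, and comparison of iterates with a semigroup. -/

section Dynamics

/-- The maximum principle: an irreducible stochastic matrix on infinitely many indices has no
nonzero square summable fixed vector. -/
theorem IsSubstochastic.eq_zero_of_toEllTwo_eq {ι : Type*} [Infinite ι] {K : ι → ι → ℝ}
    (hK : IsSubstochastic K) (hrow : ∀ k, ∑' j, K k j = 1)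
    (hirr : ∀ J : Set ι, J.Nonempty → (∀ k ∈ J, ∀ j ∉ J, K k j = 0) → J = Set.univ)
    (v : lp (fun _ : ι => ℝ) 2) (hv : hK.toEllTwo v = v) : v = 0 := by
  by_contra hne
  obtain ⟨i, hi⟩ : ∃ i, v i ≠ 0 := by
    by_contra! h
    exact hne (lp.ext (funext h))
  have hlim : Tendsto (fun k => v k ^ 2) cofinite (𝓝 0) :=
    (ellTwo_summable_sq v).tendsto_cofinite_zero
  have hfin : {k | v i ^ 2 ≤ v k ^ 2}.Finite := by
    have := hlim.eventually (gt_mem_nhds (show 0 < v i ^ 2 by positivity))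
    simpa [Filter.eventually_cofinite] using this
  -- Square summable entries tend to zero, so only finitely many are at least as large as `v i` and
  -- the maximum of `v²` is attained.
  obtain ⟨k₀, hk₀, hmax⟩ := hfin.exists_maximalFor (fun k => v k ^ 2) _ ⟨i, by simp⟩
  have hmax' : ∀ k, v k ^ 2 ≤ v k₀ ^ 2 := fun k => by
    by_cases h : v i ^ 2 ≤ v k ^ 2
    · by_contra! hlt
      exact absurd (hmax h hlt.le) (not_le.2 hlt)
    · exact (not_le.1 h).le.trans hk₀
  set c := v k₀ with hc
  have hc0 : 0 < c ^ 2 := lt_of_lt_of_le (by positivity) hk₀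
  have hcv : ∀ j, 0 ≤ c ^ 2 - c * v j := fun j => by
    nlinarith [hmax' j, sq_nonneg (c - v j)]
  -- The set where `v = c` is closed under `K`. At such a `k` the average of the nonnegative numbers
  -- `c² - c v_j` with weights `K k j` is zero, so `K k j` vanishes unless `v_j = c`. By
  -- irreducibility `v` is a nonzero constant, which is not square summable on an infinite index
  -- set.
  have hJ := hirr {k | v k = c} ⟨k₀, rfl⟩ fun k hk j hj => by
    have h1 : HasSum (fun j => K k j * v j) c := by
      have := hK.toEllTwo_hasSum v k
      rwa [hv, show v k = c from hk] at this
    have h2 : HasSum (fun j => K k j) 1 := hrow k ▸ (hK.row_summable k).hasSum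
    have h3 : HasSum (fun j => K k j * (c ^ 2 - c * v j)) 0 := by
      have h4 := (h2.mul_left (c ^ 2)).sub (h1.mul_left c)
      have h5 : c ^ 2 * 1 - c * c = 0 := by ring
      rw [h5] at h4
      exact h4.congr_fun fun j => by ring
    have h4 := (hasSum_zero_iff_of_nonneg fun j => mul_nonneg (hK.nonneg k j) (hcv j)).1 h3
    have h5 := congrFun h4 j
    rcases mul_eq_zero.1 h5 with h | h
    · exact h
    · exfalso
      have h6 : c * (c - v j) = 0 := by rw [← h]; ring
      rcases mul_eq_zero.1 h6 with h7 | h7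
      · rw [h7] at hc0; simp at hc0
      · exact hj (sub_eq_zero.1 h7).symm
  have hconst : ∀ k, v k ^ 2 = c ^ 2 := fun k => by
    have : k ∈ {k | v k = c} := hJ ▸ Set.mem_univ k
    rw [show v k = c from this]
  have h := ellTwo_summable_sq v
  simp only [hconst] at h
  have h0 := h.tendsto_cofinite_zero
  exact hc0.ne' (tendsto_nhds_unique tendsto_const_nhds h0)

/-- Iterates of a family of contractions that is generated to second order by `K - 1`. -/
theorem exists_norm_pow_sub_exp_le {A : Type*} [NormedRing A] [NormOneClass A] [NormedAlgebra ℝ A]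
    [CompleteSpace A] {K : A} (hK : ‖K‖ ≤ 1) {M : ℝ → A} (hM : ∀ ε, ‖M ε‖ ≤ 1) {C₀ : ℝ}
    (hC₀ : ∀ ε, |ε| ≤ 1 → ‖M ε - (1 - ε ^ 2 • (1 - K))‖ ≤ C₀ * |ε| ^ 3) :
    ∃ C δ : ℝ, 0 < δ ∧ ∀ ε, |ε| < δ → ∀ n : ℕ,
      ‖M ε ^ n - NormedSpace.exp (-((n * ε ^ 2) • (1 - K)))‖ ≤ n * (C * |ε| ^ 3) := by
  obtain ⟨C₁, δ₁, hδ₁, h₁⟩ := exists_norm_exp_sub_one_sub_le A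
  have hB : ‖1 - K‖ ≤ 2 := (norm_sub_le _ _).trans (by rw [norm_one]; linarith)
  -- The generator has norm at most `2`, so `‖X‖ ≤ 2ε²`. The quadratic remainder of the exponential
  -- is therefore at most `4|C₁|ε⁴ ≤ 4|C₁||ε|³`, and `|ε| < δ₁ / 2` with `|ε| ≤ 1` gives `‖X‖ < δ₁`.
  refine ⟨C₀ + |C₁| * 4, min 1 (δ₁ / 2), by positivity, fun ε hε n => ?_⟩
  have hε1 : |ε| ≤ 1 := (hε.trans_le (min_le_left _ _)).le
  have hεδ : |ε| < δ₁ / 2 := hε.trans_le (min_le_right _ _)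
  have h0 := abs_nonneg ε
  set X : A := -(ε ^ 2 • (1 - K)) with hX
  have hXn : ‖X‖ ≤ |ε| ^ 2 * 2 := by
    rw [hX, norm_neg, norm_smul, norm_pow, Real.norm_eq_abs]
    gcongr
  have hXδ : ‖X‖ < δ₁ := by nlinarith
  have h2 : ‖NormedSpace.exp X - (1 + X)‖ ≤ |C₁| * 4 * |ε| ^ 3 := by
    refine (h₁ X hXδ).trans ?_
    calc C₁ * ‖X‖ ^ 2 ≤ |C₁| * (|ε| ^ 2 * 2) ^ 2 := by
          gcongr
          exact le_abs_self _
      _ = |C₁| * 4 * |ε| ^ 3 * |ε| := by ring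
      _ ≤ |C₁| * 4 * |ε| ^ 3 * 1 := by gcongr
      _ = _ := mul_one _
  have h3 : NormedSpace.exp (-((n * ε ^ 2) • (1 - K))) = NormedSpace.exp X ^ n := by
    let : NormedAlgebra ℚ A := NormedAlgebra.restrictScalars ℚ ℝ A
    rw [← NormedSpace.exp_nsmul, hX, smul_neg, ← Nat.cast_smul_eq_nsmul ℝ, smul_smul]
  rw [h3]
  refine (norm_pow_sub_pow_le (hM ε) (norm_exp_neg_smul_one_sub_le hK (sq_nonneg ε)) n).trans ?_
  gcongr
  calc ‖M ε - NormedSpace.exp X‖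
      = ‖(M ε - (1 - ε ^ 2 • (1 - K))) - (NormedSpace.exp X - (1 + X))‖ := by
        congr 1; rw [hX]; abel
    _ ≤ C₀ * |ε| ^ 3 + |C₁| * 4 * |ε| ^ 3 := (norm_sub_le _ _).trans (add_le_add (hC₀ ε hε1) h2)
    _ = _ := by ring

theorem tendsto_pow_exp {A : Type*} [NormedRing A] [NormOneClass A] [NormedAlgebra ℝ A]
    [CompleteSpace A] {K : A} (hK : ‖K‖ ≤ 1) {M : ℝ → A} (hM : ∀ ε, ‖M ε‖ ≤ 1) {C₀ : ℝ}
    (hC₀ : ∀ ε, |ε| ≤ 1 → ‖M ε - (1 - ε ^ 2 • (1 - K))‖ ≤ C₀ * |ε| ^ 3)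
    {ε : ℕ → ℝ} {n : ℕ → ℕ} (hε : Tendsto ε atTop (𝓝 0))
    (hn : Tendsto (fun m => (n m : ℝ) * |ε m| ^ 3) atTop (𝓝 0)) :
    Tendsto (fun m => M (ε m) ^ n m - NormedSpace.exp (-((n m * ε m ^ 2) • (1 - K)))) atTop
      (𝓝 0) := by
  obtain ⟨C, δ, hδ, h⟩ := exists_norm_pow_sub_exp_le hK hM hC₀
  have hev : ∀ᶠ m in atTop, |ε m| < δ := by
    have := hε.abs
    rw [abs_zero] at this
    exact this.eventually (gt_mem_nhds hδ)
  refine squeeze_zero_norm' (hev.mono fun m hm => h (ε m) hm (n m)) ?_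
  have := hn.const_mul C
  rw [mul_zero] at this
  exact this.congr fun m => by ring

theorem tendsto_mul_abs_cube {ε : ℕ → ℝ} {n : ℕ → ℕ} {τ : ℝ} (hε : Tendsto ε atTop (𝓝 0))
    (hn : Tendsto (fun m => (n m : ℝ) * ε m ^ 2) atTop (𝓝 τ)) :
    Tendsto (fun m => (n m : ℝ) * |ε m| ^ 3) atTop (𝓝 0) := by
  have h := hn.mul hε.abs
  rw [abs_zero, mul_zero] at h
  exact h.congr fun m => by rw [← sq_abs]; ring

/-- Nontriviality of the space gives `‖1‖ = 1` in its operator algebra, as the norm estimates above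
require. -/
instance {ι : Type*} [Nonempty ι] (p : ℝ≥0∞) : Nontrivial (lp (fun _ : ι => ℝ) p) := by
  classical
  obtain ⟨i⟩ := ‹Nonempty ι›
  refine ⟨lp.single p i 1, 0, fun h => ?_⟩
  have := congrArg (fun v : lp (fun _ : ι => ℝ) p => v i) h
  simp at this

end Dynamics

end PowerDiffusion
namespace PowerDiffusion

/-! ### The time regimes for an abstract generated block. -/

section Regimes

/-- A family `M ε` of substochastic matrices that is generated to second order by a symmetric
substochastic matrix `K`, with an infinite irreducible stochastic block `I` of `K`; when `iso`
holds, `I` is also a stochastic block of every `M ε`. -/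
structure IsGeneratedBlock (K : ℕ → ℕ → ℝ) (M : ℝ → ℕ → ℕ → ℝ) (I : Set ℕ) (iso : Prop) :
    Prop where
  subK : IsSubstochastic K
  symmK : ∀ k j, K k j = K j k
  subM : ∀ ε, IsSubstochastic (M ε)
  approx : ∃ C : ℝ, ∀ ε, |ε| ≤ 1 →
    ‖(subM ε).toEllOne - (1 - ε ^ 2 • (1 - subK.toEllOne))‖ ≤ C * |ε| ^ 3
  infinite : I.Infinite
  block : ∀ k ∈ I, ∀ j ∉ I, K k j = 0
  row : ∀ k : I, ∑' j : I, K k j = 1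
  irreducible : ∀ J ⊆ I, J.Nonempty → (∀ k ∈ J, ∀ j ∈ I \ J, K k j = 0) → J = I
  isoBlock : iso → ∀ ε, ∀ k ∈ I, ∀ j ∉ I, M ε k j = 0
  isoCol : iso → ∀ ε, ∀ j : I, ∑' k : I, M ε k j = 1

namespace IsGeneratedBlock

variable {K : ℕ → ℕ → ℝ} {M : ℝ → ℕ → ℕ → ℝ} {I : Set ℕ} {iso : Prop}
  (h : IsGeneratedBlock K M I iso)
include h

/-- The generator of the limit dynamics on the block. -/
noncomputable def gen : EllOne I →L[ℝ] EllOne I := 1 - (h.subK.restrict I).toEllOne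

/-- The vector on the block after `n` steps. -/
noncomputable def evol (p : lp (fun _ : ℕ => ℝ) 1) (ε : ℝ) (n : ℕ) : EllOne I :=
  ellOneRestrict I (((h.subM ε).toEllOne ^ n) p)

theorem restrict_exp (p : lp (fun _ : ℕ => ℝ) 1) (s : ℝ) :
    ellOneRestrict I (NormedSpace.exp (-(s • (1 - h.subK.toEllOne))) p) =
      NormedSpace.exp (-(s • h.gen)) (ellOneRestrict I p) := by
  refine comp_exp_of_comp _ _ _ (fun v => ?_) p
  simp [gen, h.subK.restrict_toEllOne h.block]

/-- `M ε` need not preserve the block, so the iterates are compared with the semigroup on all of `ℕ`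
and only the semigroup is moved inside the block. -/
theorem evol_eq (p : lp (fun _ : ℕ => ℝ) 1) (ε : ℝ) (n : ℕ) :
    h.evol p ε n = ellOneRestrict I (((h.subM ε).toEllOne ^ n -
      NormedSpace.exp (-((n * ε ^ 2) • (1 - h.subK.toEllOne)))) p) +
        NormedSpace.exp (-((n * ε ^ 2) • h.gen)) (ellOneRestrict I p) := by
  rw [← h.restrict_exp, ← map_add, _root_.sub_apply, sub_add_cancel]
  rfl

theorem tendsto_evol_sub {ε : ℕ → ℝ} {n : ℕ → ℕ} (hε : Tendsto ε atTop (𝓝 0))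
    (hn : Tendsto (fun m => (n m : ℝ) * |ε m| ^ 3) atTop (𝓝 0)) (p : lp (fun _ : ℕ => ℝ) 1) :
    Tendsto (fun m => ellOneRestrict I (((h.subM (ε m)).toEllOne ^ n m -
      NormedSpace.exp (-((n m * ε m ^ 2) • (1 - h.subK.toEllOne)))) p)) atTop (𝓝 0) := by
  obtain ⟨C, hC⟩ := h.approx
  have h1 := tendsto_pow_exp h.subK.norm_toEllOne_le (fun ε => (h.subM ε).norm_toEllOne_le) hC hε hn
  have h2 := (((ellOneRestrict I).comp (ContinuousLinearMap.apply ℝ _ p)).continuous.tendsto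
    0).comp h1
  rw [map_zero] at h2
  exact h2

theorem tendsto_evol (p : lp (fun _ : ℕ => ℝ) 1) {τ : ℝ} {ε : ℕ → ℝ} {n : ℕ → ℕ}
    (hε : Tendsto ε atTop (𝓝 0)) (hn : Tendsto (fun m => (n m : ℝ) * ε m ^ 2) atTop (𝓝 τ)) :
    Tendsto (fun m => h.evol p (ε m) (n m)) atTop
      (𝓝 (NormedSpace.exp (-(τ • h.gen)) (ellOneRestrict I p))) := by
  simp only [h.evol_eq]
  have h1 := h.tendsto_evol_sub hε (tendsto_mul_abs_cube hε hn) p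
  have hc : Continuous fun s : ℝ => NormedSpace.exp (-(s • h.gen)) (ellOneRestrict I p) := by
    let : NormedAlgebra ℚ (EllOne I →L[ℝ] EllOne I) := NormedAlgebra.restrictScalars ℚ ℝ _
    have : Continuous fun s : ℝ => NormedSpace.exp (-(s • h.gen)) :=
      NormedSpace.exp_continuous.comp (by fun_prop)
    exact this.clm_apply continuous_const
  have h2 := h1.add ((hc.tendsto τ).comp hn)
  rw [zero_add] at h2
  exact h2

/-- The columns of the block of `K` sum to one by symmetry, so the total is annihilated by the
generator: it intertwines the generator with `0`, whose exponential is the identity. -/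
theorem tsum_exp (q : EllOne I) (s : ℝ) :
    ∑' k, NormedSpace.exp (-(s • h.gen)) q k = ∑' k, q k := by
  have hcol : ∀ j : I, ∑' k : I, K k j = 1 := fun j => by
    rw [← h.row j]; exact tsum_congr fun k => h.symmK k j
  have h1 := comp_exp_of_comp (lp.tsumCLM ℝ I ℝ) (-(s • h.gen)) 0 (fun v => by
    have h2 := (h.subK.restrict I).tsum_toEllOne hcol v
    have h3 : lp.tsumCLM ℝ I ℝ ((h.subK.restrict I).toEllOne v) = lp.tsumCLM ℝ I ℝ v := by
      simpa only [lp.tsumCLM_apply] using h2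
    simp only [gen, _root_.neg_apply, _root_.smul_apply,
      _root_.sub_apply, one_apply_eq_self, map_neg, map_smul, map_sub,
      h3, sub_self, smul_zero, neg_zero, _root_.zero_apply]) q
  rw [NormedSpace.exp_zero] at h1
  simpa only [lp.tsumCLM_apply, one_apply_eq_self] using h1

theorem evol_iso (hiso : iso) (p : lp (fun _ : ℕ => ℝ) 1) (ε : ℝ) (n : ℕ) :
    h.evol p ε (n + 1) = ((h.subM ε).restrict I).toEllOne (h.evol p ε n) := by
  rw [evol, pow_succ']
  exact (h.subM ε).restrict_toEllOne (h.isoBlock hiso ε) _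

theorem evol_zero (p : lp (fun _ : ℕ => ℝ) 1) (ε : ℝ) :
    h.evol p ε 0 = ellOneRestrict I p := by
  simp [evol]

theorem tsum_evol (hiso : iso) (p : lp (fun _ : ℕ => ℝ) 1) (ε : ℝ) (n : ℕ) :
    ∑' k, h.evol p ε n k = ∑' k, ellOneRestrict I p k := by
  induction n with
  | zero => rw [h.evol_zero]
  | succ n ih =>
    rw [h.evol_iso hiso, ((h.subM ε).restrict I).tsum_toEllOne (h.isoCol hiso ε), ih]

theorem antitone_norm_evol (hiso : iso) (p : lp (fun _ : ℕ => ℝ) 1) (ε : ℝ) :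
    Antitone fun n => ‖ellOneToTwo I (h.evol p ε n)‖ := by
  refine antitone_nat_of_succ_le fun n => ?_
  rw [h.evol_iso hiso, IsSubstochastic.ellOneToTwo_toEllOne]
  simpa using ((h.subM ε).restrict I).toEllTwo.le_of_opNorm_le
    ((h.subM ε).restrict I).norm_toEllTwo_le (ellOneToTwo I (h.evol p ε n))

theorem tendsto_exp_ellTwo (q : EllOne I) :
    Tendsto (fun s : ℝ => ellOneToTwo I (NormedSpace.exp (-(s • h.gen)) q)) atTop (𝓝 0) := by
  have hinf : Infinite I := h.infinite.to_subtype
  set K₂ := (h.subK.restrict I).toEllTwo with hK₂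
  have h1 : ∀ s : ℝ, ellOneToTwo I (NormedSpace.exp (-(s • h.gen)) q) =
      NormedSpace.exp (-(s • (1 - K₂))) (ellOneToTwo I q) := fun s =>
    comp_exp_of_comp _ _ _ (fun v => by
      simp [gen, hK₂, (h.subK.restrict I).ellOneToTwo_toEllOne]) q
  simp only [h1]
  refine tendsto_exp_neg_smul_one_sub_apply
    ((h.subK.restrict I).isSelfAdjoint_toEllTwo fun k j => h.symmK k j)
    (h.subK.restrict I).norm_toEllTwo_le (fun v hv => ?_) _
  refine (h.subK.restrict I).eq_zero_of_toEllTwo_eq h.row (fun J hJ hJ0 => ?_) v hv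
  have h2 := h.irreducible (Subtype.val '' J) (by simp) (hJ.image _) (by
    rintro _ ⟨k, hk, rfl⟩ j ⟨hjI, hj⟩
    exact hJ0 k hk ⟨j, hjI⟩ fun hj' => hj ⟨_, hj', rfl⟩)
  ext k
  simp only [Set.mem_univ, iff_true]
  have h3 : (k : ℕ) ∈ Subtype.val '' J := by rw [h2]; exact k.2
  simpa using h3

/-- Without isolation, the cutoff makes the comparison error vanish and the decay of the semigroup
is inherited. In the isolated case that error is not controlled at step `n`, and monotonicity of the
`ℓ²` norm replaces it. -/
theorem tendsto_long_ellTwo (p : lp (fun _ : ℕ => ℝ) 1) {ε : ℕ → ℝ} {n : ℕ → ℕ}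
    (hl : LongRegime iso ε n) :
    Tendsto (fun m => ellOneToTwo I (h.evol p (ε m) (n m))) atTop (𝓝 0) := by
  rcases hl.cutoff with hiso | hcut
  · rw [Metric.tendsto_atTop']
    intro η hη
    have h1 := (h.tendsto_exp_ellTwo (ellOneRestrict I p)).norm
    rw [norm_zero] at h1
    obtain ⟨s, hs, hs0⟩ := ((h1.eventually (gt_mem_nhds hη)).and (eventually_gt_atTop 0)).exists
    -- An earlier step number with `n' ε² → s`, where the power vector is close to `e^{-sB} P(0)`,
    -- of `ℓ²` norm below `η`. Eventually `n' ≤ n`, and the norm cannot grow in between.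
    set n' : ℕ → ℕ := fun m => ⌊s / ε m ^ 2⌋₊ with hn'
    have hne : ∀ᶠ m in atTop, s ≤ n m * ε m ^ 2 := hl.long.eventually (eventually_ge_atTop s)
    -- If `ε m = 0`, then `n ε² = 0 < s`; hence `ε m ≠ 0` eventually, as the division by `ε²`
    -- requires.
    have hpos : ∀ᶠ m in atTop, 0 < ε m ^ 2 := hne.mono fun m hm => by
      rcases (sq_nonneg (ε m)).eq_or_lt with h0 | h0
      · rw [← h0] at hm; simp at hm; linarith
      · exact h0
    have hlim : Tendsto (fun m => (n' m : ℝ) * ε m ^ 2) atTop (𝓝 s) := by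
      have h2 : Tendsto (fun m => s - ε m ^ 2) atTop (𝓝 s) := by
        simpa using (hl.eps.pow 2).const_sub s
      refine tendsto_of_tendsto_of_tendsto_of_le_of_le' h2 tendsto_const_nhds ?_ ?_
      · filter_upwards [hpos] with m hm
        have := (Nat.lt_floor_add_one (s / ε m ^ 2)).le
        rw [div_le_iff₀ hm] at this
        linarith
      · filter_upwards [hpos] with m hm
        have := Nat.floor_le (div_nonneg hs0.le hm.le)
        rwa [le_div_iff₀ hm] at this
    have h3 := ((ellOneToTwo I).continuous.tendsto _).comp (h.tendsto_evol p hl.eps hlim)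
    have h4 := h3.norm.eventually (gt_mem_nhds hs)
    have h5 : ∀ᶠ m in atTop, dist (ellOneToTwo I (h.evol p (ε m) (n m))) 0 < η := by
      filter_upwards [h4, hne, hpos] with m hm hm2 hm3
      rw [dist_zero_right]
      refine lt_of_le_of_lt (h.antitone_norm_evol hiso p (ε m) (?_ : n' m ≤ n m)) hm
      refine Nat.floor_le_of_le ?_
      rwa [div_le_iff₀ hm3]
    obtain ⟨N, hN⟩ := eventually_atTop.1 h5
    exact ⟨N, fun m hm => hN m hm.le⟩
  · simp only [h.evol_eq, map_add]
    have h1 := ((ellOneToTwo I).continuous.tendsto 0).comp (h.tendsto_evol_sub hl.eps hcut p)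
    have h2 := (h.tendsto_exp_ellTwo (ellOneRestrict I p)).comp hl.long
    rw [map_zero] at h1
    simpa using h1.add h2

theorem tendsto_long_tsum (p : lp (fun _ : ℕ => ℝ) 1) {ε : ℕ → ℝ} {n : ℕ → ℕ}
    (hl : LongRegime iso ε n) :
    Tendsto (fun m => ∑' k, h.evol p (ε m) (n m) k) atTop (𝓝 (∑' k, ellOneRestrict I p k)) := by
  rcases hl.cutoff with hiso | hcut
  · simp only [h.tsum_evol hiso]
    exact tendsto_const_nhds
  · have h1 := ((lp.tsumCLM ℝ I ℝ).continuous.tendsto 0).comp (h.tendsto_evol_sub hl.eps hcut p)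
    have h2 := h1.add (tendsto_const_nhds (x := ∑' k, ellOneRestrict I p k))
    rw [map_zero, zero_add] at h2
    refine h2.congr fun m => ?_
    rw [← h.tsum_exp (ellOneRestrict I p) (n m * ε m ^ 2), h.evol_eq]
    simp only [Function.comp, ← lp.tsumCLM_apply ℝ, ← map_add]

end IsGeneratedBlock

/-- Spreading to the high modes: `ℓ²` decay together with convergence of the total. -/
theorem spreading {I : Set ℕ} {q : EllOne I} (hq : ∀ k, 0 ≤ q k) {v : ℕ → EllOne I}
    (h2 : Tendsto (fun m => ellOneToTwo I (v m)) atTop (𝓝 0))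
    (h1 : Tendsto (fun m => ∑' k, v m k) atTop (𝓝 (∑' k, q k))) :
    (q ≠ 0 → ¬ ∃ Q : EllOne I, Tendsto v atTop (𝓝 Q)) ∧
      ∀ N : ℕ,
        Tendsto (fun m => ∑' k : I, if N ≤ (k : ℕ) then v m k else 0) atTop (𝓝 (∑' k, q k)) ∧
        Tendsto (fun m => ∑' k : I, if (k : ℕ) ≤ N then v m k else 0) atTop (𝓝 0) := by
  have hcoord : ∀ k : I, Tendsto (fun m => v m k) atTop (𝓝 0) := fun k => by
    have := ((lp.evalCLM ℝ (fun _ : I => ℝ) 2 k).continuous.tendsto 0).comp h2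
    rw [map_zero] at this
    exact this
  have hlow : ∀ N : ℕ, Tendsto (fun m => ∑' k : I, if (k : ℕ) < N then v m k else 0) atTop
      (𝓝 0) := fun N => by
    have hfin : {k : I | (k : ℕ) < N}.Finite :=
      Set.Finite.preimage Subtype.val_injective.injOn (Set.finite_lt_nat N)
    have h3 : ∀ m, ∑' k : I, (if (k : ℕ) < N then v m k else 0) =
        ∑ k ∈ hfin.toFinset, v m k := fun m => by
      rw [tsum_eq_sum (s := hfin.toFinset)]
      · refine Finset.sum_congr rfl fun k hk => ?_
        rw [if_pos (by simpa using hk)]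
      · intro k hk
        rw [if_neg (by simpa using hk)]
    simp only [h3]
    simpa using tendsto_finsetSum hfin.toFinset fun k _ => hcoord k
  refine ⟨fun hq0 ⟨Q, hQ⟩ => ?_, fun N => ⟨?_, ?_⟩⟩
  -- An `ℓ¹` limit must vanish in every coordinate, but the total is continuous on `ℓ¹` and tends to
  -- `∑ q`. So `∑ q = 0`, and `q = 0` by nonnegativity.
  · have hQ0 : Q = 0 := by
      ext k
      have := ((lp.evalCLM ℝ (fun _ : I => ℝ) 1 k).continuous.tendsto Q).comp hQ
      exact tendsto_nhds_unique this (hcoord k)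
    have h3 := ((lp.tsumCLM ℝ I ℝ).continuous.tendsto Q).comp hQ
    rw [hQ0, map_zero] at h3
    have h4 : ∑' k, q k = 0 := tendsto_nhds_unique h1 (by simpa [Function.comp_def] using h3)
    refine hq0 ?_
    ext k
    exact congrFun ((hasSum_zero_iff_of_nonneg hq).1 (h4 ▸ (ellOne_summable q).hasSum)) k
  · have h3 := h1.sub (hlow N)
    rw [sub_zero] at h3
    refine h3.congr fun m => ?_
    have hs : Summable fun k : I => if (k : ℕ) < N then v m k else 0 :=
      (ellOne_summable (v m)).indicator {k : I | (k : ℕ) < N} |>.congr fun k => by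
        simp [Set.indicator_apply]
    rw [← (ellOne_summable (v m)).tsum_sub hs]
    refine tsum_congr fun k => ?_
    by_cases hk : (k : ℕ) < N
    · simp [hk]
    · simp [hk, not_lt.1 hk]
  · exact (hlow (N + 1)).congr fun m => tsum_congr fun k => by simp

end Regimes

end PowerDiffusion
namespace PowerDiffusion

/-! ### Integration by parts for absolutely continuous functions. -/

section AbsolutelyContinuous

/-- Subdivide the interval so finely that each increment of `G` is below `η`. The quadratic bounds
then add up to at most `η |C| (G b - G a)`, and `η` is arbitrary. This replaces an almost everywhere
derivative. -/
theorem eq_of_norm_sub_le_sq {E : Type*} [NormedAddCommGroup E] {F : ℝ → E} {G : ℝ → ℝ}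
    {a b C : ℝ} (hab : a ≤ b) (hG : ContinuousOn G (Set.Icc a b)) (hmono : MonotoneOn G (Set.Icc a b))
    (h : ∀ s ∈ Set.Icc a b, ∀ t ∈ Set.Icc a b, s ≤ t → ‖F t - F s‖ ≤ C * (G t - G s) ^ 2) :
    F b = F a := by
  rw [← sub_eq_zero, ← norm_le_zero_iff]
  have key : ∀ η > 0, ‖F b - F a‖ ≤ η * (|C| * (G b - G a)) := by
    intro η hη
    obtain ⟨δ, hδ, hu⟩ := Metric.uniformContinuousOn_iff.1
      (isCompact_Icc.uniformContinuousOn_of_continuous hG) η hη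
    obtain ⟨N, hN⟩ := exists_nat_gt ((b - a) / δ)
    have hN0 : 0 < (N + 1 : ℝ) := by positivity
    set p : ℕ → ℝ := fun i => a + i * ((b - a) / (N + 1)) with hp
    have hba : 0 ≤ b - a := sub_nonneg.2 hab
    have hstep : 0 ≤ (b - a) / (N + 1) := div_nonneg hba hN0.le
    have hlast : p (N + 1) = b := by
      simp only [hp]; push_cast; field_simp; ring
    have hmem : ∀ i ≤ N + 1, p i ∈ Set.Icc a b := fun i hi => by
      refine ⟨le_add_of_nonneg_right (by positivity), ?_⟩
      rw [← hlast]
      simp only [hp]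
      gcongr
    have hterm : ∀ i ∈ Finset.range (N + 1), ‖F (p (i + 1)) - F (p i)‖ ≤
        η * (|C| * (G (p (i + 1)) - G (p i))) := by
      intro i hi
      have h1 := hmem i (Finset.mem_range.1 hi).le
      have h2 := hmem (i + 1) (Finset.mem_range.1 hi)
      have hle : p i ≤ p (i + 1) := by
        simp only [hp]; gcongr; simp
      have hd : dist (p (i + 1)) (p i) < δ := by
        have : p (i + 1) - p i = (b - a) / (N + 1) := by simp only [hp]; push_cast; ring
        rw [Real.dist_eq, this, abs_of_nonneg hstep, div_lt_iff₀ hN0]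
        rw [div_lt_iff₀ hδ] at hN
        nlinarith
      have hg := hu _ h2 _ h1 hd
      have h0 : 0 ≤ G (p (i + 1)) - G (p i) := sub_nonneg.2 (hmono h1 h2 hle)
      rw [Real.dist_eq, abs_of_nonneg h0] at hg
      refine (h _ h1 _ h2 hle).trans ?_
      calc C * (G (p (i + 1)) - G (p i)) ^ 2 ≤ |C| * (G (p (i + 1)) - G (p i)) ^ 2 := by
            gcongr; exact le_abs_self C
        _ = (|C| * (G (p (i + 1)) - G (p i))) * (G (p (i + 1)) - G (p i)) := by ring
        _ ≤ (|C| * (G (p (i + 1)) - G (p i))) * η := by gcongr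
        _ = _ := mul_comm _ _
    have hF : F b - F a = ∑ i ∈ Finset.range (N + 1), (F (p (i + 1)) - F (p i)) := by
      rw [Finset.sum_range_sub (fun i => F (p i)), hlast]; simp [hp]
    have hGs : G b - G a = ∑ i ∈ Finset.range (N + 1), (G (p (i + 1)) - G (p i)) := by
      rw [Finset.sum_range_sub (fun i => G (p i)), hlast]; simp [hp]
    rw [hF, hGs, Finset.mul_sum, Finset.mul_sum]
    exact norm_sum_le_of_le _ hterm
  have hlim : Tendsto (fun η : ℝ => η * (|C| * (G b - G a))) (𝓝[>] 0) (𝓝 0) := by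
    have : Tendsto (fun η : ℝ => η * (|C| * (G b - G a))) (𝓝 0) (𝓝 (0 * (|C| * (G b - G a)))) :=
      (continuous_id.mul continuous_const).tendsto 0
    rw [zero_mul] at this
    exact this.mono_left nhdsWithin_le_nhds
  exact ge_of_tendsto hlim (eventually_nhdsWithin_of_forall key)

/-- Integration by parts for primitives of integrable functions and a bilinear map. -/
theorem bilin_eq_add_integral {E F W : Type*} [NormedAddCommGroup E] [NormedSpace ℝ E]
    [CompleteSpace E] [NormedAddCommGroup F] [NormedSpace ℝ F] [CompleteSpace F]
    [NormedAddCommGroup W] [NormedSpace ℝ W] [CompleteSpace W] (B : E →L[ℝ] F →L[ℝ] W)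
    {T : ℝ} (hT : 0 ≤ T) {u f : ℝ → E} {v h : ℝ → F}
    (hf : IntervalIntegrable f volume 0 T) (hh : IntervalIntegrable h volume 0 T)
    (hu : ∀ t ∈ Set.Icc 0 T, u t = u 0 + ∫ r in (0 : ℝ)..t, f r)
    (hv : ∀ t ∈ Set.Icc 0 T, v t = v 0 + ∫ r in (0 : ℝ)..t, h r)
    (hint : IntervalIntegrable (fun r => B (f r) (v r) + B (u r) (h r)) volume 0 T) :
    B (u T) (v T) = B (u 0) (v 0) + ∫ r in (0 : ℝ)..T, (B (f r) (v r) + B (u r) (h r)) := by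
  set k : ℝ → ℝ := fun r => ‖f r‖ + ‖h r‖ with hk
  have hki : IntervalIntegrable k volume 0 T := hf.norm.add hh.norm
  set G : ℝ → ℝ := fun t => ∫ r in (0 : ℝ)..t, k r with hG
  set Φ : ℝ → W := fun r => B (f r) (v r) + B (u r) (h r) with hΦ
  have hsub : ∀ {s t : ℝ}, s ∈ Set.Icc 0 T → t ∈ Set.Icc 0 T → Set.uIcc s t ⊆ Set.uIcc 0 T := by
    intro s t hs ht
    rw [Set.uIcc_of_le hT]
    exact Set.uIcc_subset_Icc hs ht
  have h0 : (0 : ℝ) ∈ Set.Icc 0 T := ⟨le_rfl, hT⟩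
  have hGsub : ∀ s ∈ Set.Icc 0 T, ∀ t ∈ Set.Icc 0 T, G t - G s = ∫ r in s..t, k r :=
    fun s hs t ht => intervalIntegral.integral_interval_sub_left (hki.mono_set (hsub h0 ht))
      (hki.mono_set (hsub h0 hs))
  have husub : ∀ s ∈ Set.Icc 0 T, ∀ t ∈ Set.Icc 0 T, u t - u s = ∫ r in s..t, f r := by
    intro s hs t ht
    rw [hu s hs, hu t ht, add_sub_add_left_eq_sub]
    exact intervalIntegral.integral_interval_sub_left (hf.mono_set (hsub h0 ht))
      (hf.mono_set (hsub h0 hs))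
  have hvsub : ∀ s ∈ Set.Icc 0 T, ∀ t ∈ Set.Icc 0 T, v t - v s = ∫ r in s..t, h r := by
    intro s hs t ht
    rw [hv s hs, hv t ht, add_sub_add_left_eq_sub]
    exact intervalIntegral.integral_interval_sub_left (hh.mono_set (hsub h0 ht))
      (hh.mono_set (hsub h0 hs))
  have hmono : MonotoneOn G (Set.Icc 0 T) := by
    intro s hs t ht hst
    rw [← sub_nonneg, hGsub s hs t ht]
    exact intervalIntegral.integral_nonneg hst fun r _ => by positivity
  have hcont : ContinuousOn G (Set.Icc 0 T) := by
    have := intervalIntegral.continuousOn_primitive_interval (μ := volume) (f := k) (a := 0) (b := T)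
      (by rw [Set.uIcc_of_le hT]; exact (intervalIntegrable_iff_integrableOn_Icc_of_le hT).1 hki)
    rwa [Set.uIcc_of_le hT] at this
  have huG : ∀ s ∈ Set.Icc 0 T, ∀ t ∈ Set.Icc 0 T, s ≤ t → ‖u t - u s‖ ≤ G t - G s := by
    intro s hs t ht hst
    rw [husub s hs t ht, hGsub s hs t ht]
    exact intervalIntegral.norm_integral_le_of_norm_le hst
      (ae_of_all _ fun r _ => le_add_of_nonneg_right (norm_nonneg _)) (hki.mono_set (hsub hs ht))
  have hvG : ∀ s ∈ Set.Icc 0 T, ∀ t ∈ Set.Icc 0 T, s ≤ t → ‖v t - v s‖ ≤ G t - G s := by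
    intro s hs t ht hst
    rw [hvsub s hs t ht, hGsub s hs t ht]
    exact intervalIntegral.norm_integral_le_of_norm_le hst
      (ae_of_all _ fun r _ => le_add_of_nonneg_left (norm_nonneg _)) (hki.mono_set (hsub hs ht))
  -- On `[s, t]` freeze `v` at `t` and `u` at `s`: the increment of the product is then an exact
  -- integral. Its difference from the integral of `Φ` is of second order in the increment of `G`.
  have hmain := eq_of_norm_sub_le_sq (F := fun t => B (u t) (v t) - ∫ r in (0 : ℝ)..t, Φ r)
    (C := ‖B‖) hT hcont hmono (by
    intro s hs t ht hst
    have hfs := hf.mono_set (hsub hs ht)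
    have hhs := hh.mono_set (hsub hs ht)
    have e1 : B (u t - u s) (v t) = ∫ r in s..t, B (f r) (v t) := by
      rw [husub s hs t ht]
      exact ((B.flip (v t)).intervalIntegral_comp_comm hfs).symm
    have e2 : B (u s) (v t - v s) = ∫ r in s..t, B (u s) (h r) := by
      rw [hvsub s hs t ht]
      exact ((B (u s)).intervalIntegral_comp_comm hhs).symm
    have e3 : (∫ r in (0 : ℝ)..t, Φ r) - ∫ r in (0 : ℝ)..s, Φ r = ∫ r in s..t, Φ r :=
      intervalIntegral.integral_interval_sub_left (hint.mono_set (hsub h0 ht))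
        (hint.mono_set (hsub h0 hs))
    have i1 : IntervalIntegrable (fun r => B (f r) (v t)) volume s t :=
      ⟨(B.flip (v t)).integrable_comp hfs.1, (B.flip (v t)).integrable_comp hfs.2⟩
    have i2 : IntervalIntegrable (fun r => B (u s) (h r)) volume s t :=
      ⟨(B (u s)).integrable_comp hhs.1, (B (u s)).integrable_comp hhs.2⟩
    have e4 : (B (u t) (v t) - ∫ r in (0 : ℝ)..t, Φ r) - (B (u s) (v s) - ∫ r in (0 : ℝ)..s, Φ r) =
        ∫ r in s..t, (B (f r) (v t) + B (u s) (h r) - Φ r) := by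
      rw [intervalIntegral.integral_sub (i1.add i2) (hint.mono_set (hsub hs ht)),
        intervalIntegral.integral_add i1 i2, ← e1, ← e2, ← e3]
      simp only [map_sub, _root_.sub_apply]
      abel
    rw [e4]
    have hGn : 0 ≤ G t - G s := sub_nonneg.2 (hmono hs ht hst)
    calc ‖∫ r in s..t, (B (f r) (v t) + B (u s) (h r) - Φ r)‖
        ≤ ∫ r in s..t, ‖B‖ * (G t - G s) * k r := by
          refine intervalIntegral.norm_integral_le_of_norm_le hst (ae_of_all _ fun r hr => ?_)
            ((hki.mono_set (hsub hs ht)).const_mul _)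
          have hr' : r ∈ Set.Icc 0 T := ⟨hs.1.trans hr.1.le, hr.2.trans ht.2⟩
          have e5 : B (f r) (v t) + B (u s) (h r) - Φ r =
              B (f r) (v t - v r) - B (u r - u s) (h r) := by
            simp only [hΦ, map_sub, _root_.sub_apply]; abel
          have n1 : ‖v t - v r‖ ≤ G t - G s := (hvG r hr' t ht hr.2).trans
            (sub_le_sub_left (hmono hs hr' hr.1.le) _)
          have n2 : ‖u r - u s‖ ≤ G t - G s := (huG s hs r hr' hr.1.le).trans
            (sub_le_sub_right (hmono hr' ht hr.2) _)
          rw [e5]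
          refine (norm_sub_le _ _).trans ?_
          have n3 : ‖B (f r) (v t - v r)‖ ≤ ‖B‖ * ‖f r‖ * (G t - G s) :=
            (B.le_opNorm₂ _ _).trans (by gcongr)
          have n4 : ‖B (u r - u s) (h r)‖ ≤ ‖B‖ * (G t - G s) * ‖h r‖ :=
            (B.le_opNorm₂ _ _).trans (by gcongr)
          simp only [hk]
          nlinarith
      _ = ‖B‖ * (G t - G s) ^ 2 := by
          rw [intervalIntegral.integral_const_mul, ← hGsub s hs t ht]; ring)
  simp only [intervalIntegral.integral_same, sub_zero] at hmain
  rw [← hmain]; abel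

end AbsolutelyContinuous

end PowerDiffusion
namespace PowerDiffusion

/-! ### Mild solutions and the propagator of a single defect in the interaction picture. -/

section Interaction

variable {H : Type*} [NormedAddCommGroup H] [InnerProductSpace ℂ H]

/-- A time dependent symmetric contraction `b` with a real scalar amplitude `g`, acting during the
time interval `[0, T]` (the interaction picture of a single defect). -/
structure IsInteraction (b : ℝ → H →L[ℂ] H) (g : ℝ → ℝ) (T : ℝ) : Prop where
  nonneg : 0 ≤ T
  cont : Continuous fun p : ℝ × H => b p.1 p.2
  norm_le : ∀ s, ‖b s‖ ≤ 1
  symm : ∀ s x y, inner ℂ (b s x) y = inner ℂ x (b s y)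
  integrable : Integrable g
  integrable_sq : Integrable fun s => g s ^ 2
  integral_le : ∫ s in (0 : ℝ)..T, |g s| ≤ 1

/-- Mild solutions of `i u' = ε g(t) b(t) u`, `u(0) = x` on `[0, T]`. -/
structure IsMild (b : ℝ → H →L[ℂ] H) (g : ℝ → ℝ) (T ε : ℝ) (x : H) (u : ℝ → H) : Prop where
  continuousOn : ContinuousOn u (Set.Icc 0 T)
  equation : ∀ t ∈ Set.Icc 0 T,
    u t = x - (Complex.I * (ε : ℂ)) • ∫ s in (0 : ℝ)..t, (g s : ℂ) • b s (u s)

variable {b : ℝ → H →L[ℂ] H} {g : ℝ → ℝ} {T ε : ℝ} {x y : H} {u v : ℝ → H}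

namespace IsInteraction

variable (hi : IsInteraction b g T)
include hi

theorem intervalIntegrable (hu : ContinuousOn u (Set.Icc 0 T)) {s t : ℝ} (hs : s ∈ Set.Icc 0 T)
    (ht : t ∈ Set.Icc 0 T) :
    IntervalIntegrable (fun r => (g r : ℂ) • b r (u r)) volume s t := by
  have h1 : IntervalIntegrable (fun r => (g r : ℂ)) volume s t :=
    hi.integrable.ofReal.intervalIntegrable
  refine h1.smul_continuousOn ?_
  have h2 : ContinuousOn (fun r => (r, u r)) (Set.uIcc s t) :=
    continuousOn_id.prodMk (hu.mono (Set.uIcc_subset_Icc hs ht))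
  exact hi.cont.comp_continuousOn h2

theorem norm_apply_le (s : ℝ) (x : H) : ‖b s x‖ ≤ ‖x‖ := by
  simpa using (b s).le_of_opNorm_le (hi.norm_le s) x

end IsInteraction

namespace IsMild

theorem eq_zero_time (hu : IsMild b g T ε x u) (hT : 0 ≤ T) : u 0 = x := by
  simpa using hu.equation 0 ⟨le_rfl, hT⟩

theorem mono (hu : IsMild b g T ε x u) {t : ℝ} (ht : t ≤ T) : IsMild b g t ε x u where
  continuousOn := hu.continuousOn.mono (Set.Icc_subset_Icc_right ht)
  equation s hs := hu.equation s ⟨hs.1, hs.2.trans ht⟩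

theorem add (hi : IsInteraction b g T) (hu : IsMild b g T ε x u) (hv : IsMild b g T ε y v) :
    IsMild b g T ε (x + y) (u + v) where
  continuousOn := hu.continuousOn.add hv.continuousOn
  equation t ht := by
    have h0 : (0 : ℝ) ∈ Set.Icc 0 T := ⟨le_rfl, hi.nonneg⟩
    rw [Pi.add_apply, hu.equation t ht, hv.equation t ht]
    simp only [Pi.add_apply, map_add, smul_add]
    rw [intervalIntegral.integral_add (hi.intervalIntegrable hu.continuousOn h0 ht)
      (hi.intervalIntegrable hv.continuousOn h0 ht), smul_add]
    abel

theorem map (hi : IsInteraction b g T) [CompleteSpace H] (L : H →L[ℂ] H)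
    (hL : ∀ s z, L (b s z) = b s (L z))
    (hu : IsMild b g T ε x u) : IsMild b g T ε (L x) (fun t => L (u t)) where
  continuousOn := L.continuous.comp_continuousOn hu.continuousOn
  equation t ht := by
    have h0 : (0 : ℝ) ∈ Set.Icc 0 T := ⟨le_rfl, hi.nonneg⟩
    rw [hu.equation t ht, map_sub, map_smul,
      ← L.intervalIntegral_comp_comm (hi.intervalIntegrable hu.continuousOn h0 ht)]
    simp only [map_smul, hL]

theorem smul (hi : IsInteraction b g T) [CompleteSpace H] (c : ℂ) (hu : IsMild b g T ε x u) :
    IsMild b g T ε (c • x) (fun t => c • u t) := by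
  simpa using hu.map hi (c • ContinuousLinearMap.id ℂ H) (fun s z => by simp)

/-- By symmetry of `b` the number `⟨u, b u⟩` is real, so the right-hand side of the equation is
orthogonal to `u` for the real inner product. Integration by parts for `‖u‖²` leaves no integral
term. -/
theorem norm_eq_right [CompleteSpace H] (hi : IsInteraction b g T) (hu : IsMild b g T ε x u) :
    ‖u T‖ = ‖x‖ := by
  set f : ℝ → H := fun r => -((Complex.I * (ε : ℂ)) • ((g r : ℂ) • b r (u r))) with hf
  have h0 : (0 : ℝ) ∈ Set.Icc 0 T := ⟨le_rfl, hi.nonneg⟩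
  have hT : T ∈ Set.Icc 0 T := ⟨hi.nonneg, le_rfl⟩
  have hint := hi.intervalIntegrable hu.continuousOn h0 hT
  have hfi : IntervalIntegrable f volume 0 T := (hint.smul (Complex.I * (ε : ℂ))).neg
  have hu0 := hu.eq_zero_time hi.nonneg
  have hue : ∀ t ∈ Set.Icc 0 T, u t = u 0 + ∫ r in (0 : ℝ)..t, f r := fun t ht => by
    rw [hu.equation t ht, hu0, hf, intervalIntegral.integral_neg, intervalIntegral.integral_smul,
      sub_eq_add_neg]
  have horth : ∀ z : H, ∀ r, Complex.re (inner ℂ z (-((Complex.I * (ε : ℂ)) •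
      ((g r : ℂ) • b r z)))) = 0 := fun z r => by
    have h1 : (inner ℂ z (b r z)).im = 0 := by
      rw [← Complex.conj_eq_iff_im, inner_conj_symm, hi.symm]
    rw [inner_neg_right, inner_smul_right, inner_smul_right]
    simp [Complex.mul_re, h1]
  let : InnerProductSpace ℝ H := InnerProductSpace.complexToReal
  have hzero : ∀ r, innerSL ℝ (f r) (u r) + innerSL ℝ (u r) (f r) = 0 := fun r => by
    simp only [innerSL_apply_apply]
    rw [real_inner_comm, real_inner_eq_re_inner ℂ]
    have := horth (u r) r
    simp only [hf, RCLike.re_to_complex]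
    rw [this, add_zero]
  have h := bilin_eq_add_integral (innerSL ℝ : H →L[ℝ] H →L[ℝ] ℝ) hi.nonneg hfi hfi hue hue (by
    simp only [hzero]; exact intervalIntegrable_const)
  simp only [hzero, intervalIntegral.integral_zero, add_zero] at h
  rw [hu0] at h
  have hsq : ∀ z : H, innerSL ℝ z z = ‖z‖ ^ 2 := fun z => real_inner_self_eq_norm_sq z
  exact (pow_left_inj₀ (norm_nonneg _) (norm_nonneg _) two_ne_zero).1
    ((hsq _).symm.trans (h.trans (hsq _)))

end IsMild

theorem IsInteraction.mono (hi : IsInteraction b g T) {t : ℝ} (ht : t ∈ Set.Icc 0 T) :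
    IsInteraction b g t where
  nonneg := ht.1
  cont := hi.cont
  norm_le := hi.norm_le
  symm := hi.symm
  integrable := hi.integrable
  integrable_sq := hi.integrable_sq
  integral_le := by
    refine le_trans ?_ hi.integral_le
    exact intervalIntegral.integral_mono_interval le_rfl ht.1 ht.2
      (ae_of_all _ fun s => abs_nonneg _) hi.integrable.abs.intervalIntegrable

namespace IsMild

variable [CompleteSpace H]

theorem norm_eq (hi : IsInteraction b g T) (hu : IsMild b g T ε x u) {t : ℝ}
    (ht : t ∈ Set.Icc 0 T) : ‖u t‖ = ‖x‖ :=
  (hu.mono ht.2).norm_eq_right (hi.mono ht)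

/-- The difference of two solutions is a solution starting at zero, and the norm is conserved. -/
theorem unique (hi : IsInteraction b g T) (hu : IsMild b g T ε x u) (hv : IsMild b g T ε x v) :
    u T = v T := by
  have h := (hu.add hi (hv.smul hi (-1))).norm_eq_right hi
  simp only [Pi.add_apply, neg_smul, one_smul, add_neg_cancel, norm_zero, norm_eq_zero] at h
  exact add_neg_eq_zero.1 h

theorem norm_sub_le (hi : IsInteraction b g T) (hu : IsMild b g T ε x u) {t : ℝ}
    (ht : t ∈ Set.Icc 0 T) : ‖u t - x‖ ≤ |ε| * ‖x‖ := by
  have h1 : ‖∫ s in (0 : ℝ)..t, (g s : ℂ) • b s (u s)‖ ≤ ‖x‖ := by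
    calc _ ≤ ∫ s in (0 : ℝ)..t, |g s| * ‖x‖ := by
          refine intervalIntegral.norm_integral_le_of_norm_le ht.1 (ae_of_all _ fun s hs => ?_)
            (hi.integrable.abs.intervalIntegrable.mul_const _)
          rw [norm_smul, Complex.norm_real, Real.norm_eq_abs]
          gcongr
          refine (hi.norm_apply_le s _).trans (hu.norm_eq hi ⟨hs.1.le, hs.2.trans ht.2⟩).le
      _ ≤ 1 * ‖x‖ := by
          rw [intervalIntegral.integral_mul_const]
          gcongr
          exact (hi.mono ht).integral_le
      _ = _ := one_mul _
  rw [hu.equation t ht, sub_sub_cancel_left, norm_neg, norm_smul]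
  simp only [norm_mul, Complex.norm_I, one_mul, Complex.norm_real, Real.norm_eq_abs]
  gcongr

/-- The first order expansion of the solution. -/
theorem norm_sub_add_le (hi : IsInteraction b g T) (hu : IsMild b g T ε x u) :
    ‖u T - (x - (Complex.I * (ε : ℂ)) • ∫ s in (0 : ℝ)..T, (g s : ℂ) • b s x)‖ ≤
      |ε| ^ 2 * ‖x‖ := by
  have h0 : (0 : ℝ) ∈ Set.Icc 0 T := ⟨le_rfl, hi.nonneg⟩
  have hT : T ∈ Set.Icc 0 T := ⟨hi.nonneg, le_rfl⟩
  rw [hu.equation T hT, sub_sub_sub_cancel_left, ← smul_sub, ← intervalIntegral.integral_sub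
    (hi.intervalIntegrable continuousOn_const h0 hT)
    (hi.intervalIntegrable hu.continuousOn h0 hT), norm_smul]
  simp only [norm_mul, Complex.norm_I, one_mul, Complex.norm_real, Real.norm_eq_abs, ← smul_sub,
    ← map_sub]
  rw [sq, mul_assoc]
  gcongr
  calc _ ≤ ∫ s in (0 : ℝ)..T, |g s| * (|ε| * ‖x‖) := by
        refine intervalIntegral.norm_integral_le_of_norm_le hi.nonneg (ae_of_all _ fun s hs => ?_)
          (hi.integrable.abs.intervalIntegrable.mul_const _)
        rw [norm_smul, Complex.norm_real, Real.norm_eq_abs]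
        gcongr
        refine (hi.norm_apply_le s _).trans ?_
        rw [norm_sub_rev]
        exact hu.norm_sub_le hi ⟨hs.1.le, hs.2⟩
    _ ≤ 1 * (|ε| * ‖x‖) := by
        rw [intervalIntegral.integral_mul_const]
        gcongr
        exact hi.integral_le
    _ = _ := one_mul _

end IsMild

/-- An exponential weight makes the integral operator a contraction on the whole interval at once.
By Young's inequality the integrand is at most `η g²` plus a multiple of the squared weight, whose
integral is at most `1 / (2κ)`; this is where `g ∈ L²` enters. -/
theorem IsInteraction.exists_weight (hi : IsInteraction b g T) (ε : ℝ) :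
    ∃ κ : ℝ, ∀ t ∈ Set.Icc 0 T,
      |ε| * ∫ s in (0 : ℝ)..t, Real.exp (-κ * (t - s)) * |g s| ≤ 1 / 2 := by
  set Q := ∫ s, g s ^ 2 with hQ
  have hQ0 : 0 ≤ Q := integral_nonneg fun s => sq_nonneg _
  -- `η` makes `η Q ≤ 1/4`. The next choice gives `2ηκ = ε² + 2η ≥ ε²`, so the other term is at most
  -- `1/4`; the summand `1` in `κ` keeps it positive when `ε = 0`.
  set η : ℝ := 1 / (4 * (Q + 1)) with hη
  have hη0 : 0 < η := by positivity
  set κ : ℝ := ε ^ 2 / (2 * η) + 1 with hκ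
  have hκ0 : 0 < κ := by positivity
  refine ⟨κ, fun t ht => ?_⟩
  have hexp : Continuous fun s => Real.exp (-κ * (t - s)) := by fun_prop
  have hexp2 : Continuous fun s => Real.exp (2 * (-κ * (t - s))) := by fun_prop
  have hi1 : IntervalIntegrable (fun s => Real.exp (-κ * (t - s)) * |g s|) volume 0 t :=
    (hi.integrable.abs.intervalIntegrable).continuousOn_mul hexp.continuousOn
  have hi2 : IntervalIntegrable (fun s => η * g s ^ 2) volume 0 t :=
    (hi.integrable_sq.intervalIntegrable).const_mul η
  have hi3 : IntervalIntegrable (fun s => ε ^ 2 / (4 * η) * Real.exp (2 * (-κ * (t - s))))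
      volume 0 t := (hexp2.intervalIntegrable _ _).const_mul _
  have hQt : ∫ s in (0 : ℝ)..t, g s ^ 2 ≤ Q := by
    rw [intervalIntegral.integral_of_le ht.1]
    exact setIntegral_le_integral hi.integrable_sq (ae_of_all _ fun s => sq_nonneg _)
  have hE : ∫ s in (0 : ℝ)..t, Real.exp (2 * (-κ * (t - s))) ≤ 1 / (2 * κ) := by
    have hd : ∀ s ∈ Set.uIcc 0 t, HasDerivAt (fun s => Real.exp (2 * (-κ * (t - s))) / (2 * κ))
        (Real.exp (2 * (-κ * (t - s)))) s := fun s _ => by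
      have h1 : HasDerivAt (fun s => 2 * (-κ * (t - s))) (2 * κ) s := by
        have := (((hasDerivAt_id s).const_sub t).const_mul (-κ)).const_mul 2
        refine this.congr_deriv (by ring)
      refine (h1.exp.div_const (2 * κ)).congr_deriv ?_
      field_simp
    rw [intervalIntegral.integral_eq_sub_of_hasDerivAt hd (hexp2.intervalIntegrable _ _)]
    have : 0 ≤ Real.exp (2 * (-κ * (t - 0))) / (2 * κ) := by positivity
    simp only [sub_self, mul_zero, Real.exp_zero]
    linarith
  have hpt : ∀ s, |ε| * (Real.exp (-κ * (t - s)) * |g s|) ≤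
      η * g s ^ 2 + ε ^ 2 / (4 * η) * Real.exp (2 * (-κ * (t - s))) := fun s => by
    have e : Real.exp (2 * (-κ * (t - s))) = Real.exp (-κ * (t - s)) ^ 2 := by
      rw [← Real.exp_nat_mul]; norm_num
    rw [e, ← sq_abs (g s), ← sq_abs ε]
    set E := Real.exp (-κ * (t - s))
    have h1 : 0 ≤ (2 * η * |g s| - |ε| * E) ^ 2 / (4 * η) := by positivity
    have h2 : (2 * η * |g s| - |ε| * E) ^ 2 / (4 * η) =
        η * |g s| ^ 2 + |ε| ^ 2 / (4 * η) * E ^ 2 - |ε| * (E * |g s|) := by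
      field_simp; ring
    linarith
  calc |ε| * ∫ s in (0 : ℝ)..t, Real.exp (-κ * (t - s)) * |g s|
      = ∫ s in (0 : ℝ)..t, |ε| * (Real.exp (-κ * (t - s)) * |g s|) := by
        rw [intervalIntegral.integral_const_mul]
    _ ≤ ∫ s in (0 : ℝ)..t, (η * g s ^ 2 + ε ^ 2 / (4 * η) * Real.exp (2 * (-κ * (t - s)))) :=
        intervalIntegral.integral_mono ht.1 (hi1.const_mul _) (hi2.add hi3) hpt
    _ = η * (∫ s in (0 : ℝ)..t, g s ^ 2) +
          ε ^ 2 / (4 * η) * ∫ s in (0 : ℝ)..t, Real.exp (2 * (-κ * (t - s))) := by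
        rw [intervalIntegral.integral_add hi2 hi3, intervalIntegral.integral_const_mul,
          intervalIntegral.integral_const_mul]
    _ ≤ η * Q + ε ^ 2 / (4 * η) * (1 / (2 * κ)) := by gcongr
    _ ≤ 1 / 4 + 1 / 4 := by
        gcongr
        · rw [hη, div_mul_eq_mul_div, one_mul, div_le_div_iff₀ (by positivity) (by norm_num)]
          linarith
        · have h1 : ε ^ 2 ≤ 2 * η * κ := by
            rw [hκ, mul_add, mul_div_cancel₀ _ (by positivity)]; linarith
          rw [div_mul_div_comm, mul_one, div_le_div_iff₀ (by positivity) (by norm_num)]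
          linarith
    _ = 1 / 2 := by norm_num

theorem IsInteraction.exists_isMild [CompleteSpace H] (hi : IsInteraction b g T) (ε : ℝ) (x : H) :
    ∃ u : ℝ → H, IsMild b g T ε x u := by
  obtain ⟨κ, hκ⟩ := hi.exists_weight ε
  let : Fact ((0 : ℝ) ≤ T) := ⟨hi.nonneg⟩
  -- The unknown is `v(t) = e^{-κt} u(t)`, so the sup norm of `v` is the weighted norm of `u`. The
  -- map `Φ` is the integral equation rewritten for `v`.
  set ext : C(Set.Icc 0 T, H) → ℝ → H := fun v s =>
    (Real.exp (κ * s) : ℂ) • v (Set.projIcc 0 T hi.nonneg s) with hext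
  have hextc : ∀ v, Continuous (ext v) := fun v => by
    have h1 : Continuous fun s : ℝ => (Real.exp (κ * s) : ℂ) := by fun_prop
    exact h1.smul (v.continuous.comp continuous_projIcc)
  have h0 : (0 : ℝ) ∈ Set.Icc 0 T := ⟨le_rfl, hi.nonneg⟩
  set J : C(Set.Icc 0 T, H) → ℝ → H := fun v t =>
    ∫ s in (0 : ℝ)..t, (g s : ℂ) • b s (ext v s) with hJ
  have hJi : ∀ v, ∀ s t, IntervalIntegrable (fun s => (g s : ℂ) • b s (ext v s)) volume s t :=
    fun v s t => by
      have h1 : IntervalIntegrable (fun r => (g r : ℂ)) volume s t :=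
        hi.integrable.ofReal.intervalIntegrable
      exact h1.smul_continuousOn
        (hi.cont.comp (continuous_id.prodMk (hextc v))).continuousOn
  have hJc : ∀ v, Continuous (J v) := fun v =>
    intervalIntegral.continuous_primitive (hJi v) 0
  let Φ : C(Set.Icc 0 T, H) → C(Set.Icc 0 T, H) := fun v =>
    ⟨fun t => (Real.exp (-κ * t) : ℂ) • (x - (Complex.I * (ε : ℂ)) • J v t), by
      have h1 : Continuous fun t : Set.Icc 0 T => (Real.exp (-κ * (t : ℝ)) : ℂ) := by fun_prop
      exact h1.smul (continuous_const.sub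
        (((hJc v).comp continuous_subtype_val).const_smul _))⟩
  have hΦ : ContractingWith (1 / 2) Φ := by
    refine ⟨by
      rw [← NNReal.coe_lt_coe]; norm_num, LipschitzWith.of_dist_le_mul fun v w => ?_⟩
    rw [ContinuousMap.dist_le (by positivity)]
    intro t
    have e1 : Φ v t - Φ w t = -((Real.exp (-κ * t) : ℂ) • (Complex.I * (ε : ℂ)) •
        ∫ s in (0 : ℝ)..t, (g s : ℂ) • b s (ext v s - ext w s)) := by
      have : J v t - J w t = ∫ s in (0 : ℝ)..t, (g s : ℂ) • b s (ext v s - ext w s) := by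
        rw [hJ, ← intervalIntegral.integral_sub (hJi v _ _) (hJi w _ _)]
        simp only [map_sub, smul_sub]
      rw [← this]
      change (Real.exp (-κ * t) : ℂ) • (x - (Complex.I * (ε : ℂ)) • J v t) -
        (Real.exp (-κ * t) : ℂ) • (x - (Complex.I * (ε : ℂ)) • J w t) = _
      module
    have hexpn : ∀ r : ℝ, ‖(Real.exp r : ℂ)‖ = Real.exp r := fun r => by
      rw [Complex.norm_real, Real.norm_of_nonneg (Real.exp_pos r).le]
    have e2 : ‖∫ s in (0 : ℝ)..t, (g s : ℂ) • b s (ext v s - ext w s)‖ ≤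
        ∫ s in (0 : ℝ)..t, |g s| * Real.exp (κ * s) * dist v w := by
      refine intervalIntegral.norm_integral_le_of_norm_le t.2.1 (ae_of_all _ fun s hs => ?_)
        ((hi.integrable.abs.intervalIntegrable.mul_continuousOn
          (by fun_prop : Continuous fun s => Real.exp (κ * s)).continuousOn).mul_const _)
      rw [norm_smul, Complex.norm_real, Real.norm_eq_abs, mul_assoc]
      gcongr
      refine (hi.norm_apply_le s _).trans ?_
      rw [hext, ← smul_sub, norm_smul, hexpn]
      gcongr
      rw [← dist_eq_norm]
      exact ContinuousMap.dist_apply_le_dist _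
    rw [dist_eq_norm, e1, norm_neg, norm_smul, norm_smul, hexpn]
    simp only [norm_mul, Complex.norm_I, one_mul, Complex.norm_real, Real.norm_eq_abs]
    calc Real.exp (-κ * t) * (|ε| * ‖∫ s in (0 : ℝ)..t, (g s : ℂ) • b s (ext v s - ext w s)‖)
        ≤ Real.exp (-κ * t) * (|ε| * ∫ s in (0 : ℝ)..t, |g s| * Real.exp (κ * s) * dist v w) := by
          gcongr
      _ = |ε| * (∫ s in (0 : ℝ)..t, Real.exp (-κ * (t - s)) * |g s|) * dist v w := by
          rw [intervalIntegral.integral_mul_const, ← mul_assoc, mul_comm (Real.exp _), mul_assoc,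
            ← mul_assoc (Real.exp _), ← intervalIntegral.integral_const_mul, ← mul_assoc]
          congr 3
          ext s
          rw [show -κ * (t - s) = -κ * t + κ * s by ring, Real.exp_add]
          ring
      _ ≤ 1 / 2 * dist v w := by
          gcongr
          exact hκ t t.2
      _ = _ := by norm_num
  have hfix := hΦ.fixedPoint_isFixedPt
  set v := ContractingWith.fixedPoint Φ hΦ
  refine ⟨ext v, (hextc v).continuousOn, fun t ht => ?_⟩
  have h1 : v ⟨t, ht⟩ = (Real.exp (-κ * t) : ℂ) • (x - (Complex.I * (ε : ℂ)) • J v t) :=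
    congrArg (fun w : C(Set.Icc 0 T, H) => w ⟨t, ht⟩) hfix.symm
  rw [hext]
  simp only
  rw [Set.projIcc_of_mem hi.nonneg ht, h1, smul_smul, ← Complex.ofReal_mul, ← Real.exp_add]
  simp [hJ, hext]

variable [CompleteSpace H]

/-- The propagator over the time interval `[0, T]`. -/
noncomputable def IsInteraction.propagator (hi : IsInteraction b g T) (ε : ℝ) : H →ₗᵢ[ℂ] H where
  toFun x := (hi.exists_isMild ε x).choose T
  map_add' x y := (hi.exists_isMild ε (x + y)).choose_spec.unique hi
    ((hi.exists_isMild ε x).choose_spec.add hi (hi.exists_isMild ε y).choose_spec)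
  map_smul' c x := (hi.exists_isMild ε (c • x)).choose_spec.unique hi
    ((hi.exists_isMild ε x).choose_spec.smul hi c)
  norm_map' x := (hi.exists_isMild ε x).choose_spec.norm_eq_right hi

theorem IsMild.propagator_eq (hi : IsInteraction b g T) (hu : IsMild b g T ε x u) :
    hi.propagator ε x = u T :=
  (hi.exists_isMild ε x).choose_spec.unique hi hu

/-- By uniqueness: `L` maps the solution starting at `x` to the solution starting at `L x`. -/
theorem IsInteraction.propagator_comm (hi : IsInteraction b g T) (L : H →L[ℂ] H)
    (hL : ∀ s z, L (b s z) = b s (L z)) (x : H) :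
    hi.propagator ε (L x) = L (hi.propagator ε x) :=
  ((hi.exists_isMild ε x).choose_spec.map hi L hL).propagator_eq hi

theorem IsInteraction.norm_propagator_sub_le (hi : IsInteraction b g T) (ε : ℝ) (x : H) :
    ‖hi.propagator ε x - (x - (Complex.I * (ε : ℂ)) • ∫ s in (0 : ℝ)..T, (g s : ℂ) • b s x)‖ ≤
      |ε| ^ 2 * ‖x‖ :=
  (hi.exists_isMild ε x).choose_spec.norm_sub_add_le hi

end Interaction

end PowerDiffusion
namespace PowerDiffusion

/-! ### The free unitary group and the perturbation in the interaction picture. -/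

section FreeEvolution

variable {H : Type*} [NormedAddCommGroup H] [InnerProductSpace ℂ H]

theorem hilbertBasis_ext (ψ : HilbertBasis ℕ ℂ H) {x y : H}
    (h : ∀ k, inner ℂ (ψ k) x = inner ℂ (ψ k) y) : x = y := by
  refine ψ.repr.injective (lp.ext (funext fun k => ?_))
  rw [ψ.repr_apply_apply, ψ.repr_apply_apply, h]

theorem hilbertBasis_hasSum_norm_sq (ψ : HilbertBasis ℕ ℂ H) (x : H) :
    HasSum (fun k => ‖inner ℂ (ψ k) x‖ ^ 2) (‖x‖ ^ 2) := by
  have h := lp.hasSum_norm (p := 2) (by simp) (ψ.repr x)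
  simpa [ψ.repr_apply_apply] using h

theorem phase_mul_conj (r : ℝ) :
    Complex.exp (-(Complex.I * r)) * (starRingEnd ℂ) (Complex.exp (-(Complex.I * r))) = 1 := by
  rw [Complex.mul_conj, Complex.normSq_eq_norm_sq, Complex.norm_exp]
  simp

theorem norm_phase (r : ℝ) : ‖Complex.exp (-(Complex.I * r))‖ = 1 := by
  rw [Complex.norm_exp]; simp

/-- The basis of eigenvectors at time `t`, with its phases. -/
noncomputable def phasedBasis [CompleteSpace H] (lam : ℕ → ℝ) (ψ : HilbertBasis ℕ ℂ H) (t : ℝ) :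
    HilbertBasis ℕ ℂ H :=
  HilbertBasis.mkOfOrthogonalEqBot
    (v := fun j => Complex.exp (-(Complex.I * ((lam j * t : ℝ) : ℂ))) • ψ j)
    (by
      have h := ψ.orthonormal
      refine ⟨fun j => ?_, fun i j hij => ?_⟩
      · rw [norm_smul, norm_phase, one_mul, h.1 j]
      · change inner ℂ (_ • ψ i) (_ • ψ j) = 0
        rw [inner_smul_left, inner_smul_right, h.2 hij, mul_zero, mul_zero])
    (by
      rw [eq_bot_iff]
      intro x hx
      refine (Submodule.mem_bot ℂ).2 (hilbertBasis_ext ψ fun k => ?_)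
      have h1 := (Submodule.mem_orthogonal _ _).1 hx _ (Submodule.subset_span ⟨k, rfl⟩)
      rw [inner_smul_left] at h1
      rw [inner_zero_right]
      refine (mul_eq_zero.1 h1).resolve_left ?_
      simp [Complex.exp_ne_zero])

variable [CompleteSpace H]

/-- The unitary group `e^{-i t H₀}`. -/
@[irreducible]
noncomputable def freeEvol (lam : ℕ → ℝ) (ψ : HilbertBasis ℕ ℂ H) (t : ℝ) : H ≃ₗᵢ[ℂ] H :=
  ψ.repr.trans (phasedBasis lam ψ t).repr.symm

variable (lam : ℕ → ℝ) (ψ : HilbertBasis ℕ ℂ H)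

theorem inner_freeEvol (t : ℝ) (k : ℕ) (x : H) :
    inner ℂ (ψ k) (freeEvol lam ψ t x) =
      Complex.exp (-(Complex.I * ((lam k * t : ℝ) : ℂ))) * inner ℂ (ψ k) x := by
  have h1 : inner ℂ (phasedBasis lam ψ t k) (freeEvol lam ψ t x) = inner ℂ (ψ k) x := by
    rw [← HilbertBasis.repr_apply_apply, ← HilbertBasis.repr_apply_apply]
    simp [freeEvol]
  have h2 : phasedBasis lam ψ t k =
      Complex.exp (-(Complex.I * ((lam k * t : ℝ) : ℂ))) • ψ k := by
    simp [phasedBasis]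
  rw [h2, inner_smul_left] at h1
  rw [← h1, ← mul_assoc, phase_mul_conj, one_mul]

theorem norm_inner_freeEvol (t : ℝ) (k : ℕ) (x : H) :
    ‖inner ℂ (ψ k) (freeEvol lam ψ t x)‖ = ‖inner ℂ (ψ k) x‖ := by
  rw [inner_freeEvol, norm_mul, norm_phase, one_mul]

theorem freeEvol_add (s t : ℝ) (x : H) :
    freeEvol lam ψ (s + t) x = freeEvol lam ψ s (freeEvol lam ψ t x) := by
  refine hilbertBasis_ext ψ fun k => ?_
  simp only [inner_freeEvol]
  rw [← mul_assoc, ← Complex.exp_add]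
  congr 2
  push_cast
  ring

theorem freeEvol_zero (x : H) : freeEvol lam ψ 0 x = x := by
  refine hilbertBasis_ext ψ fun k => ?_
  simp [inner_freeEvol]

theorem freeEvol_freeEvol_neg (t : ℝ) (x : H) :
    freeEvol lam ψ t (freeEvol lam ψ (-t) x) = x := by
  rw [← freeEvol_add, add_neg_cancel, freeEvol_zero]

theorem inner_freeEvol_neg_left (t : ℝ) (x y : H) :
    inner ℂ (freeEvol lam ψ (-t) x) y = inner ℂ x (freeEvol lam ψ t y) := by
  rw [← (freeEvol lam ψ t).inner_map_map, freeEvol_freeEvol_neg]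

/-- Parseval expands the squared distance into modes, and dominated convergence applies with the
bound `4 |⟨ψ_k, x⟩|²`. -/
theorem continuous_freeEvol_apply (x : H) : Continuous fun t => freeEvol lam ψ t x := by
  refine continuous_iff_continuousAt.2 fun t₀ => ?_
  rw [ContinuousAt, tendsto_iff_norm_sub_tendsto_zero]
  have h1 : ∀ t, ‖freeEvol lam ψ t x - freeEvol lam ψ t₀ x‖ ^ 2 =
      ∑' k, ‖Complex.exp (-(Complex.I * ((lam k * t : ℝ) : ℂ))) -
        Complex.exp (-(Complex.I * ((lam k * t₀ : ℝ) : ℂ)))‖ ^ 2 * ‖inner ℂ (ψ k) x‖ ^ 2 := by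
    intro t
    rw [← (hilbertBasis_hasSum_norm_sq ψ _).tsum_eq]
    refine tsum_congr fun k => ?_
    rw [inner_sub_right, inner_freeEvol, inner_freeEvol, ← sub_mul, norm_mul, mul_pow]
  have h2 : Tendsto (fun t => ‖freeEvol lam ψ t x - freeEvol lam ψ t₀ x‖ ^ 2) (𝓝 t₀) (𝓝 0) := by
    simp only [h1]
    have h3 := tendsto_tsum_of_dominated_convergence (𝓕 := 𝓝 t₀)
      (f := fun t k => ‖Complex.exp (-(Complex.I * ((lam k * t : ℝ) : ℂ))) -
        Complex.exp (-(Complex.I * ((lam k * t₀ : ℝ) : ℂ)))‖ ^ 2 * ‖inner ℂ (ψ k) x‖ ^ 2)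
      (g := fun _ => 0) (bound := fun k => 4 * ‖inner ℂ (ψ k) x‖ ^ 2)
      ((hilbertBasis_hasSum_norm_sq ψ x).summable.mul_left 4) (fun k => ?_)
      (Eventually.of_forall fun t k => ?_)
    · simpa using h3
    · have hc : Continuous fun t : ℝ => ‖Complex.exp (-(Complex.I * ((lam k * t : ℝ) : ℂ))) -
        Complex.exp (-(Complex.I * ((lam k * t₀ : ℝ) : ℂ)))‖ ^ 2 * ‖inner ℂ (ψ k) x‖ ^ 2 := by
        fun_prop
      simpa using hc.tendsto t₀
    · rw [norm_mul, norm_pow, norm_norm, norm_pow, norm_norm]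
      gcongr
      have h4 := norm_sub_le (Complex.exp (-(Complex.I * ((lam k * t : ℝ) : ℂ))))
        (Complex.exp (-(Complex.I * ((lam k * t₀ : ℝ) : ℂ))))
      rw [norm_phase, norm_phase] at h4
      nlinarith [norm_nonneg (Complex.exp (-(Complex.I * ((lam k * t : ℝ) : ℂ))) -
        Complex.exp (-(Complex.I * ((lam k * t₀ : ℝ) : ℂ))))]
  have h3 := h2.sqrt
  simpa [Real.sqrt_sq] using h3

theorem continuous_freeEvol : Continuous fun p : ℝ × H => freeEvol lam ψ p.1 p.2 := by
  refine continuous_iff_continuousAt.2 fun p₀ => ?_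
  rw [ContinuousAt, tendsto_iff_norm_sub_tendsto_zero]
  have h1 : Tendsto (fun p : ℝ × H => ‖p.2 - p₀.2‖ +
      ‖freeEvol lam ψ p.1 p₀.2 - freeEvol lam ψ p₀.1 p₀.2‖) (𝓝 p₀) (𝓝 0) := by
    have hc : Continuous fun p : ℝ × H => ‖p.2 - p₀.2‖ +
      ‖freeEvol lam ψ p.1 p₀.2 - freeEvol lam ψ p₀.1 p₀.2‖ :=
      (continuous_snd.sub continuous_const).norm.add
        (((continuous_freeEvol_apply lam ψ p₀.2).comp continuous_fst).sub continuous_const).norm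
    simpa using hc.tendsto p₀
  refine squeeze_zero (fun _ => norm_nonneg _) (fun p => ?_) h1
  have h2 : freeEvol lam ψ p.1 p.2 - freeEvol lam ψ p₀.1 p₀.2 = freeEvol lam ψ p.1 (p.2 - p₀.2) +
      (freeEvol lam ψ p.1 p₀.2 - freeEvol lam ψ p₀.1 p₀.2) := by
    rw [map_sub]; abel
  rw [h2]
  refine (norm_add_le _ _).trans ?_
  rw [LinearIsometryEquiv.norm_map]

/-- The perturbation in the interaction picture. -/
@[irreducible]
noncomputable def interaction (β : H →L[ℂ] H) (t : ℝ) : H →L[ℂ] H :=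
  ((freeEvol lam ψ (-t)).toContinuousLinearEquiv : H →L[ℂ] H) ∘L β ∘L
    ((freeEvol lam ψ t).toContinuousLinearEquiv : H →L[ℂ] H)

theorem interaction_apply (β : H →L[ℂ] H) (t : ℝ) (x : H) :
    interaction lam ψ β t x = freeEvol lam ψ (-t) (β (freeEvol lam ψ t x)) := by
  unfold interaction; rfl

theorem continuous_interaction (β : H →L[ℂ] H) :
    Continuous fun p : ℝ × H => interaction lam ψ β p.1 p.2 := by
  simp only [interaction_apply]
  have h := continuous_freeEvol lam ψ
  exact h.comp (continuous_fst.neg.prodMk (β.continuous.comp h))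

/-- A nonintegrable `|g₀|` would have integral `0` by convention, not `1`. -/
theorem DefectProfile.integrable {g₀ : ℝ → ℝ} {T : ℝ} (hg : DefectProfile g₀ T) :
    Integrable g₀ := by
  have h1 : Integrable fun t => |g₀ t| := by
    by_contra h
    have h2 := hg.norm_eq
    rw [integral_undef h] at h2
    exact zero_ne_one h2
  exact (integrable_norm_iff hg.memLp.1).1 h1

theorem DefectProfile.pos {g₀ : ℝ → ℝ} {T : ℝ} (hg : DefectProfile g₀ T) : 0 < T := by
  by_contra! hT
  have h0 : (fun t => |g₀ t|) =ᵐ[volume] 0 := by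
    have : ∀ᵐ t : ℝ, t ≠ 0 := by simp [ae_iff]
    filter_upwards [this] with t ht
    have : g₀ t = 0 := hg.support t fun h => ht (le_antisymm (h.2.trans hT) h.1)
    simp [this]
  have h1 := hg.norm_eq
  rw [integral_congr_ae h0] at h1
  simp at h1

theorem isInteraction {β : H →L[ℂ] H} (hβ : NormalizedCoupling β) {g₀ : ℝ → ℝ} {T : ℝ}
    (hg : DefectProfile g₀ T) : IsInteraction (interaction lam ψ β) g₀ T where
  nonneg := hg.pos.le
  cont := continuous_interaction lam ψ β
  norm_le s := ContinuousLinearMap.opNorm_le_bound _ zero_le_one fun x => by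
    rw [interaction_apply, LinearIsometryEquiv.norm_map]
    refine (β.le_opNorm _).trans ?_
    rw [hβ.norm_eq, LinearIsometryEquiv.norm_map]
  symm s x y := by
    have hsym := ContinuousLinearMap.isSelfAdjoint_iff_isSymmetric.1 hβ.selfAdjoint
    rw [interaction_apply, interaction_apply, inner_freeEvol_neg_left]
    have h1 := inner_freeEvol_neg_left lam ψ (-s) x (β (freeEvol lam ψ s y))
    rw [neg_neg] at h1
    rw [← h1]
    exact hsym _ _
  integrable := hg.integrable
  integrable_sq := hg.memLp.integrable_sq
  integral_le := by
    rw [intervalIntegral.integral_of_le hg.pos.le, ← hg.norm_eq]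
    exact setIntegral_le_integral hg.integrable.abs (ae_of_all _ fun s => abs_nonneg _)

end FreeEvolution

/-! ### From the weak equation to mild solutions in the interaction picture. -/

section Solution

/-- The variation of constants formula for a scalar equation with integrable source. -/
theorem exp_mul_eq_add_integral {c h : ℝ → ℂ} {l T : ℝ} (hT : 0 ≤ T)
    (hc : ContinuousOn c (Set.Icc 0 T)) (hh : IntervalIntegrable h volume 0 T)
    (heq : ∀ t ∈ Set.Icc 0 T, c t = c 0 + ∫ s in (0 : ℝ)..t, (-(Complex.I * l * c s) + h s)) :
    Complex.exp (Complex.I * l * T) * c T =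
      c 0 + ∫ s in (0 : ℝ)..T, Complex.exp (Complex.I * l * s) * h s := by
  have hexp : Continuous fun t : ℝ => Complex.exp (Complex.I * l * t) := by fun_prop
  have hd : ∀ t : ℝ, HasDerivAt (fun t : ℝ => Complex.exp (Complex.I * l * t))
      (Complex.I * l * Complex.exp (Complex.I * l * t)) t := fun t => by
    have h1 : HasDerivAt (fun t : ℝ => Complex.I * l * (t : ℂ)) (Complex.I * l) t := by
      simpa using (Complex.ofRealCLM.hasDerivAt (x := t)).const_mul (Complex.I * l)
    exact h1.cexp.congr_deriv (mul_comm _ _)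
  have hdc : Continuous fun t : ℝ => Complex.I * l * Complex.exp (Complex.I * l * t) := by fun_prop
  have hci : IntervalIntegrable (fun s => -(Complex.I * l * c s)) volume 0 T := by
    refine ContinuousOn.intervalIntegrable ?_
    rw [Set.uIcc_of_le hT]
    exact (continuousOn_const.mul hc).neg
  have hprod : IntervalIntegrable (fun s => Complex.exp (Complex.I * l * s) * h s) volume 0 T :=
    hh.continuousOn_mul hexp.continuousOn
  have key : ∀ r : ℝ, (ContinuousLinearMap.mul ℝ ℂ (Complex.I * l * Complex.exp (Complex.I * l * r))
      (c r) + ContinuousLinearMap.mul ℝ ℂ (Complex.exp (Complex.I * l * r))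
      (-(Complex.I * l * c r) + h r)) = Complex.exp (Complex.I * l * r) * h r := fun r => by
    simp only [ContinuousLinearMap.mul_apply']; ring
  have h2 := bilin_eq_add_integral (ContinuousLinearMap.mul ℝ ℂ)
    (u := fun t : ℝ => Complex.exp (Complex.I * l * t)) (v := c) hT
    (hdc.intervalIntegrable 0 T) (hci.add hh)
    (fun t _ => by
      rw [intervalIntegral.integral_eq_sub_of_hasDerivAt (fun s _ => hd s)
        (hdc.intervalIntegrable 0 t)]; ring) heq (by simp only [key]; exact hprod)
  simp only [key] at h2
  simpa using h2

variable {H : Type*} [NormedAddCommGroup H] [InnerProductSpace ℂ H] [CompleteSpace H]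

theorem IsSolution.mode_equation {H₀ : H →ₗ.[ℂ] H} {lam : ℕ → ℝ} {ψ : HilbertBasis ℕ ℂ H}
    (hH₀ : PurePoint H₀ lam ψ) {β : H →L[ℂ] H} {ε : ℝ} {g : ℝ → ℝ} {φ₀ : H} {φ : ℝ → H}
    (hφ : IsSolution H₀ β ε g φ₀ φ) {a L : ℝ} (ha : 0 ≤ a) {gl : ℝ → ℝ}
    (hloc : ∀ s ∈ Set.Ioo 0 L, g (a + s) = gl s)
    (hint : IntervalIntegrable g volume 0 (a + L)) (k : ℕ) {s : ℝ} (hs : s ∈ Set.Icc 0 L) :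
    inner ℂ (ψ k) (φ (a + s)) = inner ℂ (ψ k) (φ a) + ∫ r in (0 : ℝ)..s,
      (-(Complex.I * lam k * inner ℂ (ψ k) (φ (a + r))) +
        -(Complex.I * ε) * (gl r * inner ℂ (ψ k) (β (φ (a + r))))) := by
  obtain ⟨hdom, heig⟩ := hH₀.eigen k
  set F : ℝ → ℂ := fun s => inner ℂ (H₀ ⟨ψ k, hdom⟩) (φ s) +
    (ε : ℂ) * (g s : ℂ) * inner ℂ (ψ k) (β (φ s)) with hF
  have hFi : ∀ r ∈ Set.Icc 0 (a + L), IntervalIntegrable F volume 0 r := fun r hr => by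
    have hsub : Set.uIcc 0 r ⊆ Set.Ici 0 := by
      rw [Set.uIcc_of_le hr.1]; exact Set.Icc_subset_Ici_self
    have hφr := hφ.continuousOn.mono hsub
    have h1 : IntervalIntegrable (fun s => (g s : ℂ)) volume 0 r := by
      have : IntervalIntegrable g volume 0 r := hint.mono_set (by
        rw [Set.uIcc_of_le hr.1, Set.uIcc_of_le (hr.1.trans hr.2)]
        exact Set.Icc_subset_Icc_right hr.2)
      exact ⟨this.1.ofReal, this.2.ofReal⟩
    refine IntervalIntegrable.add ?_ ?_
    · exact (continuousOn_const.inner hφr).intervalIntegrable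
    · exact (h1.const_mul (ε : ℂ)).mul_continuousOn
        (continuousOn_const.inner (β.continuous.comp_continuousOn hφr))
  have e1 := hφ.equation ⟨ψ k, hdom⟩ (a + s) (add_nonneg ha hs.1)
  have e2 := hφ.equation ⟨ψ k, hdom⟩ a ha
  have hsL : s ≤ L := hs.2
  have hL : 0 ≤ L := hs.1.trans hs.2
  have e3 : inner ℂ (ψ k) (φ (a + s)) - inner ℂ (ψ k) (φ a) =
      -(Complex.I * ∫ r in a..(a + s), F r) := by
    have e4 := intervalIntegral.integral_interval_sub_left
      (hFi (a + s) ⟨add_nonneg ha hs.1, by linarith⟩) (hFi a ⟨ha, by linarith⟩)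
    rw [← e4, e1, e2]
    ring
  have e5 : ∫ r in a..(a + s), F r = ∫ r in (0 : ℝ)..s, F (a + r) := by
    rw [intervalIntegral.integral_comp_add_left, add_zero]
  -- The amplitude is known only on the open interval; the endpoints are null sets.
  rw [← sub_eq_iff_eq_add', e3, e5, ← intervalIntegral.integral_const_mul,
    ← intervalIntegral.integral_neg, intervalIntegral.integral_of_le hs.1,
    intervalIntegral.integral_of_le hs.1, integral_Ioc_eq_integral_Ioo,
    integral_Ioc_eq_integral_Ioo]
  refine setIntegral_congr_fun measurableSet_Ioo fun r hr => ?_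
  have hr' : r ∈ Set.Ioo 0 L := ⟨hr.1, hr.2.trans_le hsL⟩
  simp only [hF, heig, inner_smul_left, Complex.conj_ofReal, hloc r hr']
  ring

theorem IsSolution.mode_formula {H₀ : H →ₗ.[ℂ] H} {lam : ℕ → ℝ} {ψ : HilbertBasis ℕ ℂ H}
    (hH₀ : PurePoint H₀ lam ψ) {β : H →L[ℂ] H} {ε : ℝ} {g : ℝ → ℝ} {φ₀ : H} {φ : ℝ → H}
    (hφ : IsSolution H₀ β ε g φ₀ φ) {a L : ℝ} (ha : 0 ≤ a) {gl : ℝ → ℝ}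
    (hgl : Integrable gl) (hloc : ∀ s ∈ Set.Ioo 0 L, g (a + s) = gl s)
    (hint : IntervalIntegrable g volume 0 (a + L)) (k : ℕ) {t : ℝ} (ht : t ∈ Set.Icc 0 L) :
    Complex.exp (Complex.I * lam k * t) * inner ℂ (ψ k) (φ (a + t)) =
      inner ℂ (ψ k) (φ a) + ∫ s in (0 : ℝ)..t, Complex.exp (Complex.I * lam k * s) *
        (-(Complex.I * ε) * (gl s * inner ℂ (ψ k) (β (φ (a + s))))) := by
  have hφa : ContinuousOn (fun t => φ (a + t)) (Set.Icc 0 t) :=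
    hφ.continuousOn.comp (by fun_prop) fun t ht => add_nonneg ha ht.1
  have hgli : IntervalIntegrable (fun r => (gl r : ℂ)) volume 0 t := hgl.ofReal.intervalIntegrable
  have hβc : ContinuousOn (fun s => inner ℂ (ψ k) (β (φ (a + s)))) (Set.uIcc 0 t) := by
    rw [Set.uIcc_of_le ht.1]
    exact continuousOn_const.inner (β.continuous.comp_continuousOn hφa)
  have h := exp_mul_eq_add_integral (c := fun s => inner ℂ (ψ k) (φ (a + s)))
    (h := fun s => -(Complex.I * ε) * (gl s * inner ℂ (ψ k) (β (φ (a + s))))) (l := lam k) ht.1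
    (continuousOn_const.inner hφa) ((hgli.mul_continuousOn hβc).const_mul _) (fun s hs => by
      rw [add_zero]
      exact hφ.mode_equation hH₀ ha hloc hint k ⟨hs.1, hs.2.trans ht.2⟩)
  rwa [add_zero] at h

/-- The eigenvectors lie in the domain of `H₀` and may be used as test vectors. Variation of
constants in each mode then yields the mild equation coordinate by coordinate, for an arbitrary
window in which the amplitude is `gl`. -/
theorem IsSolution.isMild {H₀ : H →ₗ.[ℂ] H} {lam : ℕ → ℝ} {ψ : HilbertBasis ℕ ℂ H}
    (hH₀ : PurePoint H₀ lam ψ) {β : H →L[ℂ] H} {ε : ℝ} {g : ℝ → ℝ} {φ₀ : H} {φ : ℝ → H}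
    (hφ : IsSolution H₀ β ε g φ₀ φ) {a L : ℝ} (ha : 0 ≤ a) {gl : ℝ → ℝ}
    (hgl : Integrable gl) (hloc : ∀ s ∈ Set.Ioo 0 L, g (a + s) = gl s)
    (hint : IntervalIntegrable g volume 0 (a + L)) :
    IsMild (interaction lam ψ β) gl L ε (φ a) (fun t => freeEvol lam ψ (-t) (φ (a + t))) := by
  have hφa : ContinuousOn (fun t => φ (a + t)) (Set.Icc 0 L) :=
    hφ.continuousOn.comp (by fun_prop) fun t ht => add_nonneg ha ht.1
  have hu : ContinuousOn (fun t => freeEvol lam ψ (-t) (φ (a + t))) (Set.Icc 0 L) :=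
    (continuous_freeEvol lam ψ).comp_continuousOn (continuousOn_id.neg.prodMk hφa)
  refine ⟨hu, fun t ht => hilbertBasis_ext ψ fun k => ?_⟩
  have hgli : IntervalIntegrable (fun r => (gl r : ℂ)) volume 0 t := hgl.ofReal.intervalIntegrable
  have h0t : Set.uIcc 0 t ⊆ Set.Icc 0 L := by
    rw [Set.uIcc_of_le ht.1]; exact Set.Icc_subset_Icc_right ht.2
  have hcont : ContinuousOn (fun r => interaction lam ψ β r (freeEvol lam ψ (-r) (φ (a + r))))
      (Set.uIcc 0 t) :=
    (continuous_interaction lam ψ β).comp_continuousOn (continuousOn_id.prodMk (hu.mono h0t))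
  have hbi := hgli.smul_continuousOn hcont
  have hcomm := (innerSL ℂ (ψ k)).intervalIntegral_comp_comm hbi
  simp only [innerSL_apply_apply] at hcomm
  have hphase : ∀ r : ℝ, Complex.exp (-(Complex.I * ((lam k * -r : ℝ) : ℂ))) =
      Complex.exp (Complex.I * lam k * r) := fun r => by
    congr 1; push_cast; ring
  rw [inner_freeEvol, inner_sub_right, inner_smul_right, ← hcomm, hphase,
    hφ.mode_formula hH₀ ha hgl hloc hint k ht, sub_eq_add_neg,
    ← intervalIntegral.integral_const_mul, ← intervalIntegral.integral_neg]
  congr 1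
  refine intervalIntegral.integral_congr fun r _ => ?_
  rw [inner_smul_right, interaction_apply, inner_freeEvol, hphase, freeEvol_freeEvol_neg]
  ring

end Solution

end PowerDiffusion
namespace PowerDiffusion

/-! ### Gaps and defects along the train, and the one-step evolution. -/

section Train

variable {Ω : Type*} {d : ℕ → Ω → ℝ} {T : ℝ} {ω : Ω} {g₀ : ℝ → ℝ}

theorem gapStart_succ (d : ℕ → Ω → ℝ) (T : ℝ) (n : ℕ) (ω : Ω) :
    gapStart d T (n + 1) ω = onset d T n ω + T := by
  rw [gapStart, Finset.sum_range_succ, onset, gapStart, add_assoc]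

theorem gapStart_zero (d : ℕ → Ω → ℝ) (T : ℝ) (ω : Ω) : gapStart d T 0 ω = 0 := by
  simp [gapStart]

theorem gapStart_le_onset (hd : ∀ l, 0 ≤ d l ω) (n : ℕ) : gapStart d T n ω ≤ onset d T n ω :=
  le_add_of_nonneg_right (hd n)

theorem monotone_gapStart (hd : ∀ l, 0 ≤ d l ω) (hT : 0 ≤ T) :
    Monotone fun n => gapStart d T n ω :=
  monotone_nat_of_le_succ fun n => by
    rw [gapStart_succ]
    exact (gapStart_le_onset hd n).trans (le_add_of_nonneg_right hT)

theorem gapStart_nonneg (hd : ∀ l, 0 ≤ d l ω) (hT : 0 ≤ T) (n : ℕ) : 0 ≤ gapStart d T n ω := by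
  rw [← gapStart_zero d T ω]
  exact monotone_gapStart hd hT (Nat.zero_le n)

theorem onset_add_le_gapStart (hd : ∀ l, 0 ≤ d l ω) (hT : 0 ≤ T) {m n : ℕ} (h : m < n) :
    onset d T m ω + T ≤ gapStart d T n ω := by
  rw [← gapStart_succ]
  exact monotone_gapStart hd hT h

theorem monotone_onset (hd : ∀ l, 0 ≤ d l ω) (hT : 0 ≤ T) : Monotone fun n => onset d T n ω :=
  monotone_nat_of_le_succ fun n => by
    have h1 := onset_add_le_gapStart (T := T) hd hT (Nat.lt_succ_self n)
    have h2 := gapStart_le_onset (T := T) hd (n + 1)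
    simp only [Nat.succ_eq_add_one] at h1
    linarith

/-- Endpoints are excluded because `g₀` may be nonzero at `0` and `T`. Defects are ordered with
disjoint interiors, so no term of the sum reaches into the gap. -/
theorem defectTrain_gap (hd : ∀ l, 0 ≤ d l ω) (hg : DefectProfile g₀ T) (n : ℕ) {s : ℝ}
    (hs : s ∈ Set.Ioo 0 (d n ω)) : defectTrain g₀ d T ω (gapStart d T n ω + s) = 0 := by
  have hT := hg.pos.le
  have h0 : ∀ m, g₀ (gapStart d T n ω + s - onset d T m ω) = 0 := fun m => by
    refine hg.support _ fun h => ?_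
    rcases lt_or_ge m n with hmn | hmn
    · have := onset_add_le_gapStart (T := T) hd hT hmn
      linarith [h.2, hs.1]
    · have h1 : onset d T n ω ≤ onset d T m ω := monotone_onset hd hT hmn
      have h2 : onset d T n ω = gapStart d T n ω + d n ω := rfl
      linarith [h.1, hs.2]
  simp [defectTrain, h0]

theorem defectTrain_defect (hd : ∀ l, 0 ≤ d l ω) (hg : DefectProfile g₀ T) (n : ℕ) {s : ℝ}
    (hs : s ∈ Set.Ioo 0 T) : defectTrain g₀ d T ω (onset d T n ω + s) = g₀ s := by
  have hT := hg.pos.le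
  rw [defectTrain, tsum_eq_single n]
  · rw [add_sub_cancel_left]
  · intro m hm
    refine hg.support _ fun h => ?_
    rcases lt_or_gt_of_ne hm with hmn | hmn
    · have h1 := onset_add_le_gapStart (T := T) hd hT hmn
      have h2 := gapStart_le_onset (T := T) hd n
      linarith [h.2, hs.1]
    · have h1 := onset_add_le_gapStart (T := T) hd hT hmn
      have h2 := gapStart_le_onset (T := T) hd m
      linarith [h.1, hs.2]

theorem intervalIntegrable_of_shift {g gl : ℝ → ℝ} {a L : ℝ} (hL : 0 ≤ L) (hgl : Integrable gl)
    (hloc : ∀ s ∈ Set.Ioo 0 L, g (a + s) = gl s) : IntervalIntegrable g volume a (a + L) := by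
  rw [intervalIntegrable_iff_integrableOn_Ioo_of_le (le_add_of_nonneg_right hL)]
  refine ((hgl.comp_sub_right a).integrableOn).congr_fun (fun s hs => ?_) measurableSet_Ioo
  have := hloc (s - a) ⟨sub_pos.2 hs.1, by linarith [hs.2]⟩
  simp only
  rw [← this, add_sub_cancel]

theorem defectTrain_intervalIntegrable (hd : ∀ l, 0 ≤ d l ω) (hg : DefectProfile g₀ T) (n : ℕ) :
    IntervalIntegrable (defectTrain g₀ d T ω) volume 0 (gapStart d T n ω) ∧
      IntervalIntegrable (defectTrain g₀ d T ω) volume 0 (onset d T n ω) := by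
  have hgap : ∀ n, IntervalIntegrable (defectTrain g₀ d T ω) volume (gapStart d T n ω)
      (onset d T n ω) := fun n =>
    intervalIntegrable_of_shift (gl := fun _ => 0) (hd n) (integrable_zero _ _ _)
      fun s hs => defectTrain_gap hd hg n hs
  have hdef : ∀ n, IntervalIntegrable (defectTrain g₀ d T ω) volume (onset d T n ω)
      (gapStart d T (n + 1) ω) := fun n => by
    rw [gapStart_succ]
    exact intervalIntegrable_of_shift hg.pos.le hg.integrable
      fun s hs => defectTrain_defect hd hg n hs
  have h1 : IntervalIntegrable (defectTrain g₀ d T ω) volume 0 (gapStart d T n ω) := by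
    induction n with
    | zero => rw [gapStart_zero]
    | succ n ih => exact (ih.trans (hgap n)).trans (hdef n)
  exact ⟨h1, h1.trans (hgap n)⟩

variable {H : Type*} [NormedAddCommGroup H] [InnerProductSpace ℂ H] [CompleteSpace H]
  {H₀ : H →ₗ.[ℂ] H} {lam : ℕ → ℝ} {ψ : HilbertBasis ℕ ℂ H} {β : H →L[ℂ] H} {ε : ℝ} {φ₀ : H}
  {φ : ℝ → H}

theorem IsSolution.gap_eq (hH₀ : PurePoint H₀ lam ψ) (hd : ∀ l, 0 ≤ d l ω)
    (hg : DefectProfile g₀ T) (hφ : IsSolution H₀ β ε (defectTrain g₀ d T ω) φ₀ φ) (n : ℕ) {θ : ℝ}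
    (hθ : θ ∈ Set.Icc (gapStart d T n ω) (onset d T n ω)) :
    φ θ = freeEvol lam ψ (θ - gapStart d T n ω) (φ (gapStart d T n ω)) := by
  have h := (hφ.isMild hH₀ (gl := fun _ => 0) (gapStart_nonneg hd hg.pos.le n)
    (integrable_zero _ _ _) (fun s hs => defectTrain_gap hd hg n hs)
    (defectTrain_intervalIntegrable hd hg n).2).equation (θ - gapStart d T n ω)
    ⟨sub_nonneg.2 hθ.1, sub_le_iff_le_add'.2 hθ.2⟩
  simp only [Complex.ofReal_zero, zero_smul, intervalIntegral.integral_zero, smul_zero, sub_zero,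
    add_sub_cancel] at h
  rw [← h, freeEvol_freeEvol_neg]

theorem IsSolution.defect_eq (hH₀ : PurePoint H₀ lam ψ) (hβ : NormalizedCoupling β)
    (hd : ∀ l, 0 ≤ d l ω)
    (hg : DefectProfile g₀ T) (hφ : IsSolution H₀ β ε (defectTrain g₀ d T ω) φ₀ φ) (n : ℕ) :
    φ (gapStart d T (n + 1) ω) =
      freeEvol lam ψ T ((isInteraction lam ψ hβ hg).propagator ε (φ (onset d T n ω))) := by
  have h0 : 0 ≤ onset d T n ω :=
    (gapStart_nonneg hd hg.pos.le n).trans (gapStart_le_onset hd n)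
  have h := hφ.isMild hH₀ h0 hg.integrable (fun s hs => defectTrain_defect hd hg n hs)
    (by rw [← gapStart_succ]; exact (defectTrain_intervalIntegrable hd hg (n + 1)).1)
  rw [h.propagator_eq, freeEvol_freeEvol_neg, gapStart_succ]

/-- One step of the random evolution, from the end of a defect to the end of the next one. -/
theorem IsSolution.step_eq (hH₀ : PurePoint H₀ lam ψ) (hβ : NormalizedCoupling β)
    (hd : ∀ l, 0 ≤ d l ω)
    (hg : DefectProfile g₀ T) (hφ : IsSolution H₀ β ε (defectTrain g₀ d T ω) φ₀ φ) (n : ℕ) :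
    φ (gapStart d T (n + 1) ω) =
      freeEvol lam ψ T ((isInteraction lam ψ hβ hg).propagator ε
        (freeEvol lam ψ (d n ω) (φ (gapStart d T n ω)))) := by
  rw [hφ.defect_eq hH₀ hβ hd hg, hφ.gap_eq hH₀ hd hg n ⟨gapStart_le_onset hd n, le_rfl⟩]
  congr 4
  exact add_sub_cancel_left _ _

end Train

/-! ### The one-defect transition matrix and its second-order expansion. -/

section Matrices

variable {H : Type*} [NormedAddCommGroup H] [InnerProductSpace ℂ H] [CompleteSpace H]
  (lam : ℕ → ℝ) (ψ : HilbertBasis ℕ ℂ H) {β : H →L[ℂ] H} {g₀ : ℝ → ℝ} {T : ℝ}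

/-- The first order scattering operator. -/
noncomputable def bornOp (β : H →L[ℂ] H) (g₀ : ℝ → ℝ) (T : ℝ) (x : H) : H :=
  ∫ s in (0 : ℝ)..T, (g₀ s : ℂ) • interaction lam ψ β s x

theorem norm_bornOp_le (hβ : NormalizedCoupling β) (hg : DefectProfile g₀ T) (x : H) :
    ‖bornOp lam ψ β g₀ T x‖ ≤ ‖x‖ := by
  have hi := isInteraction lam ψ hβ hg
  calc _ ≤ ∫ s in (0 : ℝ)..T, |g₀ s| * ‖x‖ := by
        refine intervalIntegral.norm_integral_le_of_norm_le hi.nonneg (ae_of_all _ fun s hs => ?_)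
          (hi.integrable.abs.intervalIntegrable.mul_const _)
        rw [norm_smul, Complex.norm_real, Real.norm_eq_abs]
        gcongr
        exact hi.norm_apply_le s _
    _ ≤ 1 * ‖x‖ := by
        rw [intervalIntegral.integral_mul_const]
        gcongr
        exact hi.integral_le
    _ = _ := one_mul _

/-- In the interaction picture the matrix element `α_{kj}` rotates with the phase `e^{i(λ_k -
λ_j)s}`; integration against `g₀` produces the Fourier transform. -/
theorem inner_bornOp (hβ : NormalizedCoupling β) (hg : DefectProfile g₀ T) (k j : ℕ) :
    inner ℂ (ψ k) (bornOp lam ψ β g₀ T (ψ j)) =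
      coupling ψ β k j * fourierHat g₀ (-(lam k - lam j)) := by
  have hi := isInteraction lam ψ hβ hg
  have hbi := hi.intervalIntegrable (u := fun _ => ψ j) continuousOn_const
    (⟨le_rfl, hi.nonneg⟩ : (0 : ℝ) ∈ Set.Icc 0 T) (⟨hi.nonneg, le_rfl⟩ : T ∈ Set.Icc 0 T)
  have hcomm := (innerSL ℂ (ψ k)).intervalIntegral_comp_comm hbi
  simp only [innerSL_apply_apply] at hcomm
  have hfree : ∀ s : ℝ, freeEvol lam ψ s (ψ j) =
      Complex.exp (-(Complex.I * ((lam j * s : ℝ) : ℂ))) • ψ j := fun s => by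
    refine hilbertBasis_ext ψ fun l => ?_
    rw [inner_freeEvol, inner_smul_right]
    by_cases hl : l = j
    · rw [hl]
    · rw [ψ.orthonormal.2 hl, mul_zero, mul_zero]
  have hhat : fourierHat g₀ (-(lam k - lam j)) = ∫ s in (0 : ℝ)..T,
      Complex.exp (-(Complex.I * ((-(lam k - lam j) : ℝ) : ℂ) * (s : ℂ))) * (g₀ s : ℂ) := by
    rw [intervalIntegral.integral_of_le hi.nonneg, ← integral_Icc_eq_integral_Ioc, fourierHat,
      setIntegral_eq_integral_of_forall_compl_eq_zero]
    intro s hs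
    rw [hg.support s hs]; simp
  rw [bornOp, ← hcomm, hhat, ← intervalIntegral.integral_const_mul]
  refine intervalIntegral.integral_congr fun s _ => ?_
  have hexp : Complex.exp (-(Complex.I * ((lam k * -s : ℝ) : ℂ))) *
      Complex.exp (-(Complex.I * ((lam j * s : ℝ) : ℂ))) =
        Complex.exp (-(Complex.I * ((-(lam k - lam j) : ℝ) : ℂ) * (s : ℂ))) := by
    rw [← Complex.exp_add]
    congr 1
    push_cast
    ring
  rw [inner_smul_right, interaction_apply, inner_freeEvol, hfree, map_smul, inner_smul_right,
    coupling, ← hexp]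
  ring

theorem norm_inner_bornOp_sq (hβ : NormalizedCoupling β) (hg : DefectProfile g₀ T) (k j : ℕ) :
    ‖inner ℂ (ψ k) (bornOp lam ψ β g₀ T (ψ j))‖ ^ 2 = rate lam ψ β g₀ k j := by
  rw [inner_bornOp lam ψ hβ hg, norm_mul, mul_pow, rate]

theorem coupling_conj (hβ : NormalizedCoupling β) (k j : ℕ) :
    coupling ψ β j k = starRingEnd ℂ (coupling ψ β k j) := by
  have hsym := ContinuousLinearMap.isSelfAdjoint_iff_isSymmetric.1 hβ.selfAdjoint
  rw [coupling, coupling, inner_conj_symm]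
  exact (hsym _ _).symm

theorem fourierHat_neg (g : ℝ → ℝ) (ξ : ℝ) :
    fourierHat g (-ξ) = starRingEnd ℂ (fourierHat g ξ) := by
  rw [fourierHat, fourierHat, ← integral_conj]
  refine integral_congr_ae (ae_of_all _ fun t => ?_)
  simp only [map_mul, Complex.conj_ofReal, ← Complex.exp_conj, map_neg, Complex.conj_I]
  push_cast
  congr 2
  ring

/-- Self-adjointness of `β` gives `α_{jk}` as the conjugate of `α_{kj}`, and `g₀` is real, so
`ĝ₀(-ξ)` is the conjugate of `ĝ₀(ξ)`. -/
theorem rate_symm (hβ : NormalizedCoupling β) (k j : ℕ) :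
    rate lam ψ β g₀ k j = rate lam ψ β g₀ j k := by
  rw [rate, rate, coupling_conj ψ hβ k j, ← neg_sub (lam k) (lam j), neg_neg, fourierHat_neg,
    RCLike.norm_conj, RCLike.norm_conj]

omit [CompleteSpace H] in
theorem rate_nonneg (k j : ℕ) : 0 ≤ rate lam ψ β g₀ k j := by
  rw [rate]; positivity

theorem rate_hasSum_col (hβ : NormalizedCoupling β) (hg : DefectProfile g₀ T) (j : ℕ) :
    HasSum (fun k => rate lam ψ β g₀ k j) (‖bornOp lam ψ β g₀ T (ψ j)‖ ^ 2) := by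
  simp only [← norm_inner_bornOp_sq lam ψ hβ hg]
  exact hilbertBasis_hasSum_norm_sq ψ _

theorem rate_tsum_col_le (hβ : NormalizedCoupling β) (hg : DefectProfile g₀ T) (j : ℕ) :
    ‖bornOp lam ψ β g₀ T (ψ j)‖ ^ 2 ≤ 1 := by
  have h := norm_bornOp_le lam ψ hβ hg (ψ j)
  rw [ψ.orthonormal.1 j] at h
  exact pow_le_one₀ (norm_nonneg _) h

/-- The stochastic matrix `1 - B`. -/
noncomputable def limitMatrix (β : H →L[ℂ] H) (g₀ : ℝ → ℝ) (k j : ℕ) : ℝ :=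
  (if j = k then 1 else 0) - bEntry lam ψ β g₀ k j

omit [CompleteSpace H] in
theorem limitMatrix_of_ne {k j : ℕ} (h : j ≠ k) :
    limitMatrix lam ψ β g₀ k j = rate lam ψ β g₀ k j := by
  simp [limitMatrix, bEntry, h]

theorem limitMatrix_symm (hβ : NormalizedCoupling β) (k j : ℕ) :
    limitMatrix lam ψ β g₀ k j = limitMatrix lam ψ β g₀ j k := by
  by_cases h : j = k
  · rw [h]
  · rw [limitMatrix_of_ne lam ψ h, limitMatrix_of_ne lam ψ (Ne.symm h), rate_symm lam ψ hβ]

theorem offDiagonal_summable (hβ : NormalizedCoupling β) (hg : DefectProfile g₀ T) (k : ℕ) :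
    Summable (fun j => if j = k then 0 else rate lam ψ β g₀ k j) := by
  have h := (rate_hasSum_col lam ψ hβ hg k).summable
  refine Summable.of_nonneg_of_le (fun j => ?_) (fun j => ?_) h
  · split_ifs
    exacts [le_rfl, rate_nonneg lam ψ k j]
  · split_ifs
    exacts [rate_nonneg lam ψ j k, (rate_symm lam ψ hβ k j).le]

theorem limitMatrix_hasSum_row (hβ : NormalizedCoupling β) (hg : DefectProfile g₀ T) (k : ℕ) :
    HasSum (fun j => limitMatrix lam ψ β g₀ k j) 1 := by
  have h1 := (offDiagonal_summable lam ψ hβ hg k).hasSum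
  have h2 := hasSum_ite_eq k
    (1 - ∑' l, (if l = k then 0 else rate lam ψ β g₀ k l))
  have h3 := h2.add h1
  rw [sub_add_cancel] at h3
  refine h3.congr_fun fun j => ?_
  by_cases h : j = k
  · simp [limitMatrix, bEntry, h]
  · simp [limitMatrix, bEntry, h]

/-- The diagonal is nonnegative because of the normalizations of `β` and `g₀`: the rates in a column
sum to `‖bornOp ψ_j‖² ≤ 1`. -/
theorem limitMatrix_isSubstochastic (hβ : NormalizedCoupling β) (hg : DefectProfile g₀ T) :
    IsSubstochastic (limitMatrix lam ψ β g₀) where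
  nonneg k j := by
    by_cases h : j = k
    · have h1 : ∑' l, (if l = k then 0 else rate lam ψ β g₀ k l) ≤ 1 := by
        refine le_trans ?_ (rate_tsum_col_le lam ψ hβ hg k)
        rw [← (rate_hasSum_col lam ψ hβ hg k).tsum_eq]
        refine (offDiagonal_summable lam ψ hβ hg k).tsum_le_tsum (fun l => ?_)
          (rate_hasSum_col lam ψ hβ hg k).summable
        split_ifs
        exacts [rate_nonneg lam ψ l k, (rate_symm lam ψ hβ k l).le]
      rw [limitMatrix, bEntry, if_pos h, if_pos h]
      linarith
    · rw [limitMatrix_of_ne lam ψ h]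
      exact rate_nonneg lam ψ k j
  row_summable k := (limitMatrix_hasSum_row lam ψ hβ hg k).summable
  row_le k := (limitMatrix_hasSum_row lam ψ hβ hg k).tsum_eq.le
  col_summable j := by
    simpa only [limitMatrix_symm lam ψ hβ _ j] using
      (limitMatrix_hasSum_row lam ψ hβ hg j).summable
  col_le j := by
    simpa only [limitMatrix_symm lam ψ hβ _ j] using
      (limitMatrix_hasSum_row lam ψ hβ hg j).tsum_eq.le

variable (hβ : NormalizedCoupling β) (hg : DefectProfile g₀ T)

/-- The transition probabilities across one defect. -/
noncomputable def stepMatrix (ε : ℝ) (k j : ℕ) : ℝ :=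
  ‖inner ℂ (ψ k) ((isInteraction lam ψ hβ hg).propagator ε (ψ j))‖ ^ 2

theorem stepMatrix_hasSum_col (ε : ℝ) (j : ℕ) :
    HasSum (fun k => stepMatrix lam ψ hβ hg ε k j) 1 := by
  have h := hilbertBasis_hasSum_norm_sq ψ ((isInteraction lam ψ hβ hg).propagator ε (ψ j))
  rwa [LinearIsometry.norm_map, ψ.orthonormal.1 j, one_pow] at h

/-- The vector whose modes are the amplitudes for a transition to the mode `k`. -/
noncomputable def adjointVector (ε : ℝ) (k : ℕ) : H :=
  ContinuousLinearMap.adjoint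
    ((isInteraction lam ψ hβ hg).propagator ε).toContinuousLinearMap (ψ k)

theorem inner_adjointVector (ε : ℝ) (k : ℕ) (x : H) :
    inner ℂ (adjointVector lam ψ hβ hg ε k) x =
      inner ℂ (ψ k) ((isInteraction lam ψ hβ hg).propagator ε x) :=
  ContinuousLinearMap.adjoint_inner_left _ _ _

theorem stepMatrix_hasSum_row (ε : ℝ) (k : ℕ) :
    HasSum (fun j => stepMatrix lam ψ hβ hg ε k j) (‖adjointVector lam ψ hβ hg ε k‖ ^ 2) := by
  refine (hilbertBasis_hasSum_norm_sq ψ (adjointVector lam ψ hβ hg ε k)).congr_fun fun j => ?_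
  rw [stepMatrix, ← inner_adjointVector, norm_inner_symm]

theorem norm_adjointVector_le (ε : ℝ) (k : ℕ) : ‖adjointVector lam ψ hβ hg ε k‖ ≤ 1 := by
  refine (ContinuousLinearMap.le_opNorm _ _).trans ?_
  rw [ψ.orthonormal.1 k, mul_one, LinearIsometryEquiv.norm_map]
  exact LinearIsometry.norm_toContinuousLinearMap_le _

/-- The propagator is an isometry, so columns sum to one by Parseval. Its adjoint is a contraction,
and this suffices for the rows. -/
theorem stepMatrix_isSubstochastic (ε : ℝ) : IsSubstochastic (stepMatrix lam ψ hβ hg ε) where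
  nonneg k j := sq_nonneg _
  row_summable k := (stepMatrix_hasSum_row lam ψ hβ hg ε k).summable
  row_le k := by
    rw [(stepMatrix_hasSum_row lam ψ hβ hg ε k).tsum_eq]
    exact pow_le_one₀ (norm_nonneg _) (norm_adjointVector_le lam ψ hβ hg ε k)
  col_summable j := (stepMatrix_hasSum_col lam ψ hβ hg ε j).summable
  col_le j := (stepMatrix_hasSum_col lam ψ hβ hg ε j).tsum_eq.le

/-- In a column of sum zero the diagonal entry is minus the sum of the others, hence the factor `2`.
For the transition matrix this spares the second-order expansion of the diagonal amplitude. -/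
theorem tsum_abs_le_of_sum_eq_zero {D e : ℕ → ℝ} {E : ℝ} (j : ℕ) (hD : HasSum D 0)
    (he : HasSum e E) (he0 : ∀ k, 0 ≤ e k) (h : ∀ k, k ≠ j → |D k| ≤ e k) :
    ∑' k, |D k| ≤ 2 * E := by
  have hs : Summable fun k => |D k| := hD.summable.abs
  have h1 := hs.tsum_eq_add_tsum_ite j
  have h2 := hD.summable.tsum_eq_add_tsum_ite j
  rw [hD.tsum_eq] at h2
  have hle : ∀ k, |if k = j then 0 else D k| ≤ e k := fun k => by
    split_ifs with hk
    · simpa using he0 k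
    · exact h k hk
  have h3 : ∑' k, (if k = j then 0 else |D k|) ≤ E := by
    rw [← he.tsum_eq]
    refine Summable.tsum_le_tsum (fun k => ?_) ?_ he.summable
    · have := hle k
      split_ifs at this ⊢ with hk <;> simpa using this
    · refine Summable.of_nonneg_of_le (fun k => ?_) (fun k => ?_) he.summable
      · split_ifs <;> positivity
      · have := hle k
        split_ifs at this ⊢ with hk <;> simpa using this
  have h4 : |D j| ≤ E := by
    have h5 : |∑' k, (if k = j then 0 else D k)| ≤ E := by
      rw [← Real.norm_eq_abs]
      exact tsum_of_norm_bounded he hle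
    have h6 : D j = -∑' k, (if k = j then 0 else D k) := by linarith
    rw [h6, abs_neg]
    exact h5
  linarith

/-- The cross term `2|ε|‖a‖‖r‖` is split by Young's inequality with a weight that makes both parts
of order `|ε|³` when `‖r‖` is of order `ε²`. Both are squares, so they can be summed over the modes
by Parseval. -/
theorem abs_sq_norm_sub_le {ε : ℝ} {z a r : ℂ} (hz : z = -(Complex.I * ε) * a + r) :
    |‖z‖ ^ 2 - ε ^ 2 * ‖a‖ ^ 2| ≤ |ε| ^ 3 * ‖a‖ ^ 2 + (1 / |ε| + 1) * ‖r‖ ^ 2 := by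
  have h1 : ‖-(Complex.I * ε) * a‖ = |ε| * ‖a‖ := by simp
  have hup : ‖z‖ ≤ |ε| * ‖a‖ + ‖r‖ := by
    rw [hz, ← h1]; exact norm_add_le _ _
  have hlo : |ε| * ‖a‖ - ‖r‖ ≤ ‖z‖ := by
    rw [hz, ← h1]
    have := norm_sub_le (-(Complex.I * ε) * a + r) r
    rw [add_sub_cancel_right] at this
    linarith
  have h2 : 2 * |ε| * ‖a‖ * ‖r‖ ≤ |ε| ^ 3 * ‖a‖ ^ 2 + 1 / |ε| * ‖r‖ ^ 2 := by
    rcases (abs_nonneg ε).eq_or_lt with h0 | h0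
    · rw [← h0]; simp
    · have h3 : 0 ≤ (|ε| ^ 2 * ‖a‖ - ‖r‖) ^ 2 / |ε| := by positivity
      have h4 : (|ε| ^ 2 * ‖a‖ - ‖r‖) ^ 2 / |ε| =
          |ε| ^ 3 * ‖a‖ ^ 2 + 1 / |ε| * ‖r‖ ^ 2 - 2 * |ε| * ‖a‖ * ‖r‖ := by
        field_simp; ring
      linarith
  have ha := norm_nonneg a
  have hr := norm_nonneg r
  have hz0 := norm_nonneg z
  have he := abs_nonneg ε
  rw [← sq_abs ε, abs_le]
  have hεa : 0 ≤ |ε| * ‖a‖ := by positivity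
  constructor
  · rcases le_total (|ε| * ‖a‖) ‖r‖ with hc | hc
    · nlinarith [sq_nonneg ‖z‖, mul_nonneg hεa hr]
    · nlinarith [mul_nonneg hεa hr, sq_nonneg ‖r‖]
  · nlinarith [mul_nonneg hεa hr]

/-- It suffices to bound columns. Each column of the difference has sum zero, so only off-diagonal
entries are estimated, where the zeroth-order term vanishes by orthogonality. The Born term
contributes `|ε|³` and the remainder `2|ε|³`; doubling gives `6`. -/
theorem stepMatrix_approx (ε : ℝ) (hε : |ε| ≤ 1) :
    ‖(stepMatrix_isSubstochastic lam ψ hβ hg ε).toEllOne -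
      (1 - ε ^ 2 • (1 - (limitMatrix_isSubstochastic lam ψ hβ hg).toEllOne))‖ ≤ 6 * |ε| ^ 3 := by
  have hε0 := abs_nonneg ε
  refine ellOne_opNorm_le _ (by positivity) fun j => ?_
  set D : lp (fun _ : ℕ => ℝ) 1 := ((stepMatrix_isSubstochastic lam ψ hβ hg ε).toEllOne -
      (1 - ε ^ 2 • (1 - (limitMatrix_isSubstochastic lam ψ hβ hg).toEllOne)))
      (lp.single 1 j 1) with hD
  have hDk : ∀ k, D k = stepMatrix lam ψ hβ hg ε k j - ((if k = j then 1 else 0) -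
      ε ^ 2 * ((if k = j then 1 else 0) - limitMatrix lam ψ β g₀ k j)) := fun k => by
    have e : (lp.single (E := fun _ : ℕ => ℝ) 1 j 1) k = if k = j then 1 else 0 := by
      simp [lp.single_apply, Pi.single_apply]
    rw [← (stepMatrix_isSubstochastic lam ψ hβ hg ε).toEllOne_single j k,
      ← (limitMatrix_isSubstochastic lam ψ hβ hg).toEllOne_single j k, ← e]
    rfl
  have hcolK : HasSum (fun k => limitMatrix lam ψ β g₀ k j) 1 := by
    simpa only [limitMatrix_symm lam ψ hβ _ j] using limitMatrix_hasSum_row lam ψ hβ hg j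
  have hsum : HasSum (fun k => D k) 0 := by
    have h1 := (stepMatrix_hasSum_col lam ψ hβ hg ε j).sub ((hasSum_ite_eq j (1 : ℝ)).sub
      (((hasSum_ite_eq j (1 : ℝ)).sub hcolK).mul_left (ε ^ 2)))
    simp only [sub_self, mul_zero, sub_zero] at h1
    exact h1.congr_fun hDk
  set R : H := (isInteraction lam ψ hβ hg).propagator ε (ψ j) -
    (ψ j - (Complex.I * (ε : ℂ)) • bornOp lam ψ β g₀ T (ψ j)) with hR
  have hRn : ‖R‖ ≤ |ε| ^ 2 := by
    have h1 := (isInteraction lam ψ hβ hg).norm_propagator_sub_le ε (ψ j)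
    rwa [ψ.orthonormal.1 j, mul_one] at h1
  have he := ((rate_hasSum_col lam ψ hβ hg j).mul_left (|ε| ^ 3)).add
    ((hilbertBasis_hasSum_norm_sq ψ R).mul_left (1 / |ε| + 1))
  rw [ellOne_norm_eq]
  simp only [Real.norm_eq_abs]
  refine (tsum_abs_le_of_sum_eq_zero j hsum he (fun k => ?_) fun k hk => ?_).trans ?_
  · have := rate_nonneg (g₀ := g₀) (β := β) lam ψ k j
    positivity
  · have h1 : inner ℂ (ψ k) ((isInteraction lam ψ hβ hg).propagator ε (ψ j)) =
        -(Complex.I * ε) * inner ℂ (ψ k) (bornOp lam ψ β g₀ T (ψ j)) + inner ℂ (ψ k) R := by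
      rw [hR, inner_sub_right, inner_sub_right, inner_smul_right, ψ.orthonormal.2 hk]
      ring
    have h2 := abs_sq_norm_sub_le h1
    rw [norm_inner_bornOp_sq lam ψ hβ hg] at h2
    rw [hDk, limitMatrix_of_ne lam ψ (Ne.symm hk), if_neg hk, stepMatrix]
    simpa using h2
  · have h1 := rate_tsum_col_le lam ψ hβ hg j
    have h2 : (1 / |ε| + 1) * ‖R‖ ^ 2 ≤ 2 * |ε| ^ 3 := by
      calc (1 / |ε| + 1) * ‖R‖ ^ 2 ≤ (1 / |ε| + 1) * (|ε| ^ 2) ^ 2 := by gcongr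
        _ = |ε| ^ 3 + |ε| ^ 3 * |ε| := by
          rcases hε0.eq_or_lt with h0 | h0
          · rw [← h0]; simp
          · field_simp
        _ ≤ |ε| ^ 3 + |ε| ^ 3 * 1 := by gcongr
        _ = _ := by ring
    have h3 : |ε| ^ 3 * ‖bornOp lam ψ β g₀ T (ψ j)‖ ^ 2 ≤ |ε| ^ 3 * 1 := by gcongr
    linarith

end Matrices

end PowerDiffusion
namespace PowerDiffusion

/-! ### Isolated subsystems, and the block generated by the defects. -/

section Block

variable {H : Type*} [NormedAddCommGroup H] [InnerProductSpace ℂ H] [CompleteSpace H]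
  (lam : ℕ → ℝ) (ψ : HilbertBasis ℕ ℂ H) {β : H →L[ℂ] H} {g₀ : ℝ → ℝ} {T : ℝ}

/-- The reflection that changes the sign of the modes in `I`. -/
noncomputable def modeReflection (I : Set ℕ) : H ≃ₗᵢ[ℂ] H :=
  -- The phase at time one is `e^{-iπ} = -1` on `I` and `1` elsewhere.
  open Classical in freeEvol (fun j => if j ∈ I then Real.pi else 0) ψ 1

theorem inner_modeReflection (I : Set ℕ) [DecidablePred (· ∈ I)] (k : ℕ) (x : H) :
    inner ℂ (ψ k) (modeReflection ψ I x) = (if k ∈ I then -1 else 1) * inner ℂ (ψ k) x := by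
  rw [modeReflection, inner_freeEvol]
  congr 1
  split_ifs
  · rw [mul_one, Complex.exp_neg, mul_comm, Complex.exp_pi_mul_I]; norm_num
  · simp

variable {I : Set ℕ}

theorem modeReflection_coupling (hβ : NormalizedCoupling β) (hI : IsIsolated ψ β I) (x : H) :
    modeReflection ψ I (β x) = β (modeReflection ψ I x) := by
  classical
  have hsym := ContinuousLinearMap.isSelfAdjoint_iff_isSymmetric.1 hβ.selfAdjoint
  refine hilbertBasis_ext ψ fun k => ?_
  have hexp : ∀ y, HasSum (fun j => coupling ψ β k j * inner ℂ (ψ j) y)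
      (inner ℂ (ψ k) (β y)) := fun y => by
    have h := ψ.hasSum_inner_mul_inner (β (ψ k)) y
    rw [show inner ℂ (β (ψ k)) y = inner ℂ (ψ k) (β y) from hsym _ _] at h
    refine h.congr_fun fun j => ?_
    rw [coupling, show inner ℂ (β (ψ k)) (ψ j) = inner ℂ (ψ k) (β (ψ j)) from hsym _ _]
  rw [inner_modeReflection]
  refine ((hexp x).mul_left _).unique ((hexp (modeReflection ψ I x)).congr_fun fun j => ?_)
  rw [inner_modeReflection]
  by_cases hk : k ∈ I <;> by_cases hj : j ∈ I
  · simp [hk, hj]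
  · simp [hI k hk j hj]
  · have : coupling ψ β k j = 0 := by
      rw [coupling_conj ψ hβ j k, hI j hj k hk, map_zero]
    simp [this]
  · simp [hk, hj]

theorem modeReflection_freeEvol (t : ℝ) (x : H) :
    modeReflection ψ I (freeEvol lam ψ t x) = freeEvol lam ψ t (modeReflection ψ I x) := by
  classical
  refine hilbertBasis_ext ψ fun k => ?_
  simp only [inner_modeReflection, inner_freeEvol]
  ring

/-- When `I` is isolated, the reflection commutes with `β` and with the free evolution, hence with
the propagator. Amplitudes between modes of opposite sign therefore equal their own negatives. -/
theorem stepMatrix_eq_zero (hβ : NormalizedCoupling β) (hg : DefectProfile g₀ T)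
    (hI : IsIsolated ψ β I) (ε : ℝ) {k j : ℕ} (hkj : ¬(k ∈ I ↔ j ∈ I)) :
    stepMatrix lam ψ hβ hg ε k j = 0 := by
  classical
  set W := (isInteraction lam ψ hβ hg).propagator ε with hW
  have hcomm : W (modeReflection ψ I (ψ j)) = modeReflection ψ I (W (ψ j)) :=
    (isInteraction lam ψ hβ hg).propagator_comm
      ((modeReflection ψ I).toContinuousLinearEquiv : H →L[ℂ] H) (fun s z => by
        change modeReflection ψ I (interaction lam ψ β s z) =
          interaction lam ψ β s (modeReflection ψ I z)
        simp only [interaction_apply, modeReflection_freeEvol, modeReflection_coupling ψ hβ hI])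
      (ψ j)
  have hj : modeReflection ψ I (ψ j) = (if j ∈ I then (-1 : ℂ) else 1) • ψ j := by
    refine hilbertBasis_ext ψ fun l => ?_
    rw [inner_modeReflection, inner_smul_right]
    by_cases hl : l = j
    · rw [hl]
    · rw [ψ.orthonormal.2 hl, mul_zero, mul_zero]
  have h1 := congrArg (fun y => inner ℂ (ψ k) y) hcomm
  simp only [hj, map_smul, inner_smul_right, inner_modeReflection] at h1
  have h2 : inner ℂ (ψ k) (W (ψ j)) = 0 := by
    by_cases hk : k ∈ I <;> by_cases hj : j ∈ I
    · exact absurd (iff_of_true hk hj) hkj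
    · simp only [hk, hj, if_true, if_false, one_mul, neg_one_mul] at h1
      exact self_eq_neg.1 h1
    · simp only [hk, hj, if_true, if_false, one_mul, neg_one_mul] at h1
      exact self_eq_neg.1 h1.symm
    · exact absurd (iff_of_false hk hj) hkj
  rw [stepMatrix, h2]
  simp

theorem isGeneratedBlock (hβ : NormalizedCoupling β) (hg : DefectProfile g₀ T) (hinf : I.Infinite)
    (hirr : IsIrreducibleBlock (bEntry lam ψ β g₀) I) :
    IsGeneratedBlock (limitMatrix lam ψ β g₀) (stepMatrix lam ψ hβ hg) I (IsIsolated ψ β I) where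
  subK := limitMatrix_isSubstochastic lam ψ hβ hg
  symmK := limitMatrix_symm lam ψ hβ
  subM := stepMatrix_isSubstochastic lam ψ hβ hg
  approx := ⟨6, stepMatrix_approx lam ψ hβ hg⟩
  infinite := hinf
  block k hk j hj := by
    have hne : j ≠ k := fun h => hj (h ▸ hk)
    rw [limitMatrix, if_neg hne, hirr.block k hk j hj, sub_zero]
  row k := by
    have h := limitMatrix_hasSum_row lam ψ hβ hg (k : ℕ)
    rw [← hasSum_subtype_iff_of_support_subset (s := I)] at h
    · exact h.tsum_eq
    · intro j hj
      by_contra hjI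
      have hne : j ≠ k := fun h => hjI (h ▸ k.2)
      refine hj ?_
      change limitMatrix lam ψ β g₀ k j = 0
      rw [limitMatrix, if_neg hne, hirr.block k k.2 j hjI, sub_zero]
  irreducible J hJ hne hJ0 := by
    refine hirr.irreducible J hJ hne fun k hk j hj => ?_
    have hjk : j ≠ k := fun h => hj.2 (h ▸ hk)
    have h := hJ0 k hk j hj
    rw [limitMatrix, if_neg hjk] at h
    linarith
  isoBlock hI ε k hk j hj := stepMatrix_eq_zero lam ψ hβ hg hI ε fun h => hj (h.1 hk)
  isoCol hI ε j := by
    have h := stepMatrix_hasSum_col lam ψ hβ hg ε (j : ℕ)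
    rw [← hasSum_subtype_iff_of_support_subset (s := I)] at h
    · exact h.tsum_eq
    · intro k hk
      by_contra hkI
      exact hk (stepMatrix_eq_zero lam ψ hβ hg hI ε fun h => hkI (h.2 j.2))

end Block

end PowerDiffusion
namespace PowerDiffusion

/-! ### Phase averaging over an independent random gap. -/

section Probability

theorem IndepFun.prodMk_left {Ω α β γ : Type*} [MeasurableSpace Ω] [MeasurableSpace α]
    [MeasurableSpace β] [MeasurableSpace γ] {μ : Measure Ω} [IsProbabilityMeasure μ] {X : Ω → α}
    {Y : Ω → β} {Z : Ω → γ} (hX : Measurable X) (hY : Measurable Y) (hZ : Measurable Z)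
    (h : IndepFun X (fun ω => (Y ω, Z ω)) μ) (hYZ : IndepFun Y Z μ) :
    IndepFun (fun ω => (X ω, Y ω)) Z μ := by
  have : IsProbabilityMeasure (μ.map X) := Measure.isProbabilityMeasure_map hX.aemeasurable
  have : IsProbabilityMeasure (μ.map Y) := Measure.isProbabilityMeasure_map hY.aemeasurable
  have : IsProbabilityMeasure (μ.map Z) := Measure.isProbabilityMeasure_map hZ.aemeasurable
  have hXY : IndepFun X Y μ := h.comp measurable_id measurable_fst
  rw [indepFun_iff_map_prod_eq_prod_map_map (hX.prodMk hY).aemeasurable hZ.aemeasurable]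
  have h1 := (indepFun_iff_map_prod_eq_prod_map_map hX.aemeasurable
    (hY.prodMk hZ).aemeasurable).1 h
  rw [(indepFun_iff_map_prod_eq_prod_map_map hY.aemeasurable hZ.aemeasurable).1 hYZ] at h1
  rw [(indepFun_iff_map_prod_eq_prod_map_map hX.aemeasurable hY.aemeasurable).1 hXY]
  have h2 := congrArg (Measure.map (MeasurableEquiv.prodAssoc.symm : α × β × γ ≃ᵐ (α × β) × γ)) h1
  rw [Measure.map_map (MeasurableEquiv.measurable _) (hX.prodMk (hY.prodMk hZ))] at h2
  have h3 := (measurePreserving_prodAssoc (μ.map X) (μ.map Y) (μ.map Z)).symm.map_eq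
  rw [h3] at h2
  exact h2

variable {H : Type*} [NormedAddCommGroup H] [InnerProductSpace ℂ H]

/-- Second countability identifies the Borel and product σ-algebras on `H × ℝ`, so that jointly
continuous maps are measurable for the product. -/
theorem secondCountable_of_hilbertBasis (ψ : HilbertBasis ℕ ℂ H) : SecondCountableTopology H := by
  have h1 : TopologicalSpace.IsSeparable (Submodule.span ℂ (Set.range ψ) : Set H) :=
    (Set.countable_range ψ).isSeparable.span
  have h2 := h1.closure
  rw [← Submodule.topologicalClosure_coe, ψ.dense_span, Submodule.top_coe,
    TopologicalSpace.isSeparable_univ_iff] at h2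
  exact UniformSpace.secondCountable_of_separable H

variable [CompleteSpace H] (lam : ℕ → ℝ) (ψ : HilbertBasis ℕ ℂ H)

/-- Averaging over a random free evolution that mixes the phases of any two distinct modes removes
all interferences between modes. -/
theorem hasSum_integral_freeEvol {ν : Measure ℝ} [IsProbabilityMeasure ν]
    (hν : ∀ j k, j ≠ k → ∫ s, Complex.exp (Complex.I * ((lam j - lam k : ℝ) : ℂ) * (s : ℂ)) ∂ν = 0)
    (x y : H) :
    HasSum (fun j => ‖inner ℂ y (ψ j)‖ ^ 2 * ‖inner ℂ (ψ j) x‖ ^ 2)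
      (∫ s, ‖inner ℂ y (freeEvol lam ψ s x)‖ ^ 2 ∂ν) := by
  set z : ℕ → ℂ := fun j => inner ℂ y (ψ j) * inner ℂ (ψ j) x with hz
  have hzs : Summable fun j => ‖z j‖ := (ψ.summable_inner_mul_inner y x).norm
  -- The terms of the double series for `|∑ z_j e^{-iλ_j s}|²`. It converges absolutely, uniformly
  -- in `s`, so it can be integrated termwise; only the diagonal survives the mixing.
  set F : ℕ × ℕ → ℝ → ℂ := fun p s => z p.2 * starRingEnd ℂ (z p.1) *
    Complex.exp (Complex.I * ((lam p.1 - lam p.2 : ℝ) : ℂ) * (s : ℂ)) with hF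
  have hFn : ∀ p s, ‖F p s‖ = ‖z p.2‖ * ‖z p.1‖ := fun p s => by
    have h1 : Complex.exp (Complex.I * ((lam p.1 - lam p.2 : ℝ) : ℂ) * (s : ℂ)) =
        Complex.exp (-(Complex.I * ((-((lam p.1 - lam p.2) * s) : ℝ) : ℂ))) := by
      congr 1; push_cast; ring
    simp only [hF]
    rw [norm_mul, norm_mul, RCLike.norm_conj, h1, norm_phase, mul_one]
  have hFs : Summable fun p : ℕ × ℕ => ‖z p.2‖ * ‖z p.1‖ := by
    have := hzs.mul_norm hzs
    simpa [mul_comm] using this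
  have hFi : ∀ p, Integrable (F p) ν := fun p =>
    Integrable.of_bound (by
      have : Continuous (F p) := by simp only [hF]; fun_prop
      exact this.aestronglyMeasurable) _ (ae_of_all _ fun s => (hFn p s).le)
  have hexp : ∀ s, HasSum (fun p => F p s)
      ((‖inner ℂ y (freeEvol lam ψ s x)‖ ^ 2 : ℝ) : ℂ) := fun s => by
    have h1 : HasSum (fun j => z j * Complex.exp (-(Complex.I * ((lam j * s : ℝ) : ℂ))))
        (inner ℂ y (freeEvol lam ψ s x)) := by
      refine (ψ.hasSum_inner_mul_inner y (freeEvol lam ψ s x)).congr_fun fun j => ?_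
      rw [inner_freeEvol]
      simp only [hz]
      ring
    have h2 : HasSum (fun j => starRingEnd ℂ
        (z j * Complex.exp (-(Complex.I * ((lam j * s : ℝ) : ℂ)))))
        (starRingEnd ℂ (inner ℂ y (freeEvol lam ψ s x))) :=
      h1.mapL Complex.conjCLE.toContinuousLinearMap
    have h4 : ∀ p : ℕ × ℕ, F p s = starRingEnd ℂ
        (z p.1 * Complex.exp (-(Complex.I * ((lam p.1 * s : ℝ) : ℂ)))) *
        (z p.2 * Complex.exp (-(Complex.I * ((lam p.2 * s : ℝ) : ℂ)))) := fun p => by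
      have e : Complex.exp (Complex.I * ((lam p.1 - lam p.2 : ℝ) : ℂ) * (s : ℂ)) =
          Complex.exp (Complex.I * ((lam p.1 * s : ℝ) : ℂ)) *
            Complex.exp (-(Complex.I * ((lam p.2 * s : ℝ) : ℂ))) := by
        rw [← Complex.exp_add]; congr 1; push_cast; ring
      simp only [hF, map_mul, ← Complex.exp_conj, map_neg, Complex.conj_I, Complex.conj_ofReal, e]
      ring_nf
    have h3 := h2.mul h1 (by
      refine Summable.of_norm ?_
      refine hFs.congr fun p => ?_
      rw [← h4, hFn])
    rw [mul_comm, Complex.mul_conj, Complex.normSq_eq_norm_sq] at h3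
    exact h3.congr_fun h4
  have hmain := hasSum_integral_of_summable_integral_norm hFi (by
    simpa only [hFn, integral_const, probReal_univ, one_smul] using hFs)
  have h5 : ∀ s, ∑' p, F p s = ((‖inner ℂ y (freeEvol lam ψ s x)‖ ^ 2 : ℝ) : ℂ) :=
    fun s => (hexp s).tsum_eq
  simp only [h5] at hmain
  have h6 : Function.Injective fun j : ℕ => (j, j) := fun i j h => congrArg Prod.fst h
  have h7 : ∀ p ∉ Set.range fun j : ℕ => (j, j), ∫ s, F p s ∂ν = 0 := fun p hp => by
    have hne : p.1 ≠ p.2 := fun h => hp ⟨p.1, Prod.ext rfl h⟩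
    simp only [hF]
    rw [integral_const_mul, hν _ _ hne, mul_zero]
  have h8 := (h6.hasSum_iff h7).2 hmain
  have h9 : ∀ j, ((‖inner ℂ y (ψ j)‖ ^ 2 * ‖inner ℂ (ψ j) x‖ ^ 2 : ℝ) : ℂ) =
      ((fun p => ∫ s, F p s ∂ν) ∘ fun j : ℕ => (j, j)) j := fun j => by
    simp only [Function.comp, hF, sub_self, Complex.ofReal_zero, mul_zero, zero_mul,
      Complex.exp_zero, mul_one, integral_const, probReal_univ, one_smul]
    rw [Complex.mul_conj, Complex.normSq_eq_norm_sq, hz]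
    simp only
    rw [norm_mul, mul_pow]
  have h10 := h8.congr_fun h9
  exact_mod_cast h10

variable [MeasurableSpace H] [BorelSpace H] {Ω : Type*} [MeasurableSpace Ω] {μ : Measure Ω}

omit [CompleteSpace H] [MeasurableSpace H] [BorelSpace H] in
theorem integrable_inner_sq {X : Ω → H} (hX : MemLp X 2 μ) (y : H) :
    Integrable (fun ω => ‖inner ℂ y (X ω)‖ ^ 2) μ := by
  have h : MemLp (fun ω => inner ℂ y (X ω)) 2 μ := (innerSL ℂ y).comp_memLp' hX
  exact h.norm.integrable_sq

omit [CompleteSpace H] [MeasurableSpace H] [BorelSpace H] in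
theorem summable_integral_inner_sq {X : Ω → H} (hX : MemLp X 2 μ) :
    Summable fun j => ∫ ω, ‖inner ℂ (ψ j) (X ω)‖ ^ 2 ∂μ := by
  refine summable_of_sum_le (c := ∫ ω, ‖X ω‖ ^ 2 ∂μ)
    (fun j => integral_nonneg fun ω => sq_nonneg _) fun s => ?_
  rw [← integral_finsetSum _ fun j _ => integrable_inner_sq hX (ψ j)]
  refine integral_mono (integrable_finsetSum _ fun j _ => integrable_inner_sq hX (ψ j))
    hX.norm.integrable_sq fun ω => ?_
  exact sum_le_hasSum s (fun j _ => sq_nonneg _) (hilbertBasis_hasSum_norm_sq ψ (X ω))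

/-- The expected mode powers after an independent phase mixing free evolution. -/
theorem hasSum_integral_inner_freeEvol [IsProbabilityMeasure μ] {X : Ω → H} {D : Ω → ℝ}
    (hX : Measurable X) (hX2 : MemLp X 2 μ) (hD : Measurable D) (hXD : IndepFun X D μ)
    (hmix : ∀ j k, j ≠ k →
      ∫ ω, Complex.exp (Complex.I * ((lam j - lam k : ℝ) : ℂ) * (D ω : ℂ)) ∂μ = 0) (y : H) :
    HasSum (fun j => ‖inner ℂ y (ψ j)‖ ^ 2 * ∫ ω, ‖inner ℂ (ψ j) (X ω)‖ ^ 2 ∂μ)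
      (∫ ω, ‖inner ℂ y (freeEvol lam ψ (D ω) (X ω))‖ ^ 2 ∂μ) := by
  have : SecondCountableTopology H := secondCountable_of_hilbertBasis ψ
  have : IsProbabilityMeasure (μ.map D) := Measure.isProbabilityMeasure_map hD.aemeasurable
  have : IsProbabilityMeasure (μ.map X) := Measure.isProbabilityMeasure_map hX.aemeasurable
  set G : H × ℝ → ℝ := fun p => ‖inner ℂ y (freeEvol lam ψ p.2 p.1)‖ ^ 2 with hG
  have hGc : Continuous G :=
    ((continuous_const.inner ((continuous_freeEvol lam ψ).comp continuous_swap)).norm).pow 2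
  have hUX : MemLp (fun ω => freeEvol lam ψ (D ω) (X ω)) 2 μ := by
    refine hX2.of_le ((continuous_freeEvol lam ψ).measurable.comp
      (hD.prodMk hX)).aestronglyMeasurable (ae_of_all _ fun ω => ?_)
    rw [LinearIsometryEquiv.norm_map]
  have hGi : Integrable G (μ.map fun ω => (X ω, D ω)) :=
    (integrable_map_measure hGc.aestronglyMeasurable (hX.prodMk hD).aemeasurable).2
      (integrable_inner_sq hUX y)
  have hprod := (indepFun_iff_map_prod_eq_prod_map_map hX.aemeasurable hD.aemeasurable).1 hXD
  have hν : ∀ j k, j ≠ k →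
      ∫ s, Complex.exp (Complex.I * ((lam j - lam k : ℝ) : ℂ) * (s : ℂ)) ∂(μ.map D) = 0 :=
    fun j k hjk => by
      rw [integral_map hD.aemeasurable (by
        have : Continuous fun s : ℝ =>
          Complex.exp (Complex.I * ((lam j - lam k : ℝ) : ℂ) * (s : ℂ)) := by fun_prop
        exact this.aestronglyMeasurable)]
      exact hmix j k hjk
  have h1 : ∫ ω, ‖inner ℂ y (freeEvol lam ψ (D ω) (X ω))‖ ^ 2 ∂μ =
      ∫ ω, ∑' j, ‖inner ℂ y (ψ j)‖ ^ 2 * ‖inner ℂ (ψ j) (X ω)‖ ^ 2 ∂μ := by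
    have h2 : ∫ ω, ‖inner ℂ y (freeEvol lam ψ (D ω) (X ω))‖ ^ 2 ∂μ =
        ∫ p, G p ∂(μ.map fun ω => (X ω, D ω)) :=
      (integral_map (hX.prodMk hD).aemeasurable hGc.aestronglyMeasurable).symm
    rw [hprod] at hGi
    -- By independence the joint law is a product; Fubini fixes the state and averages over the gap
    -- first.
    rw [h2, hprod, integral_prod _ hGi, integral_map hX.aemeasurable
      hGi.integral_prod_left.aestronglyMeasurable]
    refine integral_congr_ae (ae_of_all _ fun ω => ?_)
    exact (hasSum_integral_freeEvol lam ψ hν (X ω) y).tsum_eq.symm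
  rw [h1]
  have h3 := hasSum_integral_of_summable_integral_norm (μ := μ)
    (F := fun j ω => ‖inner ℂ y (ψ j)‖ ^ 2 * ‖inner ℂ (ψ j) (X ω)‖ ^ 2)
    (fun j => (integrable_inner_sq hX2 (ψ j)).const_mul _) (by
      simp only [norm_mul, norm_pow, norm_norm, integral_const_mul]
      refine Summable.of_nonneg_of_le (fun j => mul_nonneg (sq_nonneg _)
        (integral_nonneg fun ω => sq_nonneg _)) (fun j => ?_)
        ((summable_integral_inner_sq ψ hX2).mul_left (‖y‖ ^ 2))
      refine mul_le_mul_of_nonneg_right ?_ (integral_nonneg fun ω => sq_nonneg _)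
      gcongr
      refine (norm_inner_le_norm y (ψ j)).trans ?_
      rw [ψ.orthonormal.1 j, mul_one])
  simpa only [integral_const_mul] using h3

end Probability

/-! ### The mean powers as an exact Markov chain. -/

section Evolution

variable {H : Type*} [NormedAddCommGroup H] [InnerProductSpace ℂ H] [CompleteSpace H]
  (lam : ℕ → ℝ) (ψ : HilbertBasis ℕ ℂ H) {β : H →L[ℂ] H} {g₀ : ℝ → ℝ} {T : ℝ}
  (hβ : NormalizedCoupling β) (hg : DefectProfile g₀ T)

/-- The state after `n` defects, as a function of the initial state and of the gaps. -/
noncomputable def stateAfter (ε : ℝ) (x : H) (δ : ℕ → ℝ) : ℕ → H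
  | 0 => x
  | n + 1 => freeEvol lam ψ T ((isInteraction lam ψ hβ hg).propagator ε
      (freeEvol lam ψ (δ n) (stateAfter ε x δ n)))

theorem norm_stateAfter (ε : ℝ) (x : H) (δ : ℕ → ℝ) (n : ℕ) :
    ‖stateAfter lam ψ hβ hg ε x δ n‖ = ‖x‖ := by
  induction n with
  | zero => rfl
  | succ n ih =>
    rw [stateAfter, LinearIsometryEquiv.norm_map, LinearIsometry.norm_map,
      LinearIsometryEquiv.norm_map, ih]

theorem IsSolution.eq_stateAfter {Ω : Type*} [MeasurableSpace Ω] {d : ℕ → Ω → ℝ} {ω : Ω}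
    {H₀ : H →ₗ.[ℂ] H} {ε : ℝ} {φ₀ : H} {φ : ℝ → H} (hH₀ : PurePoint H₀ lam ψ) (hd : ∀ l, 0 ≤ d l ω)
    (hφ : IsSolution H₀ β ε (defectTrain g₀ d T ω) φ₀ φ) (n : ℕ) :
    φ (gapStart d T n ω) = stateAfter lam ψ hβ hg ε φ₀ (fun l => d l ω) n := by
  induction n with
  | zero => rw [gapStart_zero, hφ.initial, stateAfter]
  | succ n ih => rw [hφ.step_eq hH₀ hβ hd hg, ih, stateAfter]

variable [MeasurableSpace H] [BorelSpace H]

/-- The state after `n` defects depends measurably on the initial state and the first `n` gaps only,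
and is therefore independent of the gap `d n`. -/
theorem stateAfter_factor (ε : ℝ) (n : ℕ) :
    ∃ F : H × (Finset.range n → ℝ) → H, Measurable F ∧
      ∀ x δ, stateAfter lam ψ hβ hg ε x δ n = F (x, fun i => δ i) := by
  have : SecondCountableTopology H := secondCountable_of_hilbertBasis ψ
  induction n with
  | zero => exact ⟨Prod.fst, measurable_fst, fun x δ => rfl⟩
  | succ n ih =>
    obtain ⟨F, hF, hFe⟩ := ih
    refine ⟨fun p => freeEvol lam ψ T ((isInteraction lam ψ hβ hg).propagator ε
      (freeEvol lam ψ (p.2 ⟨n, Finset.self_mem_range_succ n⟩)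
        (F (p.1, fun i => p.2 ⟨i, Finset.mem_range.2
          ((Finset.mem_range.1 i.2).trans (Nat.lt_succ_self n))⟩)))), ?_, fun x δ => ?_⟩
    · refine ((freeEvol lam ψ T).continuous.comp
        ((isInteraction lam ψ hβ hg).propagator ε).continuous).measurable.comp
        ((continuous_freeEvol lam ψ).measurable.comp (Measurable.prodMk ?_ (hF.comp ?_)))
      · exact (measurable_pi_apply _).comp measurable_snd
      · exact measurable_fst.prodMk (measurable_pi_lambda _ fun i =>
          (measurable_pi_apply _).comp measurable_snd)
    · rw [stateAfter, hFe]

variable {Ω : Type*} [MeasurableSpace Ω] {μ : Measure Ω} {d : ℕ → Ω → ℝ} {φ₀ : Ω → H}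

theorem memLp_stateAfter (hd : ∀ l, Measurable (d l)) (hm : Measurable φ₀) (hφ₀ : MemLp φ₀ 2 μ)
    (ε : ℝ) (n : ℕ) :
    MemLp (fun ω => stateAfter lam ψ hβ hg ε (φ₀ ω) (fun l => d l ω) n) 2 μ := by
  have : SecondCountableTopology H := secondCountable_of_hilbertBasis ψ
  obtain ⟨F, hF, hFe⟩ := stateAfter_factor lam ψ hβ hg ε n
  simp only [hFe]
  refine hφ₀.of_le (hF.comp (hm.prodMk
    (measurable_pi_lambda _ fun i => hd i))).aestronglyMeasurable (ae_of_all _ fun ω => ?_)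
  rw [← hFe (φ₀ ω) fun l => d l ω, norm_stateAfter]

/-- The expected mode powers evolve by the transition matrix of a single defect. -/
theorem hasSum_power_succ [IsProbabilityMeasure μ] (hd : PhaseMixing μ d lam) (hm : Measurable φ₀)
    (hφ₀ : MemLp φ₀ 2 μ) (hindep : IndepFun φ₀ (fun ω l => d l ω) μ) (ε : ℝ) (n k : ℕ) :
    HasSum (fun j => stepMatrix lam ψ hβ hg ε k j *
        ∫ ω, ‖inner ℂ (ψ j) (stateAfter lam ψ hβ hg ε (φ₀ ω) (fun l => d l ω) n)‖ ^ 2 ∂μ)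
      (∫ ω, ‖inner ℂ (ψ k)
        (stateAfter lam ψ hβ hg ε (φ₀ ω) (fun l => d l ω) (n + 1))‖ ^ 2 ∂μ) := by
  obtain ⟨F, hF, hFe⟩ := stateAfter_factor lam ψ hβ hg ε n
  set Y : Ω → (Finset.range n → ℝ) := fun ω i => d i ω with hY
  have hYm : Measurable Y := measurable_pi_lambda _ fun i => hd.measurable i
  set X : Ω → H := fun ω => stateAfter lam ψ hβ hg ε (φ₀ ω) (fun l => d l ω) n with hX
  have hXF : X = F ∘ fun ω => (φ₀ ω, Y ω) := funext fun ω => hFe _ _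
  have hXm : Measurable X := by rw [hXF]; exact hF.comp (hm.prodMk hYm)
  have hX2 : MemLp X 2 μ := memLp_stateAfter lam ψ hβ hg hd.measurable hm hφ₀ ε n
  have hYd : IndepFun Y (d n) μ := by
    have h := hd.indep.indepFun_finset (Finset.range n) {n} (by simp) hd.measurable
    exact h.comp measurable_id (measurable_pi_apply (⟨n, Finset.mem_singleton_self n⟩ :
      ({n} : Finset ℕ)))
  have hφYd : IndepFun φ₀ (fun ω => (Y ω, d n ω)) μ := by
    have hmeas : Measurable fun δ : ℕ → ℝ => ((fun i : Finset.range n => δ i), δ n) :=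
      (measurable_pi_lambda _ fun i => measurable_pi_apply _).prodMk (measurable_pi_apply _)
    exact hindep.comp measurable_id hmeas
  have hXd : IndepFun X (d n) μ := by
    rw [hXF]
    exact (IndepFun.prodMk_left hm hYm (hd.measurable n) hφYd hYd).comp hF measurable_id
  -- The test vector is the adjoint propagator applied to `ψ k`. The free evolution during the
  -- defect comes last and does not change mode powers, so it drops out.
  have h := hasSum_integral_inner_freeEvol lam ψ hXm hX2 (hd.measurable n) hXd
    (fun j k hjk => hd.mixing n j k hjk) (adjointVector lam ψ hβ hg ε k)
  simp only [inner_adjointVector] at h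
  simp only [stateAfter, norm_inner_freeEvol]
  exact h

theorem pow_stepMatrix_apply [IsProbabilityMeasure μ] (hd : PhaseMixing μ d lam)
    (hm : Measurable φ₀) (hφ₀ : MemLp φ₀ 2 μ) (hindep : IndepFun φ₀ (fun ω l => d l ω) μ)
    (ε : ℝ) (n k : ℕ) :
    ((stepMatrix_isSubstochastic lam ψ hβ hg ε).toEllOne ^ n)
        (ellOneMk _ (summable_integral_inner_sq ψ hφ₀)) k =
      ∫ ω, ‖inner ℂ (ψ k) (stateAfter lam ψ hβ hg ε (φ₀ ω) (fun l => d l ω) n)‖ ^ 2 ∂μ := by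
  induction n generalizing k with
  | zero => rw [pow_zero, one_apply_eq_self, ellOneMk_apply]; rfl
  | succ n ih =>
    rw [pow_succ', mul_apply_eq_comp]
    refine ((stepMatrix_isSubstochastic lam ψ hβ hg ε).toEllOne_hasSum _ k).unique ?_
    simp only [ih]
    exact hasSum_power_succ lam ψ hβ hg hd hm hφ₀ hindep ε n k

end Evolution

end PowerDiffusion

/-! ### The theorem: assembly of the regimes. -/

open PowerDiffusion in
theorem corollary3p2
    {H : Type*} [NormedAddCommGroup H] [InnerProductSpace ℂ H] [CompleteSpace H]
    [MeasurableSpace H] [BorelSpace H]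
    {Ω : Type*} [MeasurableSpace Ω] (μ : Measure Ω) [IsProbabilityMeasure μ]
    (H₀ : H →ₗ.[ℂ] H) (lam : ℕ → ℝ) (ψ : HilbertBasis ℕ ℂ H) (hH₀ : PurePoint H₀ lam ψ)
    (β : H →L[ℂ] H) (hβ : NormalizedCoupling β)
    (g₀ : ℝ → ℝ) (T : ℝ) (hg₀ : DefectProfile g₀ T)
    (d : ℕ → Ω → ℝ) (hd : PhaseMixing μ d lam)
    -- the initial state: random with finite mean power, independent of the gaps
    (φ₀ : Ω → H) (hφ₀ : MemLp φ₀ 2 μ) (hindep : IndepFun φ₀ (fun ω l => d l ω) μ)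
    -- for every size of the perturbation, the solution of the random Schrödinger equation
    (φ : ℝ → Ω → ℝ → H)
    (hφ : ∀ ε ω, IsSolution H₀ β ε (defectTrain g₀ d T ω) (φ₀ ω) (φ ε ω))
    -- an irreducible subsystem with infinitely many bound states
    (I : Set ℕ) (hI : I.Infinite) (hirr : IsIrreducibleBlock (bEntry lam ψ β g₀) I) :
    -- `B` is a bounded operator on `ℓ¹`, and the power vectors lie in `ℓ¹`
    ∃ (B : EllOne I →L[ℝ] EllOne I) (P0 : EllOne I) (P : ℝ → ℕ → EllOne I),
      (∀ (v : EllOne I) (k : I), HasSum (fun j : I => bEntry lam ψ β g₀ k j * v j) (B v k)) ∧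
      (∀ k : I, Integrable (fun ω => ‖inner ℂ (ψ k) (φ₀ ω)‖ ^ 2) μ ∧
        P0 k = ∫ ω, ‖inner ℂ (ψ k) (φ₀ ω)‖ ^ 2 ∂μ) ∧
      -- `P ε n` is the expected power vector at any time between the `n`-th defect and the next
      (∀ (ε : ℝ) (n : ℕ) (θ : Ω → ℝ),
        (∀ ω, θ ω ∈ Set.Icc (gapStart d T n ω) (onset d T n ω)) → ∀ k : I,
          Integrable (fun ω => ‖inner ℂ (ψ k) (φ ε ω (θ ω))‖ ^ 2) μ ∧
          P ε n k = ∫ ω, ‖inner ℂ (ψ k) (φ ε ω (θ ω))‖ ^ 2 ∂μ) ∧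
      -- `n ≪ ε⁻²`
      (∀ (ε : ℕ → ℝ) (n : ℕ → ℕ), Tendsto ε atTop (𝓝 0) →
        Tendsto (fun m => (n m : ℝ) * ε m ^ 2) atTop (𝓝 0) →
        Tendsto (fun m => P (ε m) (n m)) atTop (𝓝 P0)) ∧
      -- `n = τ ε⁻²`
      (∀ (τ : ℝ) (ε : ℕ → ℝ) (n : ℕ → ℕ), Tendsto ε atTop (𝓝 0) →
        Tendsto (fun m => (n m : ℝ) * ε m ^ 2) atTop (𝓝 τ) →
        Tendsto (fun m => P (ε m) (n m)) atTop (𝓝 (NormedSpace.exp (-(τ • B)) P0))) ∧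
      -- conservation of the total power
      (IsIsolated ψ β I → ∀ (ε : ℝ) (n : ℕ), ∑' k, P ε n k = ∑' k, P0 k) ∧
      -- `n ≫ ε⁻²`
      (∀ (ε : ℕ → ℝ) (n : ℕ → ℕ), LongRegime (IsIsolated ψ β I) ε n →
        Tendsto (fun m => toEllTwo (P (ε m) (n m))) atTop (𝓝 0) ∧
        (P0 ≠ 0 → ¬ ∃ Q : EllOne I, Tendsto (fun m => P (ε m) (n m)) atTop (𝓝 Q)) ∧
        Tendsto (fun m => ∑' k, P (ε m) (n m) k) atTop (𝓝 (∑' k, P0 k)) ∧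
        ∀ N : ℕ,
          Tendsto (fun m => ∑' k : I, if N ≤ (k : ℕ) then P (ε m) (n m) k else 0) atTop
            (𝓝 (∑' k, P0 k)) ∧
          Tendsto (fun m => ∑' k : I, if (k : ℕ) ≤ N then P (ε m) (n m) k else 0) atTop
            (𝓝 0)) := by
  -- The initial state is only almost everywhere strongly measurable; a measurable modification has
  -- the same powers and the same independence.
  have hm : Measurable (hφ₀.1.mk φ₀) := hφ₀.1.stronglyMeasurable_mk.measurable
  have hae : φ₀ =ᵐ[μ] hφ₀.1.mk φ₀ := hφ₀.1.ae_eq_mk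
  have hφm : MemLp (hφ₀.1.mk φ₀) 2 μ := hφ₀.ae_eq hae
  have hind : IndepFun (hφ₀.1.mk φ₀) (fun ω l => d l ω) μ := hindep.congr hae EventuallyEq.rfl
  have h := isGeneratedBlock lam ψ hβ hg₀ hI hirr
  set p := ellOneMk _ (summable_integral_inner_sq ψ hφm) with hp
  have hP0 : ∀ k : I, ellOneRestrict I p k = ∫ ω, ‖inner ℂ (ψ k) (φ₀ ω)‖ ^ 2 ∂μ := fun k => by
    rw [ellOneRestrict_apply, hp, ellOneMk_apply]
    refine integral_congr_ae ?_
    filter_upwards [hae] with ω hω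
    rw [hω]
  refine ⟨h.gen, ellOneRestrict I p, h.evol p, fun v k => ?_,
    fun k => ⟨integrable_inner_sq hφ₀ _, hP0 k⟩, fun ε n θ hθ k => ?_, fun ε n hε hn => ?_,
    fun τ ε n hε hn => h.tendsto_evol p hε hn, fun hiso ε n => h.tsum_evol hiso p ε n,
    fun ε n hl => ?_⟩
  · have h1 := (h.subK.restrict I).toEllOne_hasSum v k
    have h2 := (hasSum_ite_eq k (v k)).sub h1
    refine h2.congr_fun fun j => ?_
    by_cases hjk : j = k
    · simp only [limitMatrix, hjk, if_true]; ring
    · have : (j : ℕ) ≠ k := fun e => hjk (Subtype.ext e)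
      simp only [limitMatrix, hjk, this, if_false]; ring
  -- Mode powers are constant during a gap, so the time `θ` may be replaced by the end of the last
  -- defect. This works pointwise, and `θ` need not be measurable.
  · have hst : (fun ω => ‖inner ℂ (ψ k) (stateAfter lam ψ hβ hg₀ ε (hφ₀.1.mk φ₀ ω)
        (fun l => d l ω) n)‖ ^ 2) =ᵐ[μ] fun ω => ‖inner ℂ (ψ k) (φ ε ω (θ ω))‖ ^ 2 := by
      filter_upwards [hae] with ω hω
      have hdω : ∀ l, 0 ≤ d l ω := fun l => hd.nonneg l ω
      rw [(hφ ε ω).gap_eq hH₀ hdω hg₀ n (hθ ω), norm_inner_freeEvol,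
        (hφ ε ω).eq_stateAfter lam ψ hβ hg₀ hH₀ hdω, hω]
    refine ⟨(integrable_inner_sq
      (memLp_stateAfter lam ψ hβ hg₀ hd.measurable hm hφm ε n) (ψ k)).congr hst, ?_⟩
    rw [← integral_congr_ae hst]
    exact pow_stepMatrix_apply lam ψ hβ hg₀ hd hm hφm hind ε n k
  -- The case `τ = 0`, where the semigroup is the identity.
  · simpa using h.tendsto_evol p hε hn
  · have h2 := h.tendsto_long_ellTwo p hl
    have h1 := h.tendsto_long_tsum p hl
    have hs := spreading (fun k => (hP0 k).symm ▸ integral_nonneg fun ω => sq_nonneg _) h2 h1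
    exact ⟨h2, hs.1, h1, hs.2⟩
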